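/- Conventions. A ringed space is a topological space $Y$ with a sheaf $\mathcal{O}_Y$ of continuous real-valued functions (a subalgebra $\mathcal{O}_Y(U)\subseteq C(U,\mathbb{R})$ for each open $U$, with membership local on open covers). A morphism $\varphi:Y\to Z$ is a continuous map such that $f\in\mathcal{O}_Z(V)$ implies $f\circ\varphi\in\mathcal{O}_Y(\varphi^{-1}(V))$ for all open $V\subseteq Z$; an isomorphism is a morphism with an inverse morphism. If $\sim$ is an equivalence relation on a smooth manifold $Y$ (for instance, lying in the same orbit of a group) with quotient map $\pi:Y\to Y/{\sim}$, the quotient $Y/{\sim}$ carries the quotient topology and the sheaf $V\mapsto\{f:V\to\mathbb{R}\mid f\circ\pi\in\mathcal{C}^\infty(\pi^{-1}(V))\}$. Let $n,r\ge 0$ be integers, let $X$ be an $n$-dimensional smooth manifold and let $x\in X$. Let $J^r_x\mathcal{C}$ (resp. $J^r_x\widetilde{\mathcal{C}}$) be the space of $r$-jets at $x$ of smooth linear connections (resp. symmetric, i.e. torsion-free, smooth linear connections) defined on neighbourhoods of $x$; its smooth structure is the one given by the partial derivatives up to order $r$ at $x$ of the Christoffel symbols in a chart. Let $\mathrm{Diff}_x$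 be the group of germs at $x$ of local diffeomorphisms of $X$ fixing $x$. It acts on jets through $(\tau\cdot\nabla)_D\bar D:=\tau_*^{-1}\bigl(\nabla_{\tau_*D}(\tau_*\bar D)\bigr)$. The moduli spaces are the quotient ringed spaces $$\mathfrak{C}^r_n:=J^r_x\mathcal{C}/\mathrm{Diff}_x,\qquad \widetilde{\mathfrak{C}}^r_n:=J^r_x\widetilde{\mathcal{C}}/\mathrm{Diff}_x .$$ For $m\ge 0$ let $C_m$ be the vector space of $(1,m+2)$-tensors $T^l_{ijk_1\dots k_m}$ on the $n$-dimensional vector space $T_xX\cong\mathbb{R}^n$ that are symmetric in the last $m$ covariant indices $k_1,\dots,k_m$ and whose symmetrization over all $m+2$ covariant indices is zero. Let $\widetilde C_m\subseteq C_m$ be the subspace of those that moreover satisfy $T^l_{ijk_1\dots k_m}=T^l_{jik_1\dots k_m}$. The group $\mathrm{Gl}_n$ acts linearly on these spaces by its natural action on tensors. **Theorem.** There are isomorphisms of ringed spaces $$\mathfrak{C}^r_n\simeq (C_0\times\cdots\times C_r)/\mathrm{Gl}_n,\qquad \widetilde{\mathfrak{C}}^r_n\simeq(\widetilde C_0\times\cdots\times\widetilde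 C_r)/\mathrm{Gl}_n .$$ -/

import Mathlib

open Set Filter Topology TopologicalSpace
open scoped Manifold ContDiff

noncomputable section

/-! ## Ringed spaces, in the sense of sheaves of continuous real functions -/

/-- The restriction map of an open set to a smaller one. -/
def openInclusion {X : Type*} [TopologicalSpace X] {V U : Opens X} (h : V ≤ U) : C(V, U) :=
  ⟨Set.inclusion h, continuous_inclusion h⟩

/-- The map `φ⁻¹(V) → V` induced by a continuous map `φ`. -/
def preimageMap {X Y : Type*} [TopologicalSpace X] [TopologicalSpace Y] (φ : C(X, Y))
    (V : Opens Y) : C(Opens.comap φ V, V) :=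
  ⟨fun p => ⟨φ p, p.2⟩, by fun_prop⟩

/-- A sheaf of continuous functions on `X`: a subalgebra of `C(U, ℝ)` for every open `U`, such
that membership can be tested on any open cover. A ringed space is a topological space together
with such a sheaf. -/
structure ContFunSheaf (X : Type*) [TopologicalSpace X] where
  sections : ∀ U : Opens X, Subalgebra ℝ C(U, ℝ)
  mem_iff_cover : ∀ (U : Opens X) (S : Set (Opens X)) (hS : sSup S = U) (f : C(U, ℝ)),
    f ∈ sections U ↔
      ∀ (V : Opens X) (hV : V ∈ S), f.comp (openInclusion (hS ▸ le_sSup hV)) ∈ sections V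

/-- A continuous map is a morphism of ringed spaces if it pulls sections back to sections. -/
def IsRingedMorphism {X Y : Type*} [TopologicalSpace X] [TopologicalSpace Y]
    (OX : ContFunSheaf X) (OY : ContFunSheaf Y) (φ : C(X, Y)) : Prop :=
  ∀ (V : Opens Y) (f : C(V, ℝ)), f ∈ OY.sections V →
    f.comp (preimageMap φ V) ∈ OX.sections (Opens.comap φ V)

/-- Two ringed spaces are isomorphic if there are mutually inverse morphisms between them. -/
def RingedIsomorphic {X Y : Type*} [TopologicalSpace X] [TopologicalSpace Y]
    (OX : ContFunSheaf X) (OY : ContFunSheaf Y) : Prop :=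
  ∃ (φ : C(X, Y)) (ψ : C(Y, X)), IsRingedMorphism OX OY φ ∧ IsRingedMorphism OY OX ψ ∧
    φ.comp ψ = ContinuousMap.id Y ∧ ψ.comp φ = ContinuousMap.id X

/-- The sheaf of smooth functions on a space `X` that is mapped by `c` into a normed space `W`:
the functions that are, locally, restrictions along `c` of smooth functions on `W`.
For `c = id` these are the smooth functions on open subsets of `W`; if `c` is a homeomorphism onto
a linear subspace (or submanifold) of a finite-dimensional `W`, they are the smooth functions for
the smooth structure of that subspace. -/
def smoothFunSheaf {X W : Type*} [TopologicalSpace X] [NormedAddCommGroup W] [NormedSpace ℝ W]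
    (c : X → W) : ContFunSheaf X where
  sections U :=
    { carrier := {f | ∀ p : U, ∃ g : W → ℝ, ContDiff ℝ ∞ g ∧ ∀ᶠ q : U in 𝓝 p, f q = g (c q)}
      mul_mem' := by
        intro f f' hf hf' p
        obtain ⟨g, hg, h⟩ := hf p
        obtain ⟨g', hg', h'⟩ := hf' p
        refine ⟨fun w => g w * g' w, hg.mul hg', ?_⟩
        filter_upwards [h, h'] with q h1 h2
        simp [h1, h2]
      add_mem' := by
        intro f f' hf hf' p
        obtain ⟨g, hg, h⟩ := hf p
        obtain ⟨g', hg', h'⟩ := hf' p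
        refine ⟨fun w => g w + g' w, hg.add hg', ?_⟩
        filter_upwards [h, h'] with q h1 h2
        simp [h1, h2]
      algebraMap_mem' := fun a p =>
        ⟨fun _ => a, contDiff_const, Eventually.of_forall fun _ => rfl⟩ }
  mem_iff_cover := by
    intro U S hS f
    constructor
    · intro hf V hV p
      have hVU : V ≤ U := hS ▸ le_sSup hV
      obtain ⟨g, hg, h⟩ := hf (openInclusion hVU p)
      exact ⟨g, hg, ((openInclusion hVU).continuous.tendsto p).eventually h⟩
    · intro hf p
      have hp : (p : X) ∈ sSup S := hS ▸ p.2
      obtain ⟨V, hV, hpV⟩ := Opens.mem_sSup.1 hp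
      have hVU : V ≤ U := hS ▸ le_sSup hV
      obtain ⟨g, hg, h⟩ := hf V hV ⟨p, hpV⟩
      refine ⟨g, hg, ?_⟩
      rw [nhds_subtype_eq_comap, eventually_comap] at h ⊢
      filter_upwards [h, V.isOpen.mem_nhds hpV] with a ha haV q hq
      subst hq
      exact ha ⟨q, haV⟩ rfl

/-- The direct image of a sheaf of continuous functions: the functions `f` on `V` such that
`f ∘ π` is a section on `π⁻¹(V)`. For a quotient map `π` and the sheaf of smooth functions this is
the quotient ringed space (a function `f` with `f ∘ π` smooth is then automatically continuous). -/
def ContFunSheaf.direct {X Y : Type*} [TopologicalSpace X] [TopologicalSpace Y]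
    (O : ContFunSheaf X) (π : C(X, Y)) : ContFunSheaf Y where
  sections V := (O.sections (Opens.comap π V)).comap
    (ContinuousMap.compRightAlgHom ℝ ℝ (preimageMap π V))
  mem_iff_cover := by
    intro U S hS f
    have hS' : sSup ((fun V => Opens.comap π V) '' S) = Opens.comap π U := by
      rw [sSup_image, ← hS, map_sSup, sSup_image]
    have key := O.mem_iff_cover (Opens.comap π U) _ hS' (f.comp (preimageMap π U))
    refine key.trans ⟨fun h V hV => h _ ⟨V, hV, rfl⟩, ?_⟩
    rintro h _ ⟨V, hV, rfl⟩
    exact h V hV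

/-! ## Normal tensors and the orbit space -/

section NormalTensors

variable (E : Type*) [NormedAddCommGroup E] [NormedSpace ℝ E]

/-- The natural representation of the general linear group on `(1, k)`-tensors of `E`, viewed as
`E`-valued `k`-linear maps: `(g • T)(v₁, …, v_k) = g (T (g⁻¹ v₁, …, g⁻¹ v_k))`. -/
def tensorRep (k : ℕ) : Representation ℝ (E ≃L[ℝ] E) (E [×k]→L[ℝ] E) where
  toFun g :=
    { toFun := fun T => (g : E →L[ℝ] E).compContinuousMultilinearMap
        (T.compContinuousLinearMap fun _ => (g⁻¹ : E ≃L[ℝ] E).toContinuousLinearMap)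
      map_add' := fun S T => by ext v; simp
      map_smul' := fun a T => by ext v; simp }
  map_one' := by ext T v; rfl
  map_mul' g h := by ext T v; rfl

/-- The space `C_m` of normal tensors of order `m`: the `(1, m + 2)`-tensors that are symmetric in
the last `m` covariant slots and whose symmetrization over all `m + 2` slots vanishes. -/
def normalTensors (m : ℕ) : Submodule ℝ (E [×(m + 2)]→L[ℝ] E) where
  carrier := {T |
    (∀ (σ : Equiv.Perm (Fin m)) (u v : E) (w : Fin m → E),
      T (Fin.cons u (Fin.cons v (w ∘ σ))) = T (Fin.cons u (Fin.cons v w))) ∧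
    (∀ v : Fin (m + 2) → E, ∑ σ : Equiv.Perm (Fin (m + 2)), T (v ∘ σ) = 0)}
  add_mem' := by
    rintro S T ⟨hS, hS'⟩ ⟨hT, hT'⟩
    refine ⟨fun σ u v w => ?_, fun v => ?_⟩
    · simp [hS, hT]
    · simp [Finset.sum_add_distrib, hS', hT']
  zero_mem' := by simp
  smul_mem' := by
    rintro a T ⟨hT, hT'⟩
    refine ⟨fun σ u v w => ?_, fun v => ?_⟩
    · simp [hT]
    · simp [← Finset.smul_sum, hT']

/-- The space `C̃_m` of normal tensors for symmetric connections: those elements of `C_m` that are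
also symmetric in the first two covariant slots. -/
def symmetricNormalTensors (m : ℕ) : Submodule ℝ (E [×(m + 2)]→L[ℝ] E) where
  carrier := {T | T ∈ normalTensors E m ∧ ∀ (u v : E) (w : Fin m → E),
    T (Fin.cons u (Fin.cons v w)) = T (Fin.cons v (Fin.cons u w))}
  add_mem' := by
    rintro S T ⟨hS, hS'⟩ ⟨hT, hT'⟩
    exact ⟨add_mem hS hT, fun u v w => by simp [hS' u v, hT' u v]⟩
  zero_mem' := ⟨zero_mem _, by simp⟩
  smul_mem' := by
    rintro a T ⟨hT, hT'⟩
    exact ⟨Submodule.smul_mem _ a hT, fun u v w => by simp [hT' u v]⟩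

variable {E}

theorem comp_cons_cons {k : ℕ} (g : E ≃L[ℝ] E) (u v : E) (w : Fin k → E) :
    (fun i => g ((Fin.cons u (Fin.cons v w) : Fin (k + 2) → E) i)) =
      Fin.cons (g u) (Fin.cons (g v) (fun i => g (w i))) := by
  funext i
  refine Fin.cases rfl (fun i => ?_) i
  refine Fin.cases rfl (fun i => rfl) i

theorem normalTensors_invariant (m : ℕ) (g : E ≃L[ℝ] E) :
    normalTensors E m ≤ (normalTensors E m).comap (tensorRep E (m + 2) g) := by
  rintro T ⟨hT, hT'⟩
  refine ⟨fun σ u v w => ?_, fun v => ?_⟩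
  · change g (T fun i => g⁻¹ _) = g (T fun i => g⁻¹ _)
    rw [comp_cons_cons, comp_cons_cons]
    exact congrArg g (hT σ _ _ fun i => g⁻¹ (w i))
  · change ∑ σ : Equiv.Perm (Fin (m + 2)), g (T ((fun i => g⁻¹ (v i)) ∘ σ)) = 0
    rw [← map_sum, hT', map_zero]

theorem symmetricNormalTensors_invariant (m : ℕ) (g : E ≃L[ℝ] E) :
    symmetricNormalTensors E m ≤
      (symmetricNormalTensors E m).comap (tensorRep E (m + 2) g) := by
  rintro T ⟨hT, hT'⟩
  refine ⟨normalTensors_invariant m g hT, fun u v w => ?_⟩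
  change g (T fun i => g⁻¹ _) = g (T fun i => g⁻¹ _)
  rw [comp_cons_cons, comp_cons_cons, hT']

/-- The product representation on `S₀ × ⋯ × S_r` of invariant subspaces `S_m` of the spaces of
`(1, m + 2)`-tensors. -/
def productRep (r : ℕ) (S : ∀ m : ℕ, Submodule ℝ (E [×(m + 2)]→L[ℝ] E))
    (hS : ∀ (m : ℕ) (g : E ≃L[ℝ] E), S m ≤ (S m).comap (tensorRep E (m + 2) g)) :
    Representation ℝ (E ≃L[ℝ] E) (∀ m : Fin (r + 1), S m) where
  toFun g := LinearMap.pi fun m =>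
    ((tensorRep E (m + 2)).subrepresentation (S m) (hS m) g).comp (LinearMap.proj m)
  map_one' := by ext T m v; rfl
  map_mul' g h := by ext T m v; rfl

variable (E)

/-- The representation of the general linear group on `C₀ × ⋯ × C_r`. -/
def normalRep (r : ℕ) :
    Representation ℝ (E ≃L[ℝ] E) (∀ m : Fin (r + 1), normalTensors E m) :=
  productRep r (normalTensors E) normalTensors_invariant

/-- The representation of the general linear group on `C̃₀ × ⋯ × C̃_r`. -/
def symmetricNormalRep (r : ℕ) :
    Representation ℝ (E ≃L[ℝ] E) (∀ m : Fin (r + 1), symmetricNormalTensors E m) :=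
  productRep r (symmetricNormalTensors E) symmetricNormalTensors_invariant

end NormalTensors

section Orbits

variable {G W : Type*} [Group G] [NormedAddCommGroup W] [NormedSpace ℝ W]

/-- Two vectors are equivalent if they lie in the same orbit of the representation. -/
def orbitSetoid (ρ : Representation ℝ G W) : Setoid W where
  r v w := ∃ g : G, ρ g v = w
  iseqv :=
    { refl := fun v => ⟨1, by simp⟩
      symm := by
        rintro v _ ⟨g, rfl⟩
        exact ⟨g⁻¹, by simp⟩
      trans := by
        rintro v _ _ ⟨g, rfl⟩ ⟨h, rfl⟩
        exact ⟨h * g, by simp⟩ }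

/-- The orbit space of a representation, with the quotient topology. -/
abbrev OrbitSpace (ρ : Representation ℝ G W) : Type _ := Quotient (orbitSetoid ρ)

/-- The quotient ringed space structure of the orbit space of a representation. -/
def orbitSheaf (ρ : Representation ℝ G W) : ContFunSheaf (OrbitSpace ρ) :=
  (smoothFunSheaf (id : W → W)).direct ⟨Quotient.mk (orbitSetoid ρ), continuous_quot_mk⟩

end Orbits

/-! ## Jets of linear connections and their moduli space -/

section Connections

variable {n : ℕ} {M : Type*} [TopologicalSpace M] [ChartedSpace (EuclideanSpace ℝ (Fin n)) M]

variable (n) in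
/-- A local diffeomorphism of `M`, defined around `x` and leaving `x` fixed. -/
structure LocalDiffeoFixing (x : M) where
  toFun : OpenPartialHomeomorph M M
  mem_source : x ∈ toFun.source
  map_point : toFun x = x
  smooth : ContMDiffOn (𝓡 n) (𝓡 n) ∞ toFun toFun.source
  smooth_symm : ContMDiffOn (𝓡 n) (𝓡 n) ∞ toFun.symm toFun.target

variable [IsManifold (𝓡 n) ∞ M]

variable (n) in
/-- A smooth linear connection (covariant derivative on the tangent bundle), defined on some open
neighbourhood of `x`. Here `cov σ y v` is `∇_v σ` at `y`; only its values at points of `domain`, on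
vector fields differentiable there, are meaningful. -/
structure LocalConnection (x : M) where
  domain : Opens M
  mem_domain : x ∈ domain
  cov : (Π y : M, TangentSpace (𝓡 n) y) →
    (Π y : M, TangentSpace (𝓡 n) y →L[ℝ] TangentSpace (𝓡 n) y)
  isCovariantDerivativeOn :
    IsCovariantDerivativeOn (EuclideanSpace ℝ (Fin n)) cov (domain : Set M)
  smooth : ∀ V : Opens M, V ≤ domain →
    ContMDiffCovariantDerivativeOn (EuclideanSpace ℝ (Fin n)) ∞ cov (V : Set M)

variable (n) in
/-- All smooth linear connections around `x`. -/
def allConnections (x : M) : Set (LocalConnection n x) := Set.univ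

variable (n) in
/-- The symmetric (torsion-free) connections around `x`: `∇_X Y - ∇_Y X = [X, Y]`. -/
def symmetricConnections (x : M) : Set (LocalConnection n x) :=
  {D | ∀ y ∈ D.domain, ∀ X Y : Π z : M, TangentSpace (𝓡 n) z,
    MDifferentiableAt (𝓡 n) (𝓡 n).tangent
      (fun z => (⟨z, X z⟩ : TangentBundle (𝓡 n) M)) y →
    MDifferentiableAt (𝓡 n) (𝓡 n).tangent
      (fun z => (⟨z, Y z⟩ : TangentBundle (𝓡 n) M)) y →
    D.cov Y y (X y) - D.cov X y (Y y) = VectorField.mlieBracket (𝓡 n) X Y y}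

variable (n) in
/-- The coordinate field `∂/∂xᵢ` of the preferred chart at `x` (meaningful on its domain). -/
def coordField (x : M) (i : Fin n) : Π y : M, TangentSpace (𝓡 n) y :=
  VectorField.mpullback (𝓡 n) 𝓘(ℝ, EuclideanSpace ℝ (Fin n)) (extChartAt (𝓡 n) x)
    (fun _ => EuclideanSpace.single i (1 : ℝ))

/-- The Christoffel symbols of a connection around `x` in the preferred chart at `x`, as functions
of the coordinates: `(christoffel D i j u) k = Γᵏᵢⱼ(u)`, where `∇_{∂ᵢ} ∂ⱼ = ∑ₖ Γᵏᵢⱼ ∂ₖ`. -/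
def christoffel {x : M} (D : LocalConnection n x) (i j : Fin n)
    (u : EuclideanSpace ℝ (Fin n)) : EuclideanSpace ℝ (Fin n) :=
  let y : M := (extChartAt (𝓡 n) x).symm u
  mfderiv (𝓡 n) 𝓘(ℝ, EuclideanSpace ℝ (Fin n)) (extChartAt (𝓡 n) x) y
    (D.cov (coordField n x j) y (coordField n x i y))

/-- The space in which the coordinates of `r`-jets take their values: derivatives of order
`m = 0, …, r` of the functions `Γᵏᵢⱼ`. -/
abbrev JetCoordSpace (n r : ℕ) : Type :=
  ∀ m : Fin (r + 1), Fin n → Fin n →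
    (EuclideanSpace ℝ (Fin n) [×(m : ℕ)]→L[ℝ] EuclideanSpace ℝ (Fin n))

/-- The derivatives up to order `r` of the Christoffel symbols at the point `x`. -/
def jetCoord (r : ℕ) {x : M} (D : LocalConnection n x) : JetCoordSpace n r :=
  fun m i j => iteratedFDeriv ℝ m (christoffel D i j) (extChartAt (𝓡 n) x x)

variable (r : ℕ) {x : M} (C : Set (LocalConnection n x))

/-- Two connections have the same `r`-jet at `x` if the derivatives up to order `r` of their
Christoffel symbols at `x` coincide. -/
def jetSetoid : Setoid C := Setoid.ker fun D : C => jetCoord r D.1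

/-- The space of `r`-jets at `x` of connections belonging to the class `C`. -/
def JetSpace : Type _ := Quotient (jetSetoid r C)

variable {C} in
/-- The `r`-jet at `x` of a connection. -/
def jet (D : C) : JetSpace r C := Quotient.mk (jetSetoid r C) D

/-- The (injective) coordinate map of the space of jets. -/
def JetSpace.coord : JetSpace r C → JetCoordSpace n r :=
  Quotient.lift (fun D : C => jetCoord r D.1) fun _ _ h => h

/-- The space of jets carries the topology for which its coordinate map is an embedding. -/
instance : TopologicalSpace (JetSpace r C) :=
  TopologicalSpace.induced (JetSpace.coord r C) inferInstance

/-- `D'` is, around `x`, the transform `τ · D` of the connection `D` by `τ`, that is,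
`D'_X Y = τ_*⁻¹ (D_{τ_* X} (τ_* Y))`. -/
def IsTransform (τ : LocalDiffeoFixing n x) (D D' : LocalConnection n x) : Prop :=
  ∀ᶠ y in 𝓝 x, ∀ X Y : Π z : M, TangentSpace (𝓡 n) z,
    MDifferentiableAt (𝓡 n) (𝓡 n).tangent
      (fun z => (⟨z, Y z⟩ : TangentBundle (𝓡 n) M)) y →
    mfderiv (𝓡 n) (𝓡 n) τ.toFun y (D'.cov Y y (X y)) =
      D.cov (VectorField.mpullback (𝓡 n) (𝓡 n) τ.toFun.symm Y) (τ.toFun y)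
        (mfderiv (𝓡 n) (𝓡 n) τ.toFun y (X y))

/-- Two jets are equivalent if the second is the jet of the transform, by some local
diffeomorphism fixing `x`, of a connection representing the first; that is, if they lie in the same
orbit of the group of germs of such diffeomorphisms. -/
def JetEquiv (j j' : JetSpace r C) : Prop :=
  ∃ (τ : LocalDiffeoFixing n x) (D D' : C),
    IsTransform τ D.1 D'.1 ∧ jet r D = j ∧ jet r D' = j'

/-- The moduli space of `r`-jets at `x` of connections belonging to the class `C`, with the
quotient topology. (`Quot` divides by the equivalence relation generated by `JetEquiv`, which is
`JetEquiv` itself for the two classes of connections considered here.) -/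
abbrev ModuliSpace : Type _ := Quot (JetEquiv r C)

/-- The quotient ringed space structure of the moduli space. -/
def moduliSheaf : ContFunSheaf (ModuliSpace r C) :=
  (smoothFunSheaf (JetSpace.coord r C)).direct ⟨Quot.mk (JetEquiv r C), continuous_quot_mk⟩

end Connections

end

/-! In a chart centred at x, a connection is a smooth germ Γ of bilinear maps at the origin. A germ
Γ' is its transform by a local diffeomorphism τ fixing 0 exactly when Dτ·Γ' = Γ(τ)(Dτ, Dτ) + D²τ.
Smooth germs have the same r-jet iff their difference is O(|u|^(r+1)) (`jetAt_eq_iff_isBigO`). So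
two jets are equivalent iff, for some τ, the transformation law holds for their Taylor polynomials
up to O(|u|^(r+1)). This relation is `JetRel`; it is an equivalence because the failure of the law
is a cocycle in τ (`transformDefect_comp`).

The classes are described by the normal form Γ(u)(u,u) = 0, which says that straight lines through
the origin are geodesics.

Existence (`exists_normalization`): no exponential map is used. Finitely many explicit polynomial
changes of coordinates remove the homogeneous parts of Γ(u)(u,u) one degree after the other, and the
outcome depends smoothly on the jet.

Uniqueness (`isBigO_sub_fderiv_of_normal`): if τ relates two normal forms up to O(|u|^(r+1)), put δ
= Dτ(u)u − τ(u). The transformation law on the diagonal expresses Dδ(u)u = D²τ(u,u) as a term in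
which δ is multiplied by a factor O(|u|), plus O(|u|^(r+3)). Integration along rays gains one order
at a time, so δ, and then τ − Dτ(0), is O(|u|^(r+3)). Hence Dτ(0) alone relates the two jets, and
normal jets are equivalent iff a linear automorphism intertwines them (`exists_intertwining`,
`jetRel_of_intertwining`).

After uncurrying, the derivatives of normal symbols are precisely the tensors of the spaces C_m, or
of their symmetric subspaces in the torsion-free case (`mem_normalTensors_iff`). Normalization gives
a smooth map from jets to tensors; using tensors as Taylor coefficients of Christoffel symbols gives
a smooth map back. Both respect the equivalences and are mutually inverse modulo them, so they
descend to inverse morphisms of ringed spaces (`ringedIsomorphic_moduliSheaf`). The passage between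
the manifold and its chart rests on `isTransform_iff` and `exists_localConnection`. -/

noncomputable section

/-! ### Taylor polynomials and jets at the origin. -/

section Jets

open Asymptotics

universe u

variable {E F G : Type u} [NormedAddCommGroup E] [NormedSpace ℝ E] [NormedAddCommGroup F]
  [NormedSpace ℝ F] [NormedAddCommGroup G] [NormedSpace ℝ G]

/-- If the derivatives of a smooth function up to order `N` vanish at the origin, the function is
`O(‖u‖ ^ (N + 1))`. -/
theorem isBigO_pow_of_iteratedFDeriv_eq_zero (N : ℕ) {F : Type u} [NormedAddCommGroup F]
    [NormedSpace ℝ F] {f : E → F} (hf : ContDiffAt ℝ ∞ f 0)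
    (h : ∀ k ≤ N, iteratedFDeriv ℝ k f 0 = 0) : f =O[𝓝 0] fun u => ‖u‖ ^ (N + 1) := by
  induction N generalizing F with
  | zero =>
    have h0 : f 0 = 0 := by
      have := congrArg (fun T => T 0) (h 0 (Nat.zero_le _))
      simpa using this
    have := (hf.differentiableAt (by simp)).isBigO_sub
    simpa [h0] using this.norm_right
  | succ N ih =>
    have h0 : f 0 = 0 := by
      have := congrArg (fun T => T 0) (h 0 (Nat.zero_le _))
      simpa using this
    have hf' : ContDiffAt ℝ ∞ (fderiv ℝ f) 0 := hf.fderiv_right (by simp)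
    have hD : ∀ k ≤ N, iteratedFDeriv ℝ k (fderiv ℝ f) 0 = 0 := fun k hk => by
      rw [← norm_eq_zero, norm_iteratedFDeriv_fderiv, h (k + 1) (by lia), norm_zero]
    obtain ⟨C, hC⟩ := (ih hf' hD).bound
    have hdiff : ∀ᶠ u in 𝓝 (0 : E), DifferentiableAt ℝ f u := by
      have := (hf.of_le (m := 1) (by exact_mod_cast le_top)).eventually (by simp)
      filter_upwards [this] with u hu using hu.differentiableAt (by simp)
    obtain ⟨ε, hε, hball⟩ := Metric.eventually_nhds_iff_ball.1 (hC.and hdiff)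
    refine IsBigO.of_bound C ?_
    filter_upwards [Metric.ball_mem_nhds (0 : E) hε] with u hu
    have hsub : Metric.closedBall (0 : E) ‖u‖ ⊆ Metric.ball 0 ε :=
      Metric.closedBall_subset_ball (by simpa using hu)
    -- The constant comes without a sign; away from the origin the bound itself forces it to be
    -- nonnegative.
    have hC0 : 0 ≤ C ∨ u = 0 := by
      by_cases hu0 : u = 0
      · exact Or.inr hu0
      · left
        have h1 := (hball u hu).1
        have h2 : 0 < ‖‖u‖ ^ (N + 1)‖ := by
          rw [norm_pow, norm_norm]; exact pow_pos (norm_pos_iff.2 hu0) _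
        by_contra hneg
        have := (norm_nonneg _).trans h1
        nlinarith
    rcases hC0 with hC0 | rfl
    -- Mean value inequality on the ball of radius ‖u‖, where the derivative is at most C‖u‖^(N+1);
    -- the length of the segment supplies the extra factor ‖u‖.
    · have := (convex_closedBall (0 : E) ‖u‖).norm_image_sub_le_of_norm_fderiv_le (𝕜 := ℝ)
        (f := f) (C := C * ‖u‖ ^ (N + 1)) (x := 0) (y := u)
        (fun y hy => (hball y (hsub hy)).2) (fun y hy => (hball y (hsub hy)).1.trans (by
          rw [norm_pow, norm_norm]
          have : ‖y‖ ≤ ‖u‖ := by simpa using hy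
          gcongr)) (by simp) (by simp)
      rw [h0, sub_zero, sub_zero] at this
      rw [norm_pow, norm_norm, pow_succ _ (N + 1), ← mul_assoc]
      exact this
    · simp [h0]

/-- The iterated derivatives of a real smooth function are symmetric. -/
theorem iteratedFDeriv_comp_perm_of_contDiffAt (n : ℕ) {F : Type u} [NormedAddCommGroup F]
    [NormedSpace ℝ F] {f : E → F} {x : E} (hf : ContDiffAt ℝ ∞ f x) (σ : Equiv.Perm (Fin n))
    (v : Fin n → E) : iteratedFDeriv ℝ n f x (v ∘ σ) = iteratedFDeriv ℝ n f x v := by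
  -- Finite smoothness and an arbitrary target: the induction replaces f by its derivative, which
  -- loses one order and takes values elsewhere.
  have main : ∀ (n : ℕ) {F : Type u} [NormedAddCommGroup F] [NormedSpace ℝ F] {f : E → F} {x : E},
      ContDiffAt ℝ n f x → ∀ (σ : Equiv.Perm (Fin n)) (v : Fin n → E),
        iteratedFDeriv ℝ n f x (v ∘ σ) = iteratedFDeriv ℝ n f x v := by
    intro n
    induction n with
    | zero => intro F _ _ f x hf σ v; congr 1; ext i; exact i.elim0
    | succ n ih =>
      intro F _ _ f x hf
      -- The permutations leaving the derivative invariant form a submonoid, so adjacent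
      -- transpositions suffice.
      let S : Submonoid (Equiv.Perm (Fin (n + 1))) :=
        { carrier := {σ | ∀ v, iteratedFDeriv ℝ (n + 1) f x (v ∘ σ) =
            iteratedFDeriv ℝ (n + 1) f x v}
          one_mem' := fun v => rfl
          mul_mem' := fun {a b} ha hb v => by
            have := hb (v ∘ a)
            rw [ha] at this
            exact this }
      suffices hS : S = ⊤ from fun σ => (hS ▸ Submonoid.mem_top σ : σ ∈ S)
      rw [eq_top_iff, ← Equiv.Perm.mclosure_swap_castSucc_succ n, Submonoid.closure_le]
      rintro _ ⟨i, rfl⟩ v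
      have hev : ∀ᶠ y in 𝓝 x, ContDiffAt ℝ n f y :=
        (hf.of_le (by exact_mod_cast Nat.le_succ n)).eventually (by simp)
      have left : ∀ τ : Equiv.Perm (Fin n), ∀ w : Fin (n + 1) → E,
          fderiv ℝ (iteratedFDeriv ℝ n f) x (w 0) (Fin.tail w ∘ τ) =
            fderiv ℝ (iteratedFDeriv ℝ n f) x (w 0) (Fin.tail w) := by
        intro τ w
        have hd : DifferentiableAt ℝ (iteratedFDeriv ℝ n f) x :=
          hf.differentiableAt_iteratedFDeriv (by exact_mod_cast Nat.lt_succ_self n)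
        have e : ∀ z : Fin n → E, fderiv ℝ (iteratedFDeriv ℝ n f) x (w 0) z =
            fderiv ℝ (fun y => iteratedFDeriv ℝ n f y z) x (w 0) := fun z =>
          (DFunLike.congr_fun ((hd.hasFDerivAt.continuousMultilinear_apply_const z).fderiv)
            (w 0)).symm
        rw [e, e]
        congr 1
        refine Filter.EventuallyEq.fderiv_eq ?_
        filter_upwards [hev] with y hy using ih hy τ _
      rcases n with _ | n
      · exact i.elim0
      -- A swap avoiding the first slot is handled by differentiating the inductive identity, one
      -- avoiding the last slot by applying the induction hypothesis to `fderiv ℝ f`. What remains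
      -- is the case of two slots, Schwarz's theorem.
      have hcases : i ≠ 0 ∨ i ≠ Fin.last n ∨ n = 0 := by
        rcases eq_or_ne i 0 with rfl | h
        · right
          rcases Nat.eq_zero_or_pos n with h | h
          · exact Or.inr h
          · left; intro h'; rw [Fin.ext_iff] at h'; simp at h'; lia
        · exact Or.inl h
      rcases hcases with hi | hi | rfl
      · obtain ⟨j, rfl⟩ := Fin.exists_succ_eq.2 hi
        have h1 : (v ∘ Equiv.swap j.succ.castSucc j.succ.succ) 0 = v 0 := by
          rw [Function.comp_apply, Equiv.swap_apply_of_ne_of_ne]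
          · simp [Fin.ext_iff]
          · exact (Fin.succ_ne_zero _).symm
        have h2 : Fin.tail (v ∘ Equiv.swap j.succ.castSucc j.succ.succ) =
            Fin.tail v ∘ Equiv.swap j.castSucc j.succ := by
          funext k
          simp only [Fin.tail, Function.comp_apply]
          rw [← Fin.succ_castSucc, ← (Fin.succ_injective _).map_swap]
        rw [iteratedFDeriv_succ_apply_left, iteratedFDeriv_succ_apply_left, h1, h2]
        exact left _ v
      · obtain ⟨j, rfl⟩ := Fin.exists_castSucc_eq.2 hi
        have h1 : (v ∘ Equiv.swap j.castSucc.castSucc j.castSucc.succ) (Fin.last _) =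
            v (Fin.last _) := by
          rw [Function.comp_apply, Equiv.swap_apply_of_ne_of_ne]
          · exact (Fin.castSucc_lt_last _).ne'
          · rw [Fin.succ_castSucc]; exact (Fin.castSucc_lt_last _).ne'
        have h2 : Fin.init (v ∘ Equiv.swap j.castSucc.castSucc j.castSucc.succ) =
            Fin.init v ∘ Equiv.swap j.castSucc j.succ := by
          funext k
          simp only [Fin.init, Function.comp_apply]
          rw [Fin.succ_castSucc, ← (Fin.castSucc_injective _).map_swap]
        rw [iteratedFDeriv_succ_apply_right (n := n + 1) v,
          iteratedFDeriv_succ_apply_right (n := n + 1) (v ∘ _), h1, h2]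
        have hf' : ContDiffAt ℝ (n + 1 : ℕ) (fderiv ℝ f) x :=
          hf.fderiv_right (by exact_mod_cast le_rfl)
        exact DFunLike.congr_fun (α := E) (F := E →L[ℝ] F)
          (ih hf' (Equiv.swap j.castSucc j.succ) (Fin.init v)) _
      · obtain rfl : i = 0 := Fin.ext (by lia)
        rw [iteratedFDeriv_two_apply, iteratedFDeriv_two_apply]
        have := (hf.isSymmSndFDerivAt (n := ((0 + 1 + 1 : ℕ) : WithTop ℕ∞)) (by simp)) (v 1) (v 0)
        simpa using this
  exact main n (hf.of_le (by exact_mod_cast le_top)) σ v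

/-- A symmetric multilinear map that vanishes on the diagonal is zero. -/
theorem eq_zero_of_diagonal_eq_zero {k : ℕ} (T : E [×k]→L[ℝ] F)
    (hT : ∀ (σ : Equiv.Perm (Fin k)) (v : Fin k → E), T (v ∘ σ) = T v)
    (h : ∀ u : E, T (fun _ => u) = 0) : T = 0 := by
  ext v
  -- Polarization: the k-th derivative of u ↦ T(u,…,u) is the sum of T over all permutations of the
  -- arguments, here k!·T(v).
  have h1 := T.iteratedFDeriv_comp_diagonal 0 v
  have h2 : (fun x : E => T fun _ => x) = fun _ => 0 := funext h
  have h3 : ∑ σ : Equiv.Perm (Fin k), T (fun i => v (σ i)) = (k.factorial : ℝ) • T v := by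
    have e : ∀ σ : Equiv.Perm (Fin k), T (fun i => v (σ i)) = T v := fun σ => hT σ v
    simp only [e]
    simp [Fintype.card_perm, Nat.cast_smul_eq_nsmul]
  rw [h3, h2, iteratedFDeriv_fun_zero] at h1
  have h4 : (k.factorial : ℝ) ≠ 0 := by exact_mod_cast k.factorial_ne_zero
  simpa [h4] using h1.symm

theorem contDiff_diagonal {k : ℕ} (T : E [×k]→L[ℝ] F) {N : WithTop ℕ∞} :
    ContDiff ℝ N fun u : E => T fun _ => u :=
  T.contDiff.comp (contDiff_pi.2 fun _ => contDiff_id)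

/-- Compare two effects of the dilation by 2: it multiplies the k-th derivative at 0 by 2^k, and the
function, homogeneous of degree m, by 2^m. -/
theorem iteratedFDeriv_diagonal_of_ne {k m : ℕ} (T : E [×m]→L[ℝ] F) (hkm : k ≠ m) :
    iteratedFDeriv ℝ k (fun u : E => T fun _ => u) 0 = 0 := by
  set g : E → F := fun u => T fun _ => u with hg
  let A : E →L[ℝ] E := (2 : ℝ) • ContinuousLinearMap.id ℝ E
  have h1 : iteratedFDeriv ℝ k (g ∘ A) 0 = (2 : ℝ) ^ k • iteratedFDeriv ℝ k g 0 := by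
    rw [A.iteratedFDeriv_comp_right (contDiff_diagonal T (N := k)) 0 le_rfl, map_zero]
    ext v
    simp [A, ContinuousMultilinearMap.map_smul_univ, hg]
  have h2 : g ∘ A = (2 : ℝ) ^ m • g := by
    funext u
    simp [g, A, ContinuousMultilinearMap.map_smul_univ]
  rw [h2, iteratedFDeriv_const_smul_apply (contDiff_diagonal T).contDiffAt] at h1
  have h3 : ((2 : ℝ) ^ m - 2 ^ k) • iteratedFDeriv ℝ k g 0 = 0 := by rw [sub_smul, h1, sub_self]
  refine (smul_eq_zero.1 h3).resolve_left fun h => hkm ?_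
  exact (pow_right_injective₀ (by norm_num : (0 : ℝ) < 2) (by norm_num) (sub_eq_zero.1 h)).symm

theorem iteratedFDeriv_sub_apply_of_contDiffAt {k : ℕ} {f g : E → F} {x : E} (hf : ContDiffAt ℝ k f x)
    (hg : ContDiffAt ℝ k g x) : iteratedFDeriv ℝ k (fun u => f u - g u) x =
      iteratedFDeriv ℝ k f x - iteratedFDeriv ℝ k g x :=
  iteratedFDeriv_sub_apply hf hg

/-- Families of multilinear maps, the values of jets of order `r` of functions from `E` to `F`. -/
abbrev JetFamily (E F : Type u) [NormedAddCommGroup E] [NormedSpace ℝ E] [NormedAddCommGroup F]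
    [NormedSpace ℝ F] (r : ℕ) : Type u :=
  ∀ m : Fin (r + 1), E [×(m : ℕ)]→L[ℝ] F

/-- The polynomial whose derivatives at the origin are given symmetric multilinear maps. -/
def jetPoly {r : ℕ} (p : JetFamily E F r) (u : E) : F :=
  ∑ m : Fin (r + 1), ((m : ℕ).factorial : ℝ)⁻¹ • p m fun _ => u

theorem contDiff_jetPoly {r : ℕ} (p : JetFamily E F r)
    {N : WithTop ℕ∞} : ContDiff ℝ N (jetPoly p) := by
  unfold jetPoly
  exact ContDiff.sum fun m _ => contDiff_const.smul (contDiff_diagonal (p m))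

theorem jetPoly_smul {r : ℕ} (p : JetFamily E F r) (t : ℝ) (u : E) :
    jetPoly p (t • u) =
      ∑ m : Fin (r + 1), t ^ (m : ℕ) • ((m : ℕ).factorial : ℝ)⁻¹ • p m fun _ => u := by
  refine Finset.sum_congr rfl fun m _ => ?_
  have := (p m).map_smul_univ (fun _ => t) fun _ => u
  simp only [Finset.prod_const, Finset.card_univ, Fintype.card_fin] at this
  rw [this, smul_comm]

/-- Symmetric families of multilinear maps, i.e. those that are jets of smooth functions. -/
def IsSymmetricJet {r : ℕ} (p : JetFamily E F r) : Prop :=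
  ∀ (m : Fin (r + 1)) (σ : Equiv.Perm (Fin m)) (v : Fin m → E), p m (v ∘ σ) = p m v

/-- Only the term of degree k survives. Its derivative is a sum over k! permutations, which symmetry
collapses to k!·p k and the factorial in `jetPoly` cancels. -/
theorem iteratedFDeriv_jetPoly {r : ℕ} {p : JetFamily E F r}
    (hp : IsSymmetricJet p) (k : Fin (r + 1)) : iteratedFDeriv ℝ k (jetPoly p) 0 = p k := by
  have h : jetPoly p = fun u => ∑ m : Fin (r + 1), ((m : ℕ).factorial : ℝ)⁻¹ • p m fun _ => u := rfl
  have hs : ∀ m ∈ (Finset.univ : Finset (Fin (r + 1))), ContDiffAt ℝ (k : ℕ)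
      (fun u : E => ((m : ℕ).factorial : ℝ)⁻¹ • p m fun _ => u) 0 := fun m _ =>
    (contDiff_const.smul (contDiff_diagonal (p m))).contDiffAt
  have hc : ∀ m : Fin (r + 1), iteratedFDeriv ℝ (k : ℕ)
      (fun u : E => ((m : ℕ).factorial : ℝ)⁻¹ • p m fun _ => u) 0 =
        ((m : ℕ).factorial : ℝ)⁻¹ • iteratedFDeriv ℝ (k : ℕ) (fun u : E => p m fun _ => u) 0 :=
    fun m => iteratedFDeriv_const_smul_apply (contDiff_diagonal (p m)).contDiffAt
  rw [h, iteratedFDeriv_fun_sum_apply hs, Finset.sum_eq_single k]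
  · rw [hc]
    ext v
    have h4 : ((k : ℕ).factorial : ℝ) ≠ 0 := by exact_mod_cast (k : ℕ).factorial_ne_zero
    have e : ∀ σ : Equiv.Perm (Fin k), p k (fun i => v (σ i)) = p k v := fun σ => hp k σ v
    rw [_root_.smul_apply, ContinuousMultilinearMap.iteratedFDeriv_comp_diagonal]
    simp only [e]
    simp [Fintype.card_perm, ← Nat.cast_smul_eq_nsmul ℝ, smul_smul, h4]
  · intro m _ hm
    rw [hc,
      iteratedFDeriv_diagonal_of_ne _ (by simpa [Fin.ext_iff, eq_comm] using hm), smul_zero]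
  · simp

/-- The `r`-jet at the origin of a function. -/
def jetAt (r : ℕ) (f : E → F) : JetFamily E F r := fun m => iteratedFDeriv ℝ m f 0

theorem isSymmetricJet_jetAt (r : ℕ) {f : E → F} (hf : ContDiffAt ℝ ∞ f 0) :
    IsSymmetricJet (jetAt r f) :=
  fun m σ v => iteratedFDeriv_comp_perm_of_contDiffAt m hf σ v

/-- Taylor's theorem: all derivatives of the difference up to order r vanish at the origin. -/
theorem isBigO_sub_jetPoly (r : ℕ) {f : E → F} (hf : ContDiffAt ℝ ∞ f 0) :
    (fun u => f u - jetPoly (jetAt r f) u) =O[𝓝 0] fun u => ‖u‖ ^ (r + 1) := by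
  refine isBigO_pow_of_iteratedFDeriv_eq_zero r (hf.sub (contDiff_jetPoly _).contDiffAt) ?_
  intro k hk
  have hk' : ContDiffAt ℝ k f 0 := hf.of_le (by exact_mod_cast le_top)
  rw [iteratedFDeriv_sub_apply_of_contDiffAt hk' (contDiff_jetPoly _).contDiffAt, sub_eq_zero]
  exact (iteratedFDeriv_jetPoly (isSymmetricJet_jetAt r hf) ⟨k, by lia⟩).symm

/-- The coefficients of degree less than `k` of a polynomial which is `O(t ^ k)` vanish. -/
theorem coeff_eq_zero_of_isBigO {N k : ℕ} {c : Fin N → F}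
    (h : (fun t : ℝ => ∑ m : Fin N, t ^ (m : ℕ) • c m) =O[𝓝[≠] 0] fun t => t ^ k)
    (j : Fin N) (hj : (j : ℕ) < k) : c j = 0 := by
  induction N generalizing k with
  | zero => exact j.elim0
  | succ N ih =>
    obtain ⟨k, rfl⟩ : ∃ k', k = k' + 1 := ⟨k - 1, by lia⟩
    -- Letting t tend to 0 leaves only `c 0`; dividing by t, on the punctured neighbourhood, then
    -- lowers both the number of terms and the exponent.
    have hlim : Tendsto (fun t : ℝ => ∑ m : Fin (N + 1), t ^ (m : ℕ) • c m) (𝓝[≠] 0) (𝓝 0) :=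
      h.trans_tendsto (((continuous_pow (k + 1)).tendsto' 0 0 (by simp)).mono_left
        nhdsWithin_le_nhds)
    have hlim' : Tendsto (fun t : ℝ => ∑ m : Fin (N + 1), t ^ (m : ℕ) • c m) (𝓝[≠] 0)
        (𝓝 (c 0)) := by
      refine (Continuous.tendsto' (by fun_prop) 0 _ ?_).mono_left nhdsWithin_le_nhds
      simp [Fin.sum_univ_succ]
    have h0 : c 0 = 0 := tendsto_nhds_unique hlim' hlim
    have h1 : (fun t : ℝ => ∑ m : Fin N, t ^ (m : ℕ) • c m.succ) =O[𝓝[≠] 0] fun t => t ^ k := by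
      have h2 := (isBigO_refl (fun t : ℝ => t⁻¹) (𝓝[≠] 0)).smul h
      refine (h2.congr' ?_ ?_)
      · filter_upwards [self_mem_nhdsWithin] with t ht
        have ht : t ≠ 0 := ht
        rw [Fin.sum_univ_succ, h0, smul_zero, zero_add, Finset.smul_sum]
        refine Finset.sum_congr rfl fun m _ => ?_
        rw [Fin.val_succ, pow_succ', ← smul_smul, inv_smul_smul₀ ht]
      · filter_upwards [self_mem_nhdsWithin] with t ht
        have ht : t ≠ 0 := ht
        rw [smul_eq_mul, pow_succ', inv_mul_cancel_left₀ ht]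
    revert hj
    refine Fin.cases (fun _ => h0) (fun m hm => ih h1 m ?_) j
    simpa using hm

omit [NormedSpace ℝ F] in
theorem isBigO_pow_comp_smul {f : E → F} {N : ℕ} (h : f =O[𝓝 0] fun u => ‖u‖ ^ N) (u : E) :
    (fun t : ℝ => f (t • u)) =O[𝓝 0] fun t => t ^ N := by
  have h1 : Tendsto (fun t : ℝ => t • u) (𝓝 0) (𝓝 0) :=
    Continuous.tendsto' (by fun_prop) _ _ (by simp)
  refine (h.comp_tendsto h1).trans (IsBigO.of_bound (‖u‖ ^ N) (Eventually.of_forall fun t => ?_))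
  simp [norm_smul, mul_pow, mul_comm]

/-- The derivatives up to order `N` of a smooth function which is `O(‖u‖ ^ (N + 1))` vanish. -/
theorem jetAt_eq_zero_of_isBigO (N : ℕ) {f : E → F} (hf : ContDiffAt ℝ ∞ f 0)
    (h : f =O[𝓝 0] fun u => ‖u‖ ^ (N + 1)) : jetAt N f = 0 := by
  have h1 : jetPoly (jetAt N f) =O[𝓝 0] fun u => ‖u‖ ^ (N + 1) :=
    (h.sub (isBigO_sub_jetPoly N hf)).congr_left fun u => by simp
  funext k
  refine eq_zero_of_diagonal_eq_zero _ (isSymmetricJet_jetAt N hf k) fun u => ?_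
  have h2 := isBigO_pow_comp_smul h1 u
  simp only [jetPoly_smul] at h2
  have h3 := coeff_eq_zero_of_isBigO (h2.mono nhdsWithin_le_nhds) k k.2
  have h4 : ((k : ℕ).factorial : ℝ) ≠ 0 := by exact_mod_cast (k : ℕ).factorial_ne_zero
  simpa [h4] using h3

/-- Two smooth functions have the same `N`-jet at the origin if and only if their difference is
`O(‖u‖ ^ (N + 1))`. -/
theorem jetAt_eq_iff_isBigO (N : ℕ) {f g : E → F} (hf : ContDiffAt ℝ ∞ f 0)
    (hg : ContDiffAt ℝ ∞ g 0) :
    jetAt N f = jetAt N g ↔ (fun u => f u - g u) =O[𝓝 0] fun u => ‖u‖ ^ (N + 1) := by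
  have hfg : jetAt N (fun u => f u - g u) = jetAt N f - jetAt N g := by
    funext k
    exact iteratedFDeriv_sub_apply_of_contDiffAt (hf.of_le (by exact_mod_cast le_top))
      (hg.of_le (by exact_mod_cast le_top))
  constructor
  · intro h
    refine isBigO_pow_of_iteratedFDeriv_eq_zero N (hf.sub hg) fun k hk => ?_
    have := congrFun hfg ⟨k, by lia⟩
    rw [h, sub_self] at this
    exact this
  · intro h
    rw [← sub_eq_zero, ← hfg]
    exact jetAt_eq_zero_of_isBigO N (hf.sub hg) h

theorem jetAt_jetPoly {r : ℕ} {p : JetFamily E F r}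
    (hp : IsSymmetricJet p) : jetAt r (jetPoly p) = p :=
  funext fun k => iteratedFDeriv_jetPoly hp k

end Jets

/-! ### The transformation law of Christoffel symbols up to finite order. -/

section Transform

open Asymptotics

universe u

variable {E : Type u} [NormedAddCommGroup E] [NormedSpace ℝ E]

theorem two_le_infty : (2 : WithTop ℕ∞) ≤ ∞ := by
  exact WithTop.coe_le_coe.2 (le_top : (2 : ℕ∞) ≤ ⊤)

/-- The second derivative of a composition. -/
theorem fderiv_fderiv_comp {f g : E → E} {u : E} (hf : ContDiffAt ℝ 2 f (g u))
    (hg : ContDiffAt ℝ 2 g u) (a b : E) :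
    fderiv ℝ (fderiv ℝ (f ∘ g)) u a b =
      fderiv ℝ (fderiv ℝ f) (g u) (fderiv ℝ g u a) (fderiv ℝ g u b) +
        fderiv ℝ f (g u) (fderiv ℝ (fderiv ℝ g) u a b) := by
  have h1 : fderiv ℝ (f ∘ g) =ᶠ[𝓝 u] fun w => (fderiv ℝ f (g w)).comp (fderiv ℝ g w) := by
    filter_upwards [hg.continuousAt.eventually (hf.eventually (by simp)), hg.eventually (by simp)]
      with w hw hw'
    exact fderiv_comp w (hw.differentiableAt (by simp)) (hw'.differentiableAt (by simp))
  have hf' : HasFDerivAt (fderiv ℝ f) (fderiv ℝ (fderiv ℝ f) (g u)) (g u) :=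
    ((hf.fderiv_right (m := 1) (by norm_num)).differentiableAt (by simp)).hasFDerivAt
  have hg' : HasFDerivAt (fderiv ℝ g) (fderiv ℝ (fderiv ℝ g) u) u :=
    ((hg.fderiv_right (m := 1) (by norm_num)).differentiableAt (by simp)).hasFDerivAt
  have hg0 := (hg.differentiableAt (by simp)).hasFDerivAt
  have h2 : HasFDerivAt (fun w => (fderiv ℝ f (g w)).comp (fderiv ℝ g w)) _ u :=
    (hf'.comp u hg0).clm_comp hg'
  rw [h1.fderiv_eq, h2.fderiv]
  simp [add_comm]

/-- The deviation of `Γ'` from being the transform by `τ` of the connection with Christoffel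
symbols `Γ`. -/
def transformDefect (τ : E → E) (Γ Γ' : E → E →L[ℝ] E →L[ℝ] E) (u : E) : E →L[ℝ] E →L[ℝ] E :=
  (ContinuousLinearMap.compL ℝ E E E (fderiv ℝ τ u)).comp (Γ' u) -
    (Γ (τ u)).bilinearComp (fderiv ℝ τ u) (fderiv ℝ τ u) - fderiv ℝ (fderiv ℝ τ) u

theorem transformDefect_apply (τ : E → E) (Γ Γ' : E → E →L[ℝ] E →L[ℝ] E) (u a b : E) :
    transformDefect τ Γ Γ' u a b = fderiv ℝ τ u (Γ' u a b) -
      Γ (τ u) (fderiv ℝ τ u a) (fderiv ℝ τ u b) - fderiv ℝ (fderiv ℝ τ) u a b := rfl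

/-- The cocycle identity, from the chain rule to second order. It makes `JetRel` transitive and
symmetric, because the first derivatives that multiply the two defects are bounded near 0. -/
theorem transformDefect_comp {τ τ' : E → E} {Γ Γ' Γ'' : E → E →L[ℝ] E →L[ℝ] E} {u : E}
    (hτ : ContDiffAt ℝ 2 τ (τ' u)) (hτ' : ContDiffAt ℝ 2 τ' u) :
    transformDefect (τ ∘ τ') Γ Γ'' u =
      (ContinuousLinearMap.compL ℝ E E E (fderiv ℝ τ (τ' u))).comp (transformDefect τ' Γ' Γ'' u) +
        (transformDefect τ Γ Γ' (τ' u)).bilinearComp (fderiv ℝ τ' u) (fderiv ℝ τ' u) := by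
  ext a b
  have h := fderiv_comp u (hτ.differentiableAt (by simp)) (hτ'.differentiableAt (by simp))
  simp only [transformDefect_apply, fderiv_fderiv_comp hτ hτ', h,
    ContinuousLinearMap.comp_apply, Function.comp_apply,
    ContinuousLinearMap.bilinearComp_apply, _root_.add_apply,
    ContinuousLinearMap.compL_apply, map_sub]
  abel

theorem transformDefect_id (Γ Γ' : E → E →L[ℝ] E →L[ℝ] E) (u : E) :
    transformDefect id Γ Γ' u = Γ' u - Γ u := by
  ext a b
  have h : fderiv ℝ (id : E → E) = fun _ => ContinuousLinearMap.id ℝ E := funext fun _ => fderiv_id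
  rw [transformDefect_apply, h]
  simp

theorem norm_bilinearComp_le (β : E →L[ℝ] E →L[ℝ] E) (A B : E →L[ℝ] E) :
    ‖β.bilinearComp A B‖ ≤ ‖β‖ * ‖A‖ * ‖B‖ := by
  refine ContinuousLinearMap.opNorm_le_bound₂ _ (by positivity) fun a b => ?_
  rw [ContinuousLinearMap.bilinearComp_apply]
  calc ‖β (A a) (B b)‖ ≤ ‖β‖ * ‖A a‖ * ‖B b‖ := β.le_opNorm₂ _ _
    _ ≤ ‖β‖ * (‖A‖ * ‖a‖) * (‖B‖ * ‖b‖) := by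
        gcongr <;> exact ContinuousLinearMap.le_opNorm _ _
    _ = ‖β‖ * ‖A‖ * ‖B‖ * ‖a‖ * ‖b‖ := by ring

theorem norm_compL_comp_le (A : E →L[ℝ] E) (β : E →L[ℝ] E →L[ℝ] E) :
    ‖(ContinuousLinearMap.compL ℝ E E E A).comp β‖ ≤ ‖A‖ * ‖β‖ := by
  refine ContinuousLinearMap.opNorm_le_bound₂ _ (by positivity) fun a b => ?_
  calc ‖A (β a b)‖ ≤ ‖A‖ * ‖β a b‖ := A.le_opNorm _
    _ ≤ ‖A‖ * (‖β‖ * ‖a‖ * ‖b‖) := by gcongr; exact β.le_opNorm₂ _ _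
    _ = ‖A‖ * ‖β‖ * ‖a‖ * ‖b‖ := by ring

theorem isBigO_bilinearComp₂ {l : Filter E} {β : E → E →L[ℝ] E →L[ℝ] E} {A B : E → E →L[ℝ] E}
    {g g₁ g₂ : E → ℝ} (hβ : β =O[l] g) (hA : A =O[l] g₁) (hB : B =O[l] g₂) :
    (fun u => (β u).bilinearComp (A u) (B u)) =O[l] fun u => g u * g₁ u * g₂ u := by
  have h := (((isBigO_norm_left (E' := E →L[ℝ] E →L[ℝ] E)).2 hβ).mul hA.norm_left).mul
    hB.norm_left
  exact (IsBigO.of_bound 1 (Eventually.of_forall fun u => by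
    rw [one_mul, Real.norm_of_nonneg (by positivity)]
    exact norm_bilinearComp_le _ _ _)).trans h

theorem isBigO_bilinearComp {l : Filter E} {β : E → E →L[ℝ] E →L[ℝ] E} {A : E → E →L[ℝ] E}
    {g : E → ℝ} (hβ : β =O[l] g) (hA : A =O[l] fun _ => (1 : ℝ)) :
    (fun u => (β u).bilinearComp (A u) (A u)) =O[l] g := by
  simpa using isBigO_bilinearComp₂ hβ hA hA

theorem isBigO_apply₂ {l : Filter E} {β : E → E →L[ℝ] E →L[ℝ] E} {a b : E → E}
    {g g₁ g₂ : E → ℝ} (hβ : β =O[l] g) (ha : a =O[l] g₁) (hb : b =O[l] g₂) :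
    (fun u => β u (a u) (b u)) =O[l] fun u => g u * g₁ u * g₂ u := by
  have h := (((isBigO_norm_left (E' := E →L[ℝ] E →L[ℝ] E)).2 hβ).mul ha.norm_left).mul
    hb.norm_left
  exact (IsBigO.of_bound 1 (Eventually.of_forall fun u => by
    rw [one_mul, Real.norm_of_nonneg (by positivity)]
    exact (β u).le_opNorm₂ _ _)).trans h

theorem isBigO_compL_comp {l : Filter E} {β : E → E →L[ℝ] E →L[ℝ] E} {A : E → E →L[ℝ] E}
    {g : E → ℝ} (hβ : β =O[l] g) (hA : A =O[l] fun _ => (1 : ℝ)) :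
    (fun u => (ContinuousLinearMap.compL ℝ E E E (A u)).comp (β u)) =O[l] g := by
  have h := hA.norm_left.mul ((isBigO_norm_left (E' := E →L[ℝ] E →L[ℝ] E)).2 hβ)
  simp only [one_mul] at h
  exact (IsBigO.of_bound 1 (Eventually.of_forall fun u => by
    rw [one_mul, Real.norm_of_nonneg (by positivity)]
    exact norm_compL_comp_le _ _)).trans h

/-- A local diffeomorphism of `E` around the origin, leaving the origin fixed. -/
structure IsDiffeoFixingZero (τ : OpenPartialHomeomorph E E) : Prop where
  mem_source : 0 ∈ τ.source
  map_zero : τ 0 = 0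
  smooth : ContDiffOn ℝ ∞ τ τ.source
  smooth_symm : ContDiffOn ℝ ∞ τ.symm τ.target

namespace IsDiffeoFixingZero

variable {τ τ' : OpenPartialHomeomorph E E}

theorem mem_target (h : IsDiffeoFixingZero τ) : 0 ∈ τ.target := by
  have := τ.map_source h.mem_source
  rwa [h.map_zero] at this

theorem symm_zero (h : IsDiffeoFixingZero τ) : τ.symm 0 = 0 := by
  have := τ.left_inv h.mem_source
  rwa [h.map_zero] at this

theorem contDiffAt (h : IsDiffeoFixingZero τ) {u : E} (hu : u ∈ τ.source) :
    ContDiffAt ℝ ∞ τ u :=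
  h.smooth.contDiffAt (τ.open_source.mem_nhds hu)

theorem symm (h : IsDiffeoFixingZero τ) : IsDiffeoFixingZero τ.symm where
  mem_source := h.mem_target
  map_zero := h.symm_zero
  smooth := h.smooth_symm
  smooth_symm := h.smooth

theorem refl : IsDiffeoFixingZero (OpenPartialHomeomorph.refl E) where
  mem_source := mem_univ _
  map_zero := rfl
  smooth := contDiffOn_id
  smooth_symm := contDiffOn_id

theorem trans (h : IsDiffeoFixingZero τ) (h' : IsDiffeoFixingZero τ') :
    IsDiffeoFixingZero (τ.trans τ') where
  mem_source := by
    rw [OpenPartialHomeomorph.trans_source]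
    exact ⟨h.mem_source, by rw [mem_preimage, h.map_zero]; exact h'.mem_source⟩
  map_zero := by simp [h.map_zero, h'.map_zero]
  smooth := by
    rw [OpenPartialHomeomorph.coe_trans, OpenPartialHomeomorph.trans_source]
    exact h'.smooth.comp (h.smooth.mono inter_subset_left) fun u hu => hu.2
  smooth_symm := by
    rw [OpenPartialHomeomorph.coe_trans_symm, OpenPartialHomeomorph.trans_target]
    exact h.smooth_symm.comp (h'.smooth_symm.mono inter_subset_left) fun u hu => hu.2

theorem tendsto (h : IsDiffeoFixingZero τ) : Tendsto τ (𝓝 0) (𝓝 0) := by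
  have := (h.contDiffAt h.mem_source).continuousAt.tendsto
  rwa [h.map_zero] at this

theorem isBigO (h : IsDiffeoFixingZero τ) : τ =O[𝓝 0] fun u => u := by
  have := ((h.contDiffAt h.mem_source).differentiableAt (by simp)).isBigO_sub
  simpa [h.map_zero] using this

theorem isBigO_fderiv (h : IsDiffeoFixingZero τ) :
    (fderiv ℝ τ) =O[𝓝 0] fun _ => (1 : ℝ) :=
  ((h.contDiffAt h.mem_source).fderiv_right (m := 0) (by simp)).continuousAt.isBigO_one ℝ

theorem eventually_mem_source (h : IsDiffeoFixingZero τ) : ∀ᶠ u in 𝓝 0, u ∈ τ.source :=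
  τ.open_source.mem_nhds h.mem_source

theorem isBigO_comp (h : IsDiffeoFixingZero τ) {F : Type*} [NormedAddCommGroup F] {f : E → F}
    {N : ℕ} (hf : f =O[𝓝 0] fun u => ‖u‖ ^ N) : (fun u => f (τ u)) =O[𝓝 0] fun u => ‖u‖ ^ N :=
  (hf.comp_tendsto h.tendsto).trans (h.isBigO.norm_norm.pow N)

end IsDiffeoFixingZero

/-- Two families of Christoffel symbols are related if one is, up to terms of order `N` at the
origin, the transform of the other by some local diffeomorphism fixing the origin. -/
def JetRel (N : ℕ) (Γ Γ' : E → E →L[ℝ] E →L[ℝ] E) : Prop :=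
  ∃ τ : OpenPartialHomeomorph E E, IsDiffeoFixingZero τ ∧
    transformDefect τ Γ Γ' =O[𝓝 0] fun u => ‖u‖ ^ N

namespace JetRel

variable {N : ℕ} {Γ Γ' Γ'' : E → E →L[ℝ] E →L[ℝ] E}

theorem of_isBigO (h : (fun u => Γ' u - Γ u) =O[𝓝 0] fun u => ‖u‖ ^ N) : JetRel N Γ Γ' :=
  ⟨OpenPartialHomeomorph.refl E, IsDiffeoFixingZero.refl,
    h.congr_left fun u => (transformDefect_id Γ Γ' u).symm⟩

theorem trans (h : JetRel N Γ Γ') (h' : JetRel N Γ' Γ'') : JetRel N Γ Γ'' := by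
  obtain ⟨τ, hτ, hd⟩ := h
  obtain ⟨τ', hτ', hd'⟩ := h'
  refine ⟨τ'.trans τ, hτ'.trans hτ, ?_⟩
  have hA : (fun u => fderiv ℝ τ (τ' u)) =O[𝓝 0] fun _ => (1 : ℝ) :=
    hτ.isBigO_fderiv.comp_tendsto hτ'.tendsto
  refine ((isBigO_compL_comp hd' hA).add
    (isBigO_bilinearComp (hτ'.isBigO_comp (F := E →L[ℝ] E →L[ℝ] E) hd) hτ'.isBigO_fderiv)).congr' ?_ EventuallyEq.rfl
  filter_upwards [hτ'.eventually_mem_source, hτ'.tendsto.eventually hτ.eventually_mem_source]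
    with u hu hu'
  exact (transformDefect_comp ((hτ.contDiffAt hu').of_le two_le_infty)
    ((hτ'.contDiffAt hu).of_le two_le_infty)).symm

/-- The cocycle identity for τ ∘ τ⁻¹ = id has left side 0, so it can be solved for the defect of τ⁻¹
by applying Dτ⁻¹. -/
theorem symm (h : JetRel N Γ Γ') : JetRel N Γ' Γ := by
  obtain ⟨τ, hτ, hd⟩ := h
  refine ⟨τ.symm, hτ.symm, ?_⟩
  have hd' := isBigO_bilinearComp (hτ.symm.isBigO_comp (F := E →L[ℝ] E →L[ℝ] E) hd)
    hτ.symm.isBigO_fderiv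
  refine (isBigO_compL_comp (IsBigO.neg_left (E' := E →L[ℝ] E →L[ℝ] E) hd')
    hτ.symm.isBigO_fderiv).congr' ?_ EventuallyEq.rfl
  filter_upwards [τ.open_target.mem_nhds hτ.mem_target] with u hu
  have hu' : τ.symm u ∈ τ.source := τ.map_target hu
  have h1 := (hτ.contDiffAt hu').of_le two_le_infty
  have h2 := (hτ.symm.contDiffAt hu).of_le two_le_infty
  have h3 := transformDefect_comp (Γ := Γ) (Γ' := Γ') (Γ'' := Γ) h1 h2
  have h4 : τ ∘ τ.symm =ᶠ[𝓝 u] id := by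
    filter_upwards [τ.open_target.mem_nhds hu] with v hv using τ.right_inv hv
  have h5 : transformDefect (τ ∘ τ.symm) Γ Γ u = 0 := by
    have : transformDefect (τ ∘ τ.symm) Γ Γ u = transformDefect id Γ Γ u := by
      unfold transformDefect
      rw [h4.fderiv_eq, h4.fderiv.fderiv_eq, h4.eq_of_nhds]
    rw [this, transformDefect_id, sub_self]
  have h6 : (fderiv ℝ τ.symm u).comp (fderiv ℝ τ (τ.symm u)) = ContinuousLinearMap.id ℝ E := by
    have h7 : τ.symm ∘ τ =ᶠ[𝓝 (τ.symm u)] id := by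
      filter_upwards [τ.open_source.mem_nhds hu'] with v hv using τ.left_inv hv
    have h8 := h7.fderiv_eq (𝕜 := ℝ)
    have h2' : DifferentiableAt ℝ τ.symm (τ (τ.symm u)) := by
      rw [τ.right_inv hu]; exact h2.differentiableAt (by simp)
    rw [fderiv_comp _ h2' (h1.differentiableAt (by simp)), τ.right_inv hu, fderiv_id] at h8
    exact h8
  rw [h5] at h3
  ext a b
  have h9 := DFunLike.congr_fun (DFunLike.congr_fun h3 a) b
  have h10 := congrArg (fderiv ℝ τ.symm u) h9
  have h11 : ∀ v, fderiv ℝ τ.symm u (fderiv ℝ τ (τ.symm u) v) = v := fun v =>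
    DFunLike.congr_fun h6 v
  simp only [_root_.zero_apply, map_zero, _root_.add_apply, map_add,
    ContinuousLinearMap.comp_apply, ContinuousLinearMap.compL_apply, h11] at h10
  simp only [ContinuousLinearMap.comp_apply, ContinuousLinearMap.compL_apply, map_neg,
    _root_.neg_apply]
  exact (eq_neg_of_add_eq_zero_left h10.symm).symm

end JetRel

end Transform

/-! ### Rigidity: transformations between normal forms are linear to high order. -/

section Uniqueness

open Asymptotics

universe u

variable {E F : Type u} [NormedAddCommGroup E] [NormedSpace ℝ E] [NormedAddCommGroup F]
  [NormedSpace ℝ F]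

omit [NormedSpace ℝ E] in
theorem isBigO_norm_pow_of_le {a b : ℕ} (h : b ≤ a) :
    (fun u : E => ‖u‖ ^ a) =O[𝓝 0] fun u => ‖u‖ ^ b := by
  refine IsBigO.of_bound 1 ?_
  filter_upwards [Metric.ball_mem_nhds (0 : E) one_pos] with u hu
  rw [one_mul, norm_pow, norm_pow, norm_norm]
  exact pow_le_pow_of_le_one (norm_nonneg _) (by simpa using le_of_lt (mem_ball_zero_iff.1 hu)) h

/-- Integration along rays: if the Euler operator of weight `c` maps `f` to `O(‖u‖ ^ N)`, then `f`
itself is `O(‖u‖ ^ N)`, as soon as it vanishes to order higher than `c`. -/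
theorem isBigO_of_euler {f : E → F} {c N : ℕ} (hN : c + 1 ≤ N)
    (hf : ∀ᶠ u in 𝓝 0, DifferentiableAt ℝ f u) (h0 : f =o[𝓝 0] fun u => ‖u‖ ^ c)
    (h : (fun u => fderiv ℝ f u u - (c : ℝ) • f u) =O[𝓝 0] fun u => ‖u‖ ^ N) :
    f =O[𝓝 0] fun u => ‖u‖ ^ N := by
  obtain ⟨C, hC0, hC⟩ := h.exists_pos
  obtain ⟨ε, hε, hball⟩ := Metric.eventually_nhds_iff_ball.1 (hC.bound.and hf)
  refine IsBigO.of_bound C ?_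
  filter_upwards [Metric.ball_mem_nhds (0 : E) hε] with u hu
  have hu' : ‖u‖ < ε := by simpa using hu
  have hmem : ∀ t : ℝ, 0 < t → t ≤ 1 → t • u ∈ Metric.ball (0 : E) ε := by
    intro t ht ht1
    simp only [mem_ball_zero_iff, norm_smul, Real.norm_of_nonneg ht.le]
    nlinarith [norm_nonneg u]
  -- The weight turns the Euler operator into an ordinary derivative, g'(t) = t^(-c-1)(Df(tu)(tu) −
  -- c f(tu)). It is bounded by C‖u‖^N because N ≥ c + 1, and g tends to 0 at 0 by `h0`; so f(u) =
  -- g(1) obeys the same bound.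
  let g : ℝ → F := fun t => (t ^ c)⁻¹ • f (t • u)
  have hderiv : ∀ t : ℝ, 0 < t → t ≤ 1 → HasDerivAt g
      ((t ^ (c + 1))⁻¹ • (fderiv ℝ f (t • u) (t • u) - (c : ℝ) • f (t • u))) t := by
    intro t ht ht1
    have h1 : HasDerivAt (fun t : ℝ => t • u) u t := by
      simpa using (hasDerivAt_id t).smul_const u
    have h2 : HasDerivAt (fun t : ℝ => f (t • u)) (fderiv ℝ f (t • u) u) t :=
      (hball _ (hmem t ht ht1)).2.hasFDerivAt.comp_hasDerivAt t h1
    have h3 : HasDerivAt (fun t : ℝ => (t ^ c)⁻¹) (-((c : ℝ) * t ^ (c - 1)) / (t ^ c) ^ 2) t :=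
      (hasDerivAt_pow c t).fun_inv (pow_ne_zero _ ht.ne')
    have h4 : HasDerivAt g _ t := h3.smul h2
    convert h4 using 1
    have e1 : (t ^ (c + 1))⁻¹ * (c : ℝ) = -(-((c : ℝ) * t ^ (c - 1)) / (t ^ c) ^ 2) := by
      rcases c with _ | c
      · simp
      · simp only [Nat.add_sub_cancel]
        field_simp
        ring
    rw [smul_sub, map_smul, smul_smul, smul_smul, e1, neg_smul, sub_neg_eq_add]
    congr 2
    field_simp
    ring
  have hbound : ∀ t : ℝ, 0 < t → t ≤ 1 →
      ‖(t ^ (c + 1))⁻¹ • (fderiv ℝ f (t • u) (t • u) - (c : ℝ) • f (t • u))‖ ≤ C * ‖u‖ ^ N := by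
    intro t ht ht1
    have h1 := (hball _ (hmem t ht ht1)).1
    rw [norm_pow, norm_norm, norm_smul, Real.norm_of_nonneg ht.le, mul_pow] at h1
    rw [norm_smul, norm_inv, norm_pow, Real.norm_of_nonneg ht.le]
    rw [inv_mul_le_iff₀ (by positivity)]
    refine h1.trans ?_
    have : t ^ N ≤ t ^ (c + 1) := pow_le_pow_of_le_one ht.le ht1 hN
    have h5 : (0 : ℝ) ≤ C * ‖u‖ ^ N := by positivity
    nlinarith
  have hmv : ∀ s : ℝ, 0 < s → s ≤ 1 → ‖g 1 - g s‖ ≤ C * ‖u‖ ^ N := by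
    intro s hs hs1
    have := (convex_Icc s 1).norm_image_sub_le_of_norm_hasDerivWithin_le (f := g)
      (fun t ht => (hderiv t (hs.trans_le ht.1) ht.2).hasDerivWithinAt)
      (fun t ht => hbound t (hs.trans_le ht.1) ht.2) (left_mem_Icc.2 hs1) (right_mem_Icc.2 hs1)
    refine this.trans ?_
    have h5 : (0 : ℝ) ≤ C * ‖u‖ ^ N := by positivity
    rw [Real.norm_of_nonneg (by linarith)]
    nlinarith
  have hlim : Tendsto g (𝓝[>] 0) (𝓝 0) := by
    have h1 : Tendsto (fun t : ℝ => t • u) (𝓝[>] 0) (𝓝 0) :=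
      (Continuous.tendsto' (by fun_prop) _ _ (by simp)).mono_left nhdsWithin_le_nhds
    have h2 : (fun t : ℝ => f (t • u)) =o[𝓝[>] 0] fun t => t ^ c := by
      refine (h0.comp_tendsto h1).trans_isBigO (IsBigO.of_bound (‖u‖ ^ c)
        (Eventually.of_forall fun t => ?_))
      simp [norm_smul, mul_pow, mul_comm]
    have h3 := (isBigO_refl (fun t : ℝ => (t ^ c)⁻¹) (𝓝[>] 0)).smul_isLittleO h2
    refine (isLittleO_one_iff ℝ).1 (h3.congr' EventuallyEq.rfl ?_)
    filter_upwards [self_mem_nhdsWithin] with t ht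
    exact inv_mul_cancel₀ (pow_ne_zero _ (ne_of_gt ht))
  have hfin : ‖g 1 - 0‖ ≤ C * ‖u‖ ^ N := by
    refine le_of_tendsto (tendsto_const_nhds.sub hlim).norm ?_
    filter_upwards [Ioc_mem_nhdsGT one_pos] with s hs using hmv s hs.1 hs.2
  simpa [g] using hfin

/-- A bound on a function does not in general bound its derivative. For a smooth function it amounts
to the vanishing of a jet, and differentiation lowers the order of that jet by one. -/
theorem isBigO_fderiv_of_isBigO {N : ℕ} {f : E → F} (hf : ContDiffAt ℝ ∞ f 0)
    (h : f =O[𝓝 0] fun u => ‖u‖ ^ (N + 2)) : fderiv ℝ f =O[𝓝 0] fun u => ‖u‖ ^ (N + 1) := by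
  have hj := jetAt_eq_zero_of_isBigO (N + 1) hf h
  refine isBigO_pow_of_iteratedFDeriv_eq_zero N (hf.fderiv_right (by simp)) fun k hk => ?_
  rw [← norm_eq_zero, norm_iteratedFDeriv_fderiv]
  have := congrFun hj ⟨k + 1, by lia⟩
  exact norm_eq_zero.2 this

/-- A transformation between two connections in normal form, up to order `r + 1`, agrees with its
linear part to order `r + 3`. -/
theorem isBigO_sub_fderiv_of_normal {r : ℕ} {τ : OpenPartialHomeomorph E E}
    (hτ : IsDiffeoFixingZero τ) {Γ Γ' : E → E →L[ℝ] E →L[ℝ] E} (hΓ : ContDiffAt ℝ ∞ Γ 0)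
    (h0 : ∀ u, Γ u u u = 0) (h0' : ∀ u, Γ' u u u = 0)
    (hd : transformDefect τ Γ Γ' =O[𝓝 0] fun u => ‖u‖ ^ (r + 1)) :
    (fun u => τ u - fderiv ℝ τ 0 u) =O[𝓝 0] fun u => ‖u‖ ^ (r + 3) := by
  have hs := hτ.contDiffAt hτ.mem_source
  have hs' : ContDiffAt ℝ ∞ (fderiv ℝ τ) 0 := hs.fderiv_right (by simp)
  have hdiff : ∀ᶠ u in 𝓝 0, DifferentiableAt ℝ τ u := by
    filter_upwards [hτ.eventually_mem_source] with u hu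
      using (hτ.contDiffAt hu).differentiableAt (by simp)
  have hdiff' : ∀ᶠ u in 𝓝 0, DifferentiableAt ℝ (fderiv ℝ τ) u := by
    filter_upwards [hτ.eventually_mem_source] with u hu
      using ((hτ.contDiffAt hu).fderiv_right (m := ∞) (by simp)).differentiableAt (by simp)
  -- The failure of τ to be homogeneous of degree one. Its derivative in the radial direction is
  -- D²τ(u,u), which the transformation law controls.
  set δ : E → E := fun u => fderiv ℝ τ u u - τ u with hδ
  have hδd : ∀ᶠ u in 𝓝 0, DifferentiableAt ℝ δ u := by
    filter_upwards [hdiff, hdiff'] with u hu hu' using (hu'.clm_apply differentiableAt_id).sub hu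
  have hδe : ∀ᶠ u in 𝓝 0, fderiv ℝ δ u u = fderiv ℝ (fderiv ℝ τ) u u u := by
    filter_upwards [hdiff, hdiff'] with u hu hu'
    have h1 : HasFDerivAt δ _ u :=
      (hu'.hasFDerivAt.clm_apply (hasFDerivAt_id u)).sub hu.hasFDerivAt
    rw [h1.fderiv]
    simp
  have hid : (fun u : E => u) =O[𝓝 0] fun u => ‖u‖ ^ 1 := by
    simpa using (isBigO_refl (fun u : E => u) (𝓝 0)).norm_right
  have hΓτ : (fun u => Γ (τ u)) =O[𝓝 0] fun _ => (1 : ℝ) :=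
    (hΓ.continuousAt.isBigO_one ℝ).comp_tendsto hτ.tendsto
  have hτ1 : τ =O[𝓝 0] fun u => ‖u‖ ^ 1 := by simpa using hτ.isBigO.norm_right
  have hdv : (fun u => transformDefect τ Γ Γ' u u u) =O[𝓝 0] fun u => ‖u‖ ^ (r + 3) :=
    (isBigO_apply₂ hd hid hid).congr_right fun u => by ring
  -- Both normal forms enter here: Γ'(u)(u,u) = 0, and Γ(τ)(τ,τ) = 0 at the point τ(u). Every
  -- remaining Γ term contains δ.
  have heq : ∀ u, fderiv ℝ (fderiv ℝ τ) u u u =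
      -(Γ (τ u) (τ u) (δ u) + Γ (τ u) (δ u) (fderiv ℝ τ u u)) - transformDefect τ Γ Γ' u u u := by
    intro u
    have e : fderiv ℝ τ u u = τ u + δ u := by simp [hδ]
    rw [transformDefect_apply, h0', map_zero, e]
    simp only [map_add, _root_.add_apply, h0]
    abel
  have hDu : (fun u => fderiv ℝ τ u u) =O[𝓝 0] fun u => ‖u‖ ^ 1 := by
    have h1 : (fun u => fderiv ℝ τ u u) =O[𝓝 0] fun u => ‖fderiv ℝ τ u‖ * ‖u‖ :=
      IsBigO.of_bound 1 (Eventually.of_forall fun u => by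
        rw [one_mul, Real.norm_of_nonneg (by positivity)]
        exact (fderiv ℝ τ u).le_opNorm u)
    refine h1.trans ?_
    simpa using hτ.isBigO_fderiv.norm_left.mul (isBigO_refl (fun u : E => ‖u‖) (𝓝 0))
  -- Each round gains one order, until the defect, which is O(|u|^(r+3)) on the diagonal, becomes
  -- the limit.
  have step : ∀ k, 1 ≤ k → k ≤ r + 2 → δ =O[𝓝 0] (fun u => ‖u‖ ^ k) →
      (fun u => fderiv ℝ δ u u) =O[𝓝 0] fun u => ‖u‖ ^ (k + 1) := by
    intro k hk hkr hδk
    have h1 : (fun u => Γ (τ u) (τ u) (δ u)) =O[𝓝 0] fun u => ‖u‖ ^ (k + 1) :=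
      (isBigO_apply₂ hΓτ hτ1 hδk).congr_right fun u => by ring
    have h2 : (fun u => Γ (τ u) (δ u) (fderiv ℝ τ u u)) =O[𝓝 0] fun u => ‖u‖ ^ (k + 1) :=
      (isBigO_apply₂ hΓτ hδk hDu).congr_right fun u => by ring
    have h3 := hdv.trans (isBigO_norm_pow_of_le (E := E) (show k + 1 ≤ r + 3 by lia))
    refine ((h1.add h2).neg_left.sub h3).congr' ?_ EventuallyEq.rfl
    filter_upwards [hδe] with u hu
    rw [hu, heq]
  have hδ0 : δ 0 = 0 := by simp [hδ, hτ.map_zero]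
  have hδk : ∀ k, k ≤ r + 2 → δ =O[𝓝 0] fun u => ‖u‖ ^ (k + 1) := by
    intro k
    induction k with
    | zero =>
      intro _
      have := hδd.self_of_nhds.isBigO_sub
      simpa [hδ0] using this.norm_right
    | succ k ih =>
      intro hk
      have h1 := step (k + 1) (by lia) (by lia) (ih (by lia))
      refine isBigO_of_euler (c := 0) (by lia) hδd ?_ (by simpa using h1)
      have h2 : Tendsto δ (𝓝 0) (𝓝 0) := by
        have := hδd.self_of_nhds.continuousAt.tendsto
        rwa [hδ0] at this
      simpa using (isLittleO_one_iff ℝ).2 h2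
  -- Weight one: the Euler operator u·D − 1 annihilates the linear part and sends τ − Dτ(0) to δ.
  -- Differentiability at 0 gives the required o(|u|).
  refine isBigO_of_euler (c := 1) (by lia) ?_ ?_ ?_
  · filter_upwards [hdiff] with u hu using hu.sub (fderiv ℝ τ 0).differentiableAt
  · have := (hs.differentiableAt (by simp)).hasFDerivAt.isLittleO
    simpa [hτ.map_zero] using this.norm_right
  · refine (hδk (r + 2) le_rfl).congr' ?_ EventuallyEq.rfl
    filter_upwards [hdiff] with u hu
    have h1 : HasFDerivAt (fun u => τ u - fderiv ℝ τ 0 u) (fderiv ℝ τ u - fderiv ℝ τ 0) u :=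
      hu.hasFDerivAt.sub (fderiv ℝ τ 0).hasFDerivAt
    rw [h1.fderiv]
    simp [hδ]

/-- Two connections in normal form that are related by a transformation, up to order `r + 1`, are
also related by its linear part. -/
theorem transformDefect_fderiv_of_normal {r : ℕ} {τ : OpenPartialHomeomorph E E}
    (hτ : IsDiffeoFixingZero τ) {Γ Γ' : E → E →L[ℝ] E →L[ℝ] E} (hΓ : ContDiffAt ℝ ∞ Γ 0)
    (hΓ' : ContDiffAt ℝ ∞ Γ' 0) (h0 : ∀ u, Γ u u u = 0) (h0' : ∀ u, Γ' u u u = 0)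
    (hd : transformDefect τ Γ Γ' =O[𝓝 0] fun u => ‖u‖ ^ (r + 1)) :
    transformDefect (fderiv ℝ τ 0) Γ Γ' =O[𝓝 0] fun u => ‖u‖ ^ (r + 1) := by
  set A := fderiv ℝ τ 0 with hA
  set e : E → E := fun u => τ u - A u with he
  have hs := hτ.contDiffAt hτ.mem_source
  have heO : e =O[𝓝 0] fun u => ‖u‖ ^ (r + 3) :=
    isBigO_sub_fderiv_of_normal hτ hΓ h0 h0' hd
  have hes : ContDiffAt ℝ ∞ e 0 := hs.sub A.contDiff.contDiffAt
  -- The law contains two derivatives of τ, each costing one order; this is why the nonlinear part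
  -- has to be O(|u|^(r+3)).
  have hDe : fderiv ℝ e =O[𝓝 0] fun u => ‖u‖ ^ (r + 2) := isBigO_fderiv_of_isBigO hes heO
  have hDDe : fderiv ℝ (fderiv ℝ e) =O[𝓝 0] fun u => ‖u‖ ^ (r + 1) :=
    isBigO_fderiv_of_isBigO (hes.fderiv_right (by simp)) hDe
  have hdiff : ∀ᶠ u in 𝓝 0, DifferentiableAt ℝ τ u := by
    filter_upwards [hτ.eventually_mem_source] with u hu
      using (hτ.contDiffAt hu).differentiableAt (by simp)
  have hfe : fderiv ℝ τ =ᶠ[𝓝 0] fun u => A + fderiv ℝ e u := by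
    filter_upwards [hdiff] with u hu
    have h1 : HasFDerivAt e (fderiv ℝ τ u - A) u := hu.hasFDerivAt.sub A.hasFDerivAt
    rw [h1.fderiv]
    abel
  have hfe2 : ∀ᶠ u in 𝓝 0, fderiv ℝ (fderiv ℝ τ) u = fderiv ℝ (fderiv ℝ e) u := by
    filter_upwards [hfe.eventuallyEq_nhds] with u hu
    rw [hu.fderiv_eq, fderiv_const_add]
  have hA1 : (fun _ : E => A) =O[𝓝 0] fun _ => (1 : ℝ) := isBigO_const_const _ one_ne_zero _
  have hAt : Tendsto A (𝓝 0) (𝓝 0) := A.continuous.tendsto' _ _ (map_zero A)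
  have hΓA : (fun u => Γ (A u)) =O[𝓝 0] fun _ => (1 : ℝ) :=
    (hΓ.continuousAt.isBigO_one ℝ).comp_tendsto hAt
  have hΓd : (fun u => Γ (τ u) - Γ (A u)) =O[𝓝 0] fun u => ‖u‖ ^ (r + 1) := by
    have h1 := (hΓ.hasStrictFDerivAt (by simp)).isBigO_sub
    have h2 : Tendsto (fun u => (τ u, A u)) (𝓝 0) (𝓝 ((0 : E), (0 : E))) := by
      rw [nhds_prod_eq]; exact hτ.tendsto.prodMk hAt
    have h3 : (fun u => Γ (τ u) - Γ (A u)) =O[𝓝 0] e := h1.comp_tendsto h2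
    exact h3.trans (heO.trans (isBigO_norm_pow_of_le (by lia)))
  have hDe1 := hDe.trans (isBigO_norm_pow_of_le (E := E) (show r + 1 ≤ r + 2 by lia))
  have t1 := isBigO_bilinearComp hΓd hτ.isBigO_fderiv
  have t2 : (fun u => (Γ (A u)).bilinearComp (fderiv ℝ e u) (fderiv ℝ τ u)) =O[𝓝 0]
      fun u => ‖u‖ ^ (r + 1) := by
    simpa using isBigO_bilinearComp₂ hΓA hDe1 hτ.isBigO_fderiv
  have t3 : (fun u => (Γ (A u)).bilinearComp A (fderiv ℝ e u)) =O[𝓝 0]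
      fun u => ‖u‖ ^ (r + 1) := by
    simpa using isBigO_bilinearComp₂ hΓA hA1 hDe1
  have t4 : (fun u => (ContinuousLinearMap.compL ℝ E E E (fderiv ℝ e u)).comp (Γ' u)) =O[𝓝 0]
      fun u => ‖u‖ ^ (r + 1) := by
    have h := hDe1.norm_left.mul
      ((isBigO_norm_left (E' := E →L[ℝ] E →L[ℝ] E)).2 (hΓ'.continuousAt.isBigO_one ℝ))
    simp only [mul_one] at h
    exact (IsBigO.of_bound 1 (Eventually.of_forall fun u => by
      rw [one_mul, Real.norm_of_nonneg (by positivity)]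
      exact norm_compL_comp_le _ _)).trans h
  -- Telescoping from τ to its linear part A: change the base point of Γ, then its two arguments,
  -- then the factor in front of Γ', and finally drop the second derivative.
  have total := (((((hd.add t1).add t2).add t3).sub t4).add hDDe)
  refine total.congr' ?_ EventuallyEq.rfl
  filter_upwards [hfe, hfe2] with u hu hu2
  ext a b
  have hAA : fderiv ℝ (A : E → E) = fun _ => A := funext fun u => A.fderiv
  have hAu : ∀ v, fderiv ℝ τ u v = A v + fderiv ℝ e u v := fun v => by rw [hu]; rfl
  simp only [_root_.add_apply, _root_.sub_apply, transformDefect_apply,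
    ContinuousLinearMap.bilinearComp_apply, ContinuousLinearMap.comp_apply,
    ContinuousLinearMap.compL_apply, hAA, fderiv_fun_const, Pi.zero_apply,
    _root_.zero_apply, hAu, hu2, map_add]
  abel

end Uniqueness

/-! ### Explicit normalizing coordinates and their smooth dependence on the jet. -/

section Normalization

open Asymptotics

universe u v

variable {E F : Type u} [NormedAddCommGroup E] [NormedSpace ℝ E] [NormedAddCommGroup F]
  [NormedSpace ℝ F] {P : Type v} [NormedAddCommGroup P] [NormedSpace ℝ P]

/-- A smooth map with invertible derivative at the origin is a local diffeomorphism. -/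
theorem exists_isDiffeoFixingZero [CompleteSpace E] {f : E → E} (hf : ContDiff ℝ ∞ f)
    (h0 : f 0 = 0) (e : E ≃L[ℝ] E) (he : fderiv ℝ f 0 = e) :
    ∃ τ : OpenPartialHomeomorph E E, IsDiffeoFixingZero τ ∧ (τ : E → E) = f := by
  have hd : HasFDerivAt f (e : E →L[ℝ] E) 0 :=
    he ▸ (hf.contDiffAt.differentiableAt (by simp)).hasFDerivAt
  let τ₀ := hf.contDiffAt.toOpenPartialHomeomorph f hd (by simp)
  -- The source is cut down to the points where the derivative is invertible, so that the inverse is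
  -- smooth on the whole target and not merely at the origin.
  let s : Set E := {u | fderiv ℝ f u ∈ range ((↑) : (E ≃L[ℝ] E) → E →L[ℝ] E)}
  have hs : IsOpen s := (ContinuousLinearEquiv.isOpen).preimage (hf.continuous_fderiv (by simp))
  refine ⟨τ₀.restrOpen s hs, ⟨?_, h0, hf.contDiffOn, ?_⟩, rfl⟩
  · rw [OpenPartialHomeomorph.restrOpen_source]
    exact ⟨hf.contDiffAt.mem_toOpenPartialHomeomorph_source hd (by simp), e, he.symm⟩
  · intro w hw
    have hw' : τ₀.symm w ∈ s := by
      have := (τ₀.restrOpen s hs).map_target hw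
      rw [OpenPartialHomeomorph.restrOpen_source] at this
      exact this.2
    obtain ⟨e', he'⟩ := hw'
    refine ((τ₀.restrOpen s hs).contDiffAt_symm hw (f₀' := e') ?_ hf.contDiffAt).contDiffWithinAt
    change HasFDerivAt f (e' : E →L[ℝ] E) (τ₀.symm w)
    rw [he']
    exact (hf.contDiffAt.differentiableAt (by simp)).hasFDerivAt

/-- Evaluation is polynomial jointly in the multilinear map and its arguments. -/
theorem contDiff_diagonal_uncurry {k : ℕ} {T : P → E [×k]→L[ℝ] F} {f : P → E}
    (hT : ContDiff ℝ ∞ T) (hf : ContDiff ℝ ∞ f) : ContDiff ℝ ∞ fun x => T x fun _ => f x := by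
  have h1 : ContDiff ℝ ∞ fun x : (E [×k]→L[ℝ] F) × (Fin k → E) => x.1 x.2 :=
    contDiff_iff_contDiffAt.2 fun x =>
      ((ContinuousLinearMap.id ℝ (E [×k]→L[ℝ] F)).cpolynomialOn_uncurry_of_multilinear
        (s := univ) x (mem_univ x)).contDiffAt
  exact h1.comp (hT.prodMk (contDiff_pi.2 fun _ => hf))

theorem contDiff_jetFamily_apply {r : ℕ} (m : Fin (r + 1)) :
    ContDiff ℝ ∞ fun p : JetFamily E F r => p m :=
  contDiff_pi.1 contDiff_id m

/-- Iterated derivatives commute with continuous linear maps. -/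
theorem iteratedFDeriv_clm_apply {G : Type u} [NormedAddCommGroup G] [NormedSpace ℝ G]
    (L : F →L[ℝ] G) {f : E → F} {k : ℕ} {u : E} (hf : ContDiffAt ℝ k f u) (w : Fin k → E) :
    iteratedFDeriv ℝ k (fun v => L (f v)) u w = L (iteratedFDeriv ℝ k f u w) :=
  DFunLike.congr_fun (L.iteratedFDeriv_comp_left (f := f) hf le_rfl) w

/-- Evaluation of bilinear maps. -/
def evalBilin (a b : E) : (E →L[ℝ] E →L[ℝ] E) →L[ℝ] E :=
  (ContinuousLinearMap.apply ℝ E b).comp (ContinuousLinearMap.apply ℝ (E →L[ℝ] E) a)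

theorem iteratedFDeriv_apply₂ {f : E → E →L[ℝ] E →L[ℝ] E} {k : ℕ} {u : E}
    (hf : ContDiffAt ℝ k f u) (w : Fin k → E) (a b : E) :
    iteratedFDeriv ℝ k (fun v => f v a b) u w = iteratedFDeriv ℝ k f u w a b :=
  iteratedFDeriv_clm_apply (evalBilin a b) hf w

theorem contDiff_jetPoly_uncurry {r : ℕ} :
    ContDiff ℝ ∞ fun x : JetFamily E F r × E => jetPoly x.1 x.2 := by
  unfold jetPoly
  exact ContDiff.sum fun m _ => contDiff_const.smul (contDiff_diagonal_uncurry
    ((contDiff_jetFamily_apply m).comp contDiff_fst) contDiff_snd)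

/-- The jet at the origin of a function depends smoothly on parameters. -/
theorem contDiff_iteratedFDeriv_param (k : ℕ) {F : Type u} [NormedAddCommGroup F]
    [NormedSpace ℝ F] {g : P → E → F} (hg : ∀ p, ContDiffAt ℝ ∞ (Function.uncurry g) (p, 0)) :
    ContDiff ℝ ∞ fun p => iteratedFDeriv ℝ k (g p) 0 := by
  induction k generalizing F with
  | zero =>
    have h : (fun p => iteratedFDeriv ℝ 0 (g p) 0) =
        fun p => (continuousMultilinearCurryFin0 ℝ E F).symm (g p 0) := rfl
    rw [h]
    refine (continuousMultilinearCurryFin0 ℝ E F).symm.contDiff.comp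
      (contDiff_iff_contDiffAt.2 fun p => ?_)
    exact ContDiffAt.comp (g := Function.uncurry g) (f := fun p : P => (p, (0 : E))) p (hg p)
      (contDiffAt_id.prodMk contDiffAt_const)
  | succ k ih =>
    -- The innermost derivative is split off, so that the induction hypothesis applies to the family
    -- of derivatives, again smooth in the parameter and the point.
    have h : (fun p => iteratedFDeriv ℝ (k + 1) (g p) 0) =
        fun p => (continuousMultilinearCurryRightEquiv' ℝ k E F).symm
          (iteratedFDeriv ℝ k (fderiv ℝ (g p)) 0) := by
      funext p
      rw [iteratedFDeriv_succ_eq_comp_right]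
      rfl
    rw [h]
    refine (continuousMultilinearCurryRightEquiv' ℝ k E F).symm.contDiff.comp (ih fun p => ?_)
    refine ContDiffAt.fderiv (f := fun x : P × E => g x.1) (n := ∞) (g := Prod.snd) ?_
      contDiffAt_snd (by simp)
    exact ContDiffAt.comp (g := Function.uncurry g)
      (f := fun x : (P × E) × E => (x.1.1, x.2)) ((p, 0), 0) (hg p) (by fun_prop)

theorem contDiff_jetAt_param (r : ℕ) {g : P → E → F}
    (hg : ∀ p, ContDiffAt ℝ ∞ (Function.uncurry g) (p, 0)) :
    ContDiff ℝ ∞ fun p => jetAt r (g p) :=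
  contDiff_pi.2 fun m => contDiff_iteratedFDeriv_param m hg

/-- The jets at the origin of order `r` of Christoffel symbols. -/
abbrev SymbolJet (E : Type u) [NormedAddCommGroup E] [NormedSpace ℝ E] (r : ℕ) : Type u :=
  JetFamily E (E →L[ℝ] E →L[ℝ] E) r

/-- The change of coordinates which makes the symmetrization of the derivative of order `m` of the
Christoffel symbols vanish. -/
def normalizingMap {r : ℕ} (m : Fin (r + 1)) (p : SymbolJet E r) (u : E) : E :=
  u - (((m : ℕ) + 2).factorial : ℝ)⁻¹ • p m (fun _ => u) u u

/-- The Christoffel symbols in the coordinates given by `normalizingMap`. -/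
def normalizedSymbols {r : ℕ} (m : Fin (r + 1)) (p : SymbolJet E r) (u : E) :
    E →L[ℝ] E →L[ℝ] E :=
  -- `inverse` has the default value 0 at non-invertible maps. Only the germ at the origin is used,
  -- where the derivative is the identity and nearby derivatives are invertible.
  (ContinuousLinearMap.compL ℝ E E E (fderiv ℝ (normalizingMap m p) u).inverse).comp
    ((jetPoly p (normalizingMap m p u)).bilinearComp (fderiv ℝ (normalizingMap m p) u)
      (fderiv ℝ (normalizingMap m p) u) + fderiv ℝ (fderiv ℝ (normalizingMap m p)) u)

section Smoothness

variable {r : ℕ} (m : Fin (r + 1))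

theorem contDiff_normalizingMap_uncurry :
    ContDiff ℝ ∞ fun x : SymbolJet E r × E => normalizingMap m x.1 x.2 := by
  unfold normalizingMap
  have h : ContDiff ℝ ∞ fun x : SymbolJet E r × E => x.1 m fun _ => x.2 :=
    contDiff_diagonal_uncurry ((contDiff_jetFamily_apply m).comp contDiff_fst) contDiff_snd
  exact contDiff_snd.sub (contDiff_const.smul ((h.clm_apply contDiff_snd).clm_apply contDiff_snd))

theorem contDiff_normalizingMap (p : SymbolJet E r) : ContDiff ℝ ∞ (normalizingMap m p) :=
  (contDiff_normalizingMap_uncurry m).comp (contDiff_prodMk_right p)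

theorem contDiff_fderiv_normalizingMap_uncurry :
    ContDiff ℝ ∞ fun x : SymbolJet E r × E => fderiv ℝ (normalizingMap m x.1) x.2 :=
  ContDiff.fderiv (f := fun x : SymbolJet E r × E => normalizingMap m x.1) (n := ∞)
    (g := Prod.snd) ((contDiff_normalizingMap_uncurry m).comp
      ((contDiff_fst.comp contDiff_fst).prodMk contDiff_snd)) contDiff_snd (by simp)

theorem contDiff_fderiv_fderiv_normalizingMap_uncurry :
    ContDiff ℝ ∞ fun x : SymbolJet E r × E => fderiv ℝ (fderiv ℝ (normalizingMap m x.1)) x.2 :=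
  ContDiff.fderiv (f := fun x : SymbolJet E r × E => fderiv ℝ (normalizingMap m x.1)) (n := ∞)
    (g := Prod.snd) ((contDiff_fderiv_normalizingMap_uncurry m).comp
      ((contDiff_fst.comp contDiff_fst).prodMk contDiff_snd)) contDiff_snd (by simp)

theorem normalizingMap_zero (p : SymbolJet E r) : normalizingMap m p 0 = 0 := by
  simp [normalizingMap]

theorem fderiv_normalizingMap_zero (p : SymbolJet E r) :
    fderiv ℝ (normalizingMap m p) 0 = ContinuousLinearMap.id ℝ E := by
  have h1 : HasFDerivAt (fun u : E => p m (fun _ => u)) (fderiv ℝ (fun u : E => p m (fun _ => u)) 0)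
      (0 : E) := ((contDiff_diagonal (p m) (N := 1)).differentiable (by simp) 0).hasFDerivAt
  have h2 : HasFDerivAt (normalizingMap m p) _ (0 : E) :=
    (hasFDerivAt_id (0 : E)).sub
      (((h1.clm_apply (hasFDerivAt_id (0 : E))).clm_apply (hasFDerivAt_id (0 : E))).const_smul
        (((m : ℕ) + 2).factorial : ℝ)⁻¹)
  rw [h2.fderiv]
  ext v
  simp

theorem contDiffAt_bilinearComp {x : P} {β : P → E →L[ℝ] E →L[ℝ] E} {A B : P → E →L[ℝ] E}
    (hβ : ContDiffAt ℝ ∞ β x) (hA : ContDiffAt ℝ ∞ A x) (hB : ContDiffAt ℝ ∞ B x) :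
    ContDiffAt ℝ ∞ (fun y => (β y).bilinearComp (A y) (B y)) x := by
  have hflip : ContDiff ℝ ∞ fun γ : E →L[ℝ] E →L[ℝ] E => γ.flip :=
    (ContinuousLinearMap.flipₗᵢ ℝ E E E).contDiff
  exact hflip.contDiffAt.comp x ((hflip.contDiffAt.comp x (hβ.clm_comp hA)).clm_comp hB)

theorem contDiffAt_compL_comp {x : P} {β : P → E →L[ℝ] E →L[ℝ] E} {A : P → E →L[ℝ] E}
    (hA : ContDiffAt ℝ ∞ A x) (hβ : ContDiffAt ℝ ∞ β x) :
    ContDiffAt ℝ ∞ (fun y => (ContinuousLinearMap.compL ℝ E E E (A y)).comp (β y)) x :=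
  ((ContinuousLinearMap.compL ℝ E E E).contDiff.contDiffAt.comp x hA).clm_comp hβ

/-- Joint smoothness is claimed only at the points (p, 0): there the derivative of the coordinate
change is the identity, near which inversion is smooth. -/
theorem contDiffAt_normalizedSymbols [CompleteSpace E] (p : SymbolJet E r) :
    ContDiffAt ℝ ∞ (fun x : SymbolJet E r × E => normalizedSymbols m x.1 x.2) (p, 0) := by
  have h1 : ContDiffAt ℝ ∞ (fun x : SymbolJet E r × E => fderiv ℝ (normalizingMap m x.1) x.2)
      (p, 0) := (contDiff_fderiv_normalizingMap_uncurry m).contDiffAt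
  have h2 : ContDiffAt ℝ ∞ (fun x : SymbolJet E r × E =>
      fderiv ℝ (fderiv ℝ (normalizingMap m x.1)) x.2) (p, 0) :=
    (contDiff_fderiv_fderiv_normalizingMap_uncurry m).contDiffAt
  have h3 : ContDiffAt ℝ ∞ (fun x : SymbolJet E r × E =>
      jetPoly x.1 (normalizingMap m x.1 x.2)) (p, 0) :=
    (contDiff_jetPoly_uncurry.comp (contDiff_fst.prodMk
      (contDiff_normalizingMap_uncurry m))).contDiffAt
  have h4 : ContDiffAt ℝ ∞ (fun x : SymbolJet E r × E =>
      (fderiv ℝ (normalizingMap m x.1) x.2).inverse) (p, 0) := by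
    refine ContDiffAt.comp (g := ContinuousLinearMap.inverse) (p, (0 : E)) ?_ h1
    rw [fderiv_normalizingMap_zero]
    exact contDiffAt_map_inverse (ContinuousLinearEquiv.refl ℝ E)
  have h5 := contDiffAt_bilinearComp h3 h1 h1
  have h6 : ContDiffAt ℝ ∞ (fun x : SymbolJet E r × E =>
      (jetPoly x.1 (normalizingMap m x.1 x.2)).bilinearComp (fderiv ℝ (normalizingMap m x.1) x.2)
        (fderiv ℝ (normalizingMap m x.1) x.2) + fderiv ℝ (fderiv ℝ (normalizingMap m x.1)) x.2)
      (p, 0) := h5.add h2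
  exact contDiffAt_compL_comp h4 h6

/-- The effect on jets of the change of coordinates given by `normalizingMap`. -/
def normalizeJet (p : SymbolJet E r) : SymbolJet E r := jetAt r (normalizedSymbols m p)

/-- Smoothness in the jet is what will make normalization a morphism of ringed spaces, and not just
a map of orbit sets. -/
theorem contDiff_normalizeJet [CompleteSpace E] : ContDiff ℝ ∞ (normalizeJet (E := E) m) :=
  contDiff_jetAt_param r (g := normalizedSymbols m) (contDiffAt_normalizedSymbols m)

theorem contDiffAt_normalizedSymbols_right [CompleteSpace E] (p : SymbolJet E r) :
    ContDiffAt ℝ ∞ (normalizedSymbols m p) 0 :=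
  ContDiffAt.comp (g := fun x : SymbolJet E r × E => normalizedSymbols m x.1 x.2)
    (f := fun u => (p, u)) (0 : E) (contDiffAt_normalizedSymbols m p)
    (contDiffAt_const.prodMk contDiffAt_id)

/-- Near the origin `normalizedSymbols` satisfies the transformation law exactly; replacing it by
its Taylor polynomial costs O(|u|^(r+1)), which `JetRel` ignores. -/
theorem jetRel_normalizeJet [CompleteSpace E] (p : SymbolJet E r) :
    JetRel (r + 1) (jetPoly p) (jetPoly (normalizeJet m p)) := by
  have h1 : JetRel (r + 1) (jetPoly p) (normalizedSymbols m p) := by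
    obtain ⟨τ, hτ, hτe⟩ := exists_isDiffeoFixingZero (contDiff_normalizingMap m p)
      (normalizingMap_zero m p) (ContinuousLinearEquiv.refl ℝ E) (fderiv_normalizingMap_zero m p)
    refine ⟨τ, hτ, IsBigO.of_bound 1 ?_⟩
    rw [hτe]
    have hc : ContinuousAt (fderiv ℝ (normalizingMap m p)) 0 :=
      ((contDiff_normalizingMap m p).continuous_fderiv (by simp)).continuousAt
    have hinv := hc.eventually (ContinuousLinearEquiv.isOpen.mem_nhds
      ⟨ContinuousLinearEquiv.refl ℝ E, (fderiv_normalizingMap_zero m p).symm⟩)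
    filter_upwards [hinv] with u hu
    obtain ⟨e, he⟩ := hu
    have h2 : transformDefect (normalizingMap m p) (jetPoly p) (normalizedSymbols m p) u = 0 := by
      ext a b
      rw [transformDefect_apply, normalizedSymbols, ← he]
      simp
    have h3 : ‖transformDefect (normalizingMap m p) (jetPoly p) (normalizedSymbols m p) u‖ = 0 :=
      by rw [h2]; exact ContinuousLinearMap.opNorm_zero
    rw [h3]
    positivity
  exact h1.trans (JetRel.of_isBigO ((isBigO_sub_jetPoly r
    (contDiffAt_normalizedSymbols_right m p)).neg_left.congr_left fun u => by
      rw [neg_sub]; rfl))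

/-- Jets of torsion-free connections. -/
def IsTorsionFreeJet (p : SymbolJet E r) : Prop :=
  ∀ (k : Fin (r + 1)) (w : Fin k → E) (a b : E), p k w a b = p k w b a

theorem isTorsionFreeJet_jetAt {f : E → E →L[ℝ] E →L[ℝ] E} (hf : ContDiffAt ℝ ∞ f 0)
    (h : ∀ᶠ u in 𝓝 0, ∀ a b, f u a b = f u b a) : IsTorsionFreeJet (jetAt r f) := by
  intro k w a b
  have hf' : ContDiffAt ℝ (k : ℕ) f 0 := hf.of_le (by exact_mod_cast le_top)
  have h1 : (fun v => f v a b) =ᶠ[𝓝 0] fun v => f v b a := by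
    filter_upwards [h] with u hu using hu a b
  have h2 := (h1.iteratedFDeriv ℝ k).eq_of_nhds
  calc jetAt r f k w a b = iteratedFDeriv ℝ k (fun v => f v a b) 0 w :=
        (iteratedFDeriv_apply₂ hf' w a b).symm
    _ = iteratedFDeriv ℝ k (fun v => f v b a) 0 w := by rw [h2]
    _ = jetAt r f k w b a := iteratedFDeriv_apply₂ hf' w b a

theorem jetPoly_torsionFree {p : SymbolJet E r} (hp : IsTorsionFreeJet p) (u a b : E) :
    jetPoly p u a b = jetPoly p u b a := by
  simp only [jetPoly, _root_.sum_apply, _root_.smul_apply, hp _ _ a b]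

/-- The inhomogeneous term is a second derivative, hence symmetric, so a change of coordinates
creates no torsion. -/
theorem isTorsionFreeJet_normalizeJet [CompleteSpace E] {p : SymbolJet E r}
    (hp : IsTorsionFreeJet p) : IsTorsionFreeJet (normalizeJet m p) := by
  refine isTorsionFreeJet_jetAt (contDiffAt_normalizedSymbols_right m p)
    (Eventually.of_forall fun u a b => ?_)
  have h : IsSymmSndFDerivAt ℝ (normalizingMap m p) u :=
    (contDiff_normalizingMap m p).contDiffAt.isSymmSndFDerivAt (by simpa using two_le_infty)
  simp only [normalizedSymbols, ContinuousLinearMap.comp_apply, ContinuousLinearMap.compL_apply,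
    _root_.add_apply, ContinuousLinearMap.bilinearComp_apply]
  rw [jetPoly_torsionFree hp, h.eq a b]

theorem isSymmetricJet_normalizeJet [CompleteSpace E] (p : SymbolJet E r) :
    IsSymmetricJet (normalizeJet m p) :=
  isSymmetricJet_jetAt r (contDiffAt_normalizedSymbols_right m p)

end Smoothness

end Normalization

/-! ### One degree at a time: existence of normal forms. -/

section NormalizationOrder

open Asymptotics

universe u

variable {E F : Type u} [NormedAddCommGroup E] [NormedSpace ℝ E] [NormedAddCommGroup F]
  [NormedSpace ℝ F]

/-- Euler's identity for homogeneous functions. -/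
theorem fderiv_apply_self_of_homogeneous {f : E → F} {k : ℕ} {u : E}
    (hf : DifferentiableAt ℝ f u) (h : ∀ t : ℝ, f (t • u) = t ^ k • f u) :
    fderiv ℝ f u u = (k : ℝ) • f u := by
  have h1 : HasDerivAt (fun t : ℝ => t • u) u 1 := by
    simpa using (hasDerivAt_id (1 : ℝ)).smul_const u
  have hf' : HasFDerivAt f (fderiv ℝ f u) ((1 : ℝ) • u) := by
    rw [one_smul]; exact hf.hasFDerivAt
  have h2 : HasDerivAt (fun t : ℝ => f (t • u)) (fderiv ℝ f u u) 1 := hf'.comp_hasDerivAt 1 h1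
  have h3 : HasDerivAt (fun t : ℝ => t ^ k • f u) (((k : ℝ) * 1 ^ (k - 1)) • f u) 1 :=
    (hasDerivAt_pow k (1 : ℝ)).smul_const (f u)
  simp only [h] at h2
  simpa using h2.unique h3

/-- Euler's identity for the second derivative of homogeneous functions. -/
theorem fderiv_fderiv_apply_self_of_homogeneous {f : E → E} {k : ℕ} (hf : ContDiff ℝ ∞ f)
    (h : ∀ (t : ℝ) (u : E), f (t • u) = t ^ k • f u) (u : E) :
    fderiv ℝ (fderiv ℝ f) u u u = ((k : ℝ) * (k - 1)) • f u := by
  have hd : Differentiable ℝ f := hf.differentiable (by simp)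
  have hd' : Differentiable ℝ (fderiv ℝ f) :=
    (hf.fderiv_right (m := ∞) (by simp)).differentiable (by simp)
  have h1 : (fun v => fderiv ℝ f v v) = fun v => (k : ℝ) • f v :=
    funext fun v => fderiv_apply_self_of_homogeneous (hd v) fun t => h t v
  have h2 : HasFDerivAt (fun v => fderiv ℝ f v v) _ u :=
    (hd' u).hasFDerivAt.clm_apply (hasFDerivAt_id u)
  have h3 : HasFDerivAt (fun v => (k : ℝ) • f v) _ u := (hd u).hasFDerivAt.const_smul (k : ℝ)
  rw [h1] at h2
  have h4 := DFunLike.congr_fun (h2.unique h3) u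
  have h5 := fderiv_apply_self_of_homogeneous (hd u) fun t => h t u
  simp only [_root_.add_apply, ContinuousLinearMap.comp_apply, ContinuousLinearMap.flip_apply,
    _root_.smul_apply, ContinuousLinearMap.id_apply, h5] at h4
  rw [mul_sub, mul_one, sub_smul, mul_smul, ← h4]
  simp

variable {r : ℕ}

theorem jetPoly_apply₂ (p : SymbolJet E r) (u a b : E) :
    jetPoly p u a b = ∑ j : Fin (r + 1), ((j : ℕ).factorial : ℝ)⁻¹ • p j (fun _ => u) a b := by
  simp only [jetPoly, _root_.sum_apply, _root_.smul_apply]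

theorem apply_diagonal_smul (p : SymbolJet E r) (j : Fin (r + 1)) (t : ℝ) (u : E) :
    p j (fun _ => t • u) (t • u) (t • u) = t ^ ((j : ℕ) + 2) • p j (fun _ => u) u u := by
  have := (p j).map_smul_univ (fun _ => t) fun _ => u
  simp only [Finset.prod_const, Finset.card_univ, Fintype.card_fin] at this
  rw [this]
  simp only [map_smul, _root_.smul_apply, smul_smul]
  congr 1
  ring

theorem isBigO_apply_diagonal (p : SymbolJet E r) (j : Fin (r + 1)) :
    (fun u => p j (fun _ => u) u u) =O[𝓝 0] fun u => ‖u‖ ^ ((j : ℕ) + 2) := by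
  refine IsBigO.of_bound ‖p j‖ (Eventually.of_forall fun u => ?_)
  have h1 : ‖p j fun _ => u‖ ≤ ‖p j‖ * ‖u‖ ^ (j : ℕ) := by
    simpa using (p j).le_opNorm fun _ => u
  calc ‖p j (fun _ => u) u u‖ ≤ ‖p j fun _ => u‖ * ‖u‖ * ‖u‖ :=
        ContinuousLinearMap.le_opNorm₂ _ _ _
    _ ≤ ‖p j‖ * ‖u‖ ^ (j : ℕ) * ‖u‖ * ‖u‖ := by gcongr
    _ = ‖p j‖ * ‖‖u‖ ^ ((j : ℕ) + 2)‖ := by rw [norm_pow, norm_norm]; ring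

/-- Vanishing of the symmetrized derivatives of order less than `k`. -/
theorem apply_diagonal_eq_zero_of_isBigO {p : SymbolJet E r} {k : ℕ}
    (h : (fun u => jetPoly p u u u) =O[𝓝 0] fun u => ‖u‖ ^ (k + 2)) (j : Fin (r + 1))
    (hj : (j : ℕ) < k) (u : E) : p j (fun _ => u) u u = 0 := by
  have h1 := (isBigO_pow_comp_smul h u).mono (nhdsWithin_le_nhds (s := {0}ᶜ))
  -- Along the ray through u every term carries t² from the two vector arguments. Dividing it out
  -- leaves a polynomial in t that is O(t^k).
  have h2 := (isBigO_refl (fun t : ℝ => (t ^ 2)⁻¹) (𝓝[≠] 0)).smul h1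
  have h3 : (fun t : ℝ => ∑ j : Fin (r + 1), t ^ (j : ℕ) •
      ((j : ℕ).factorial : ℝ)⁻¹ • p j (fun _ => u) u u) =O[𝓝[≠] 0] fun t => t ^ k := by
    refine h2.congr' ?_ ?_
    · filter_upwards [self_mem_nhdsWithin] with t ht
      have ht : t ≠ 0 := ht
      rw [jetPoly_apply₂, Finset.smul_sum]
      refine Finset.sum_congr rfl fun j _ => ?_
      rw [apply_diagonal_smul, smul_comm, smul_smul, smul_smul, smul_smul]
      congr 1
      rw [pow_add]
      field_simp
    · filter_upwards [self_mem_nhdsWithin] with t ht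
      have ht : t ≠ 0 := ht
      rw [smul_eq_mul, pow_add]
      field_simp
  have h4 := coeff_eq_zero_of_isBigO h3 j hj
  exact (smul_eq_zero.1 h4).resolve_left
    (inv_ne_zero (by exact_mod_cast (j : ℕ).factorial_ne_zero))

theorem isBigO_clm_apply {A : E → E →L[ℝ] E} {a : E → E} {g : E → ℝ}
    (hA : A =O[𝓝 0] fun _ => (1 : ℝ)) (ha : a =O[𝓝 0] g) : (fun u => A u (a u)) =O[𝓝 0] g := by
  have h := hA.norm_left.mul ha.norm_left
  simp only [one_mul] at h
  exact (IsBigO.of_bound 1 (Eventually.of_forall fun u => by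
    rw [one_mul, Real.norm_of_nonneg (by positivity)]
    exact (A u).le_opNorm _)).trans h

/-- Smooth functions are locally Lipschitz. -/
theorem isBigO_comp_sub_comp {f : E → F} (hf : ContDiffAt ℝ ∞ f 0) {a b : E → E}
    (ha : Tendsto a (𝓝 0) (𝓝 0)) (hb : Tendsto b (𝓝 0) (𝓝 0)) :
    (fun u => f (a u) - f (b u)) =O[𝓝 0] fun u => a u - b u := by
  have h2 : Tendsto (fun u : E => (a u, b u)) (𝓝 0) (𝓝 ((0 : E), (0 : E))) := by
    rw [nhds_prod_eq]; exact ha.prodMk hb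
  exact (hf.hasStrictFDerivAt (by simp)).isBigO_sub.comp_tendsto h2

/-- The change of coordinates `normalizingMap` improves the order of vanishing of the symmetrized
Christoffel symbols. -/
theorem isBigO_normalizeJet [CompleteSpace E] (m : Fin (r + 1)) {p : SymbolJet E r}
    (h : (fun u => jetPoly p u u u) =O[𝓝 0] fun u => ‖u‖ ^ ((m : ℕ) + 2)) :
    (fun u => jetPoly (normalizeJet m p) u u u) =O[𝓝 0] fun u => ‖u‖ ^ ((m : ℕ) + 3) := by
  set τ := normalizingMap m p with hτ
  have hτs : ContDiff ℝ ∞ τ := contDiff_normalizingMap m p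
  have hτd : Differentiable ℝ τ := hτs.differentiable (by simp)
  set H : E → E := fun u => ((m : ℕ).factorial : ℝ)⁻¹ • p m (fun _ => u) u u with hH
  set Q : E → E := fun u => -((((m : ℕ) + 2).factorial : ℝ)⁻¹ • p m (fun _ => u) u u) with hQ
  have hτQ : ∀ u, τ u = u + Q u := fun u => sub_eq_add_neg _ _
  have hQs : ContDiff ℝ ∞ Q := by
    have : Q = fun u => τ u - u := funext fun u => by rw [hτQ]; abel
    rw [this]
    exact hτs.sub contDiff_id
  have hQd : Differentiable ℝ Q := hQs.differentiable (by simp)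
  have hQh : ∀ (t : ℝ) (u : E), Q (t • u) = t ^ ((m : ℕ) + 2) • Q u := by
    intro t u
    simp only [hQ]
    rw [apply_diagonal_smul, smul_neg, smul_comm]
  have hQO : Q =O[𝓝 0] fun u => ‖u‖ ^ ((m : ℕ) + 2) :=
    ((isBigO_apply_diagonal p m).const_smul_left _).neg_left
  -- This explains the factor 1/(m+2)! in `normalizingMap`: by Euler's identity the second
  -- derivative contributes (m+2)(m+1), which leaves the Taylor factor 1/m! of the term to be
  -- removed.
  have hQH : ∀ u, ((((m : ℕ) + 2 : ℕ) : ℝ) * (((m : ℕ) + 2 : ℕ) - 1)) • Q u = -H u := by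
    intro u
    simp only [hQ, hH]
    rw [smul_neg, smul_smul]
    congr 2
    have : (((m : ℕ).factorial : ℕ) : ℝ) ≠ 0 := by exact_mod_cast (m : ℕ).factorial_ne_zero
    rw [Nat.factorial_succ, Nat.factorial_succ]
    push_cast
    have h1 : ((m : ℕ) : ℝ) + 1 + 1 ≠ 0 := by positivity
    have h2 : ((m : ℕ) : ℝ) + 1 ≠ 0 := by positivity
    field_simp
    ring
  have hfτ : fderiv ℝ τ = fun u => ContinuousLinearMap.id ℝ E + fderiv ℝ Q u := by
    funext u
    have h1 : HasFDerivAt (fun u => u + Q u) _ u := (hasFDerivAt_id u).add (hQd u).hasFDerivAt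
    rw [← h1.fderiv]
    exact congrArg (fun f => fderiv ℝ f u) (funext hτQ)
  have hffτ : ∀ u, fderiv ℝ (fderiv ℝ τ) u u u = -H u := by
    intro u
    rw [hfτ, fderiv_const_add, fderiv_fderiv_apply_self_of_homogeneous hQs hQh, hQH]
  set q : E → E := fun u => (((m : ℕ) + 2 : ℕ) : ℝ) • Q u with hq
  have hτu : ∀ u, fderiv ℝ τ u u = u + q u := by
    intro u
    rw [hfτ]
    change u + fderiv ℝ Q u u = _
    rw [fderiv_apply_self_of_homogeneous (hQd u) fun t => hQh t u]
  have hqO : q =O[𝓝 0] fun u => ‖u‖ ^ ((m : ℕ) + 2) := hQO.const_smul_left _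
  have hid : (fun u : E => u) =O[𝓝 0] fun u => ‖u‖ ^ 1 := by
    simpa using (isBigO_refl (fun u : E => u) (𝓝 0)).norm_right
  have huq : (fun u => u + q u) =O[𝓝 0] fun u => ‖u‖ ^ 1 :=
    hid.add (hqO.trans (isBigO_norm_pow_of_le (by lia)))
  have hΓs : ContDiff ℝ ∞ (jetPoly p) := contDiff_jetPoly p
  have hτ0 : Tendsto τ (𝓝 0) (𝓝 0) := hτs.continuous.tendsto' _ _ (normalizingMap_zero m p)
  have hΓτ : (fun u => jetPoly p (τ u)) =O[𝓝 0] fun _ => (1 : ℝ) :=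
    (hΓs.contDiffAt.continuousAt.isBigO_one ℝ).comp_tendsto hτ0
  have hΓd : (fun u => jetPoly p (τ u) - jetPoly p u) =O[𝓝 0] fun u => ‖u‖ ^ ((m : ℕ) + 2) := by
    refine (isBigO_comp_sub_comp hΓs.contDiffAt hτ0 tendsto_id).trans (hQO.congr_left fun u => ?_)
    simp only [hτQ, id]; abel
  -- Lower degrees vanish by the hypothesis on p, higher ones are negligible; only the degree m
  -- component H remains.
  have hΓH : (fun u => jetPoly p u u u - H u) =O[𝓝 0] fun u => ‖u‖ ^ ((m : ℕ) + 3) := by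
    have h1 : (fun u => jetPoly p u u u - H u) = fun u => ∑ j ∈ Finset.univ.erase m,
        ((j : ℕ).factorial : ℝ)⁻¹ • p j (fun _ => u) u u := by
      funext u
      rw [jetPoly_apply₂, ← Finset.add_sum_erase _ _ (Finset.mem_univ m), add_sub_cancel_left]
    rw [h1]
    refine IsBigO.fun_sum fun j hj => ?_
    rcases lt_or_ge (j : ℕ) m with hjm | hjm
    · simp only [apply_diagonal_eq_zero_of_isBigO h j hjm, smul_zero]
      exact isBigO_zero _ _
    · have hne : (j : ℕ) ≠ m := fun h => Finset.ne_of_mem_erase hj (Fin.ext h)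
      exact ((isBigO_apply_diagonal p j).const_smul_left _).trans
        (isBigO_norm_pow_of_le (by lia))
  -- The second derivative −H cancels the leading term. Moving the base point from u to τ(u), or an
  -- argument from u to u + q, changes the value by O(|u|^(m+3)).
  have hinner : (fun u => jetPoly p (τ u) (fderiv ℝ τ u u) (fderiv ℝ τ u u) +
      fderiv ℝ (fderiv ℝ τ) u u u) =O[𝓝 0] fun u => ‖u‖ ^ ((m : ℕ) + 3) := by
    have t1 : (fun u => (jetPoly p (τ u) - jetPoly p u) u u) =O[𝓝 0]
        fun u => ‖u‖ ^ ((m : ℕ) + 3) :=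
      (isBigO_apply₂ hΓd hid hid).trans (IsBigO.trans (IsBigO.of_bound 1
        (Eventually.of_forall fun u => by rw [one_mul]; exact le_of_eq (by ring_nf)))
          (isBigO_norm_pow_of_le (E := E) (show (m : ℕ) + 3 ≤ (m : ℕ) + 4 by lia)))
    have t2 : (fun u => jetPoly p (τ u) u (q u)) =O[𝓝 0] fun u => ‖u‖ ^ ((m : ℕ) + 3) :=
      (isBigO_apply₂ hΓτ hid hqO).congr_right fun u => by ring
    have t3 : (fun u => jetPoly p (τ u) (q u) (u + q u)) =O[𝓝 0] fun u => ‖u‖ ^ ((m : ℕ) + 3) :=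
      (isBigO_apply₂ hΓτ hqO huq).congr_right fun u => by ring
    refine (((hΓH.add t1).add t2).add t3).congr_left fun u => ?_
    rw [hffτ, hτu]
    simp only [_root_.sub_apply, map_add, _root_.add_apply]
    abel
  have hinv : (fun u => (fderiv ℝ τ u).inverse) =O[𝓝 0] fun _ => (1 : ℝ) := by
    have h1 : ContinuousAt (fun u => (fderiv ℝ τ u).inverse) 0 := by
      refine ContinuousAt.comp (g := ContinuousLinearMap.inverse) ?_
        (hτs.continuous_fderiv (by simp)).continuousAt
      rw [hτ, fderiv_normalizingMap_zero]
      exact (contDiffAt_map_inverse (n := 0) (ContinuousLinearEquiv.refl ℝ E)).continuousAt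
    exact h1.isBigO_one ℝ
  have hsym : (fun u => normalizedSymbols m p u u u) =O[𝓝 0] fun u => ‖u‖ ^ ((m : ℕ) + 3) :=
    (isBigO_clm_apply hinv hinner :)
  -- Truncation at order r costs r + 1 orders plus two from the arguments, and r + 3 ≥ m + 3.
  have hdiff : (fun u => (normalizedSymbols m p u - jetPoly (normalizeJet m p) u) u u) =O[𝓝 0]
      fun u => ‖u‖ ^ (r + 3) :=
    (isBigO_apply₂ (isBigO_sub_jetPoly r (contDiffAt_normalizedSymbols_right m p)) hid
      hid).congr_right fun u => by ring
  refine (hsym.sub (hdiff.trans (isBigO_norm_pow_of_le (by lia)))).congr_left fun u => ?_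
  simp only [_root_.sub_apply]
  abel

/-- Every jet of connection is equivalent to one whose symmetrized derivatives vanish, which can be
chosen to depend smoothly on the given jet. -/
theorem exists_normalization [CompleteSpace E] (r : ℕ) :
    ∃ Φ : SymbolJet E r → SymbolJet E r, ContDiff ℝ ∞ Φ ∧ ∀ p,
      JetRel (r + 1) (jetPoly p) (jetPoly (Φ p)) ∧ (IsSymmetricJet p → IsSymmetricJet (Φ p)) ∧
      (IsTorsionFreeJet p → IsTorsionFreeJet (Φ p)) ∧
      ∀ (j : Fin (r + 1)) (u : E), Φ p j (fun _ => u) u u = 0 := by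
  -- The two vector arguments give O(|u|²) to start with. Stage k removes degree k without spoiling
  -- the lower ones, so r + 1 stages exhaust the degrees 0,…,r.
  have main : ∀ k, k ≤ r + 1 → ∃ Φ : SymbolJet E r → SymbolJet E r, ContDiff ℝ ∞ Φ ∧ ∀ p,
      JetRel (r + 1) (jetPoly p) (jetPoly (Φ p)) ∧ (IsSymmetricJet p → IsSymmetricJet (Φ p)) ∧
      (IsTorsionFreeJet p → IsTorsionFreeJet (Φ p)) ∧
      (fun u => jetPoly (Φ p) u u u) =O[𝓝 0] fun u => ‖u‖ ^ (k + 2) := by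
    intro k
    induction k with
    | zero =>
      intro _
      refine ⟨id, contDiff_id, fun p => ⟨JetRel.of_isBigO ?_, id, id, ?_⟩⟩
      · simp only [id, sub_self]
        exact isBigO_zero (E' := E →L[ℝ] E →L[ℝ] E) _ _
      · simp only [id, jetPoly_apply₂]
        have h : ∀ j ∈ (Finset.univ : Finset (Fin (r + 1))),
            (fun u => ((j : ℕ).factorial : ℝ)⁻¹ • p j (fun _ => u) u u) =O[𝓝 0]
              fun u => ‖u‖ ^ (0 + 2) := fun j _ =>
          ((isBigO_apply_diagonal p j).const_smul_left _).trans (isBigO_norm_pow_of_le (by lia))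
        exact IsBigO.fun_sum h
    | succ k ih =>
      intro hk
      obtain ⟨Φ, hΦ, h⟩ := ih (by lia)
      let m : Fin (r + 1) := ⟨k, by lia⟩
      refine ⟨normalizeJet m ∘ Φ, (contDiff_normalizeJet m).comp hΦ, fun p => ?_⟩
      obtain ⟨h1, h2, h3, h4⟩ := h p
      exact ⟨h1.trans (jetRel_normalizeJet m _), fun _ => isSymmetricJet_normalizeJet m _,
        fun hp => isTorsionFreeJet_normalizeJet m (h3 hp), isBigO_normalizeJet m h4⟩
  obtain ⟨Φ, hΦ, h⟩ := main (r + 1) le_rfl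
  exact ⟨Φ, hΦ, fun p => ⟨(h p).1, (h p).2.1, (h p).2.2.1,
    fun j u => apply_diagonal_eq_zero_of_isBigO (h p).2.2.2 j j.2 u⟩⟩

end NormalizationOrder

/-! ### Centred charts and components of tangent vectors. -/

section ChartCoordinates

open Bundle

variable {n : ℕ} {M : Type*} [TopologicalSpace M] [ChartedSpace (EuclideanSpace ℝ (Fin n)) M]

/-- The preferred chart at `x`, translated so that it maps `x` to the origin. -/
def centeredChart (x : M) : OpenPartialHomeomorph M (EuclideanSpace ℝ (Fin n)) :=
  (chartAt (EuclideanSpace ℝ (Fin n)) x).transHomeomorph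
    (Homeomorph.subRight (chartAt (EuclideanSpace ℝ (Fin n)) x x))

theorem centeredChart_apply (x y : M) : (centeredChart x : M → EuclideanSpace ℝ (Fin n)) y =
    extChartAt (𝓡 n) x y - extChartAt (𝓡 n) x x := by
  simp [centeredChart]

theorem centeredChart_symm_apply (x : M) (u : EuclideanSpace ℝ (Fin n)) :
    (centeredChart x).symm u = (extChartAt (𝓡 n) x).symm (extChartAt (𝓡 n) x x + u) := by
  rw [add_comm]
  simp only [mfld_simps]
  rfl

theorem centeredChart_source (x : M) :
    (centeredChart (n := n) x).source = (chartAt (EuclideanSpace ℝ (Fin n)) x).source := rfl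

theorem mem_centeredChart_source (x : M) : x ∈ (centeredChart (n := n) x).source :=
  mem_chart_source _ x

theorem centeredChart_self (x : M) : (centeredChart x : M → EuclideanSpace ℝ (Fin n)) x = 0 := by
  rw [centeredChart_apply, sub_self]

theorem zero_mem_centeredChart_target (x : M) : 0 ∈ (centeredChart (n := n) x).target := by
  rw [← centeredChart_self x]
  exact (centeredChart x).map_source (mem_centeredChart_source x)

theorem centeredChart_symm_zero (x : M) : (centeredChart (n := n) x).symm 0 = x := by
  rw [← centeredChart_self x]
  exact (centeredChart x).left_inv (mem_centeredChart_source x)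

theorem eventually_centeredChart_symm {x y : M}
    (hy : y ∈ (centeredChart (n := n) x).source) :
    ∀ᶠ z in 𝓝 y, (centeredChart (n := n) x).symm (centeredChart (n := n) x z) = z := by
  filter_upwards [(centeredChart (n := n) x).open_source.mem_nhds hy] with z hz
  exact (centeredChart (n := n) x).left_inv hz

variable [IsManifold (𝓡 n) ∞ M]

theorem contMDiffOn_centeredChart (x : M) :
    ContMDiffOn (𝓡 n) 𝓘(ℝ, EuclideanSpace ℝ (Fin n)) ∞ (centeredChart (n := n) x)
      (centeredChart (n := n) x).source := by
  have h : ContDiff ℝ ∞ fun u : EuclideanSpace ℝ (Fin n) => u - extChartAt (𝓡 n) x x := by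
    fun_prop
  refine (h.contMDiff.comp_contMDiffOn (contMDiffOn_chart (I := 𝓡 n) (x := x))).congr ?_
  intro y _
  simp [centeredChart]

theorem contMDiffOn_centeredChart_symm (x : M) :
    ContMDiffOn 𝓘(ℝ, EuclideanSpace ℝ (Fin n)) (𝓡 n) ∞ (centeredChart (n := n) x).symm
      (centeredChart (n := n) x).target := by
  have h : ContDiff ℝ ∞ fun u : EuclideanSpace ℝ (Fin n) => u + extChartAt (𝓡 n) x x := by
    fun_prop
  refine ((contMDiffOn_chart_symm (I := 𝓡 n) (x := x)).comp h.contMDiff.contMDiffOn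
    (s := (centeredChart (n := n) x).target) ?_).congr ?_
  · intro y hy
    simpa [centeredChart, OpenPartialHomeomorph.transHomeomorph] using hy
  · intro y _
    simp only [mfld_simps, Function.comp_apply]
    rfl

/-- The components of tangent vectors in the preferred chart at `x`. -/
def components (x y : M) : TangentSpace (𝓡 n) y →L[ℝ] EuclideanSpace ℝ (Fin n) :=
  (trivializationAt (EuclideanSpace ℝ (Fin n)) (TangentSpace (𝓡 n)) x).continuousLinearMapAt ℝ y

/-- The tangent vector with given components in the preferred chart at `x`. -/
def ofComponents (x y : M) : EuclideanSpace ℝ (Fin n) →L[ℝ] TangentSpace (𝓡 n) y :=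
  (trivializationAt (EuclideanSpace ℝ (Fin n)) (TangentSpace (𝓡 n)) x).symmL ℝ y

variable {x y : M}

theorem components_ofComponents (hy : y ∈ (centeredChart (n := n) x).source)
    (a : EuclideanSpace ℝ (Fin n)) : components x y (ofComponents x y a) = a :=
  (trivializationAt (EuclideanSpace ℝ (Fin n)) (TangentSpace (𝓡 n)) x).continuousLinearMapAt_symmL
    (by simpa [centeredChart_source] using hy) a

theorem ofComponents_components (hy : y ∈ (centeredChart (n := n) x).source)
    (v : TangentSpace (𝓡 n) y) : ofComponents x y (components x y v) = v :=
  (trivializationAt (EuclideanSpace ℝ (Fin n)) (TangentSpace (𝓡 n)) x).symmL_continuousLinearMapAt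
    (by simpa [centeredChart_source] using hy) v

theorem components_eq_mfderiv_extChartAt (hy : y ∈ (centeredChart (n := n) x).source) :
    components x y =
      mfderiv (𝓡 n) 𝓘(ℝ, EuclideanSpace ℝ (Fin n)) (extChartAt (𝓡 n) x) y :=
  TangentBundle.continuousLinearMapAt_trivializationAt hy

theorem mdifferentiableAt_centeredChart (hy : y ∈ (centeredChart (n := n) x).source) :
    MDifferentiableAt (𝓡 n) 𝓘(ℝ, EuclideanSpace ℝ (Fin n)) (centeredChart (n := n) x) y :=
  ((contMDiffOn_centeredChart x).contMDiffAt
    ((centeredChart (n := n) x).open_source.mem_nhds hy)).mdifferentiableAt (by simp)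

theorem mdifferentiableAt_centeredChart_symm {u : EuclideanSpace ℝ (Fin n)}
    (hu : u ∈ (centeredChart (n := n) x).target) :
    MDifferentiableAt 𝓘(ℝ, EuclideanSpace ℝ (Fin n)) (𝓡 n) (centeredChart (n := n) x).symm u :=
  ((contMDiffOn_centeredChart_symm x).contMDiffAt
    ((centeredChart (n := n) x).open_target.mem_nhds hu)).mdifferentiableAt (by simp)

theorem components_eq_mfderiv (hy : y ∈ (centeredChart (n := n) x).source) :
    components x y = mfderiv (𝓡 n) 𝓘(ℝ, EuclideanSpace ℝ (Fin n)) (centeredChart (n := n) x) y := by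
  rw [components_eq_mfderiv_extChartAt hy]
  have h : (centeredChart x : M → EuclideanSpace ℝ (Fin n)) =
      fun y => extChartAt (𝓡 n) x y - extChartAt (𝓡 n) x x := funext (centeredChart_apply x)
  have h' : (extChartAt (𝓡 n) x : M → EuclideanSpace ℝ (Fin n)) =
      (fun u => u + extChartAt (𝓡 n) x x) ∘ (centeredChart x) := by
    funext y; simp [h]
  have hd : HasFDerivAt (fun u : EuclideanSpace ℝ (Fin n) => u + extChartAt (𝓡 n) x x)
      (ContinuousLinearMap.id ℝ _) (centeredChart x y) := (hasFDerivAt_id _).add_const _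
  have := hd.hasMFDerivAt.comp y (mdifferentiableAt_centeredChart hy).hasMFDerivAt
  rw [h', this.mfderiv]
  ext v
  rfl

/-- The components of a vector field in the preferred chart at `x`, as a function on `M`. -/
def componentField (x : M) (σ : Π y : M, TangentSpace (𝓡 n) y) (y : M) :
    EuclideanSpace ℝ (Fin n) := components x y (σ y)

theorem mdifferentiableAt_iff_componentField (hy : y ∈ (centeredChart (n := n) x).source)
    (σ : Π y : M, TangentSpace (𝓡 n) y) :
    MDifferentiableAt (𝓡 n) (𝓡 n).tangent (fun z => (⟨z, σ z⟩ : TangentBundle (𝓡 n) M)) y ↔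
      MDifferentiableAt (𝓡 n) 𝓘(ℝ, EuclideanSpace ℝ (Fin n)) (componentField x σ) y := by
  have h := (trivializationAt (EuclideanSpace ℝ (Fin n)) (TangentSpace (𝓡 n))
    x).mdifferentiableAt_section_iff (𝓡 n) σ (b₀ := y) (by simpa [centeredChart_source] using hy)
  refine h.trans (Filter.EventuallyEq.mdifferentiableAt_iff ?_)
  filter_upwards [(centeredChart (n := n) x).open_source.mem_nhds hy] with z hz
  simp only [componentField, components]
  rw [Trivialization.continuousLinearMapAt_apply, Trivialization.coe_linearMapAt_of_mem]
  simpa [centeredChart_source] using hz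

theorem contMDiffOn_iff_componentField {V : Set M} (hV : IsOpen V)
    (hV' : V ⊆ (centeredChart (n := n) x).source) (σ : Π y : M, TangentSpace (𝓡 n) y) :
    ContMDiffOn (𝓡 n) (𝓡 n).tangent ∞ (fun z => (⟨z, σ z⟩ : TangentBundle (𝓡 n) M)) V ↔
      ContMDiffOn (𝓡 n) 𝓘(ℝ, EuclideanSpace ℝ (Fin n)) ∞ (componentField x σ) V := by
  have h := (trivializationAt (EuclideanSpace ℝ (Fin n)) (TangentSpace (𝓡 n))
    x).contMDiffOn_section_iff (IB := 𝓡 n) (n := ∞) (s := σ) hV (by simpa [centeredChart_source] using hV')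
  refine h.trans (contMDiffOn_congr ?_)
  intro z hz
  simp only [componentField, components]
  rw [Trivialization.continuousLinearMapAt_apply, Trivialization.coe_linearMapAt_of_mem]
  simpa [centeredChart_source] using hV' hz

/-- The components of an endomorphism field in the preferred chart at `x`. -/
def homComponentField (x : M)
    (A : Π y : M, TangentSpace (𝓡 n) y →L[ℝ] TangentSpace (𝓡 n) y) (y : M) :
    EuclideanSpace ℝ (Fin n) →L[ℝ] EuclideanSpace ℝ (Fin n) :=
  (components x y).comp ((A y).comp (ofComponents x y))

theorem contMDiffOn_iff_homComponentField {V : Set M} (hV : IsOpen V)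
    (hV' : V ⊆ (centeredChart (n := n) x).source)
    (A : Π y : M, TangentSpace (𝓡 n) y →L[ℝ] TangentSpace (𝓡 n) y) :
    ContMDiffOn (𝓡 n)
      ((𝓡 n).prod 𝓘(ℝ, EuclideanSpace ℝ (Fin n) →L[ℝ] EuclideanSpace ℝ (Fin n))) ∞
      (fun z => (⟨z, A z⟩ : TotalSpace (EuclideanSpace ℝ (Fin n) →L[ℝ] EuclideanSpace ℝ (Fin n))
        fun z : M => TangentSpace (𝓡 n) z →L[ℝ] TangentSpace (𝓡 n) z)) V ↔
      ContMDiffOn (𝓡 n) 𝓘(ℝ, EuclideanSpace ℝ (Fin n) →L[ℝ] EuclideanSpace ℝ (Fin n)) ∞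
        (homComponentField x A) V := by
  let e := trivializationAt (EuclideanSpace ℝ (Fin n)) (TangentSpace (𝓡 n)) x
  have h := (e.continuousLinearMap (RingHom.id ℝ) e).contMDiffOn_section_iff
    (IB := 𝓡 n) (n := ∞) (s := A) hV (by
      rw [Bundle.Trivialization.baseSet_continuousLinearMap]; simpa [e, centeredChart_source] using hV')
  exact h

end ChartCoordinates

/-! ### The flat connection of a chart and constant fields. -/

section FlatConnection

open Bundle

variable {n : ℕ} {M : Type*} [TopologicalSpace M] [ChartedSpace (EuclideanSpace ℝ (Fin n)) M]
  [IsManifold (𝓡 n) ∞ M] {F : Type*} [NormedAddCommGroup F] [NormedSpace ℝ F] {x y : M}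

theorem mdifferentiableAt_iff_comp_centeredChart_symm
    (hy : y ∈ (centeredChart (n := n) x).source) (f : M → F) :
    MDifferentiableAt (𝓡 n) 𝓘(ℝ, F) f y ↔
      DifferentiableAt ℝ (f ∘ (centeredChart (n := n) x).symm) (centeredChart (n := n) x y) := by
  constructor
  · intro h
    rw [← mdifferentiableAt_iff_differentiableAt]
    refine MDifferentiableAt.comp (I' := 𝓡 n) _ ?_
      (mdifferentiableAt_centeredChart_symm ((centeredChart (n := n) x).map_source hy))
    rwa [(centeredChart (n := n) x).left_inv hy]
  · intro h
    rw [← mdifferentiableAt_iff_differentiableAt] at h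
    refine (h.comp y (mdifferentiableAt_centeredChart hy)).congr_of_eventuallyEq ?_
    filter_upwards [eventually_centeredChart_symm hy] with z hz
    simp [hz]

theorem mvfderiv_eq_fderiv_comp_centeredChart_symm
    (hy : y ∈ (centeredChart (n := n) x).source) {f : M → F}
    (hf : MDifferentiableAt (𝓡 n) 𝓘(ℝ, F) f y) (v : TangentSpace (𝓡 n) y) :
    mvfderiv (𝓡 n) f y v =
      fderiv ℝ (f ∘ (centeredChart (n := n) x).symm) (centeredChart (n := n) x y)
        (components x y v) := by
  have h := ((mdifferentiableAt_iff_comp_centeredChart_symm hy f).1 hf).hasFDerivAt.hasMFDerivAt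
  have h' := h.comp y (mdifferentiableAt_centeredChart hy).hasMFDerivAt
  have h'' := h'.congr_of_eventuallyEq (f₁ := f) (by
    filter_upwards [eventually_centeredChart_symm hy] with z hz
    simp [hz])
  rw [mvfderiv, h''.mfderiv, components_eq_mfderiv hy]
  rfl

theorem contDiffAt_comp_centeredChart_symm {V : Set M} (hV : IsOpen V) {f : M → F}
    (hf : ContMDiffOn (𝓡 n) 𝓘(ℝ, F) ∞ f V) {u : EuclideanSpace ℝ (Fin n)}
    (hu : u ∈ (centeredChart (n := n) x).target) (hu' : (centeredChart (n := n) x).symm u ∈ V) :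
    ContDiffAt ℝ ∞ (f ∘ (centeredChart (n := n) x).symm) u := by
  rw [← contMDiffAt_iff_contDiffAt]
  exact (hf.contMDiffAt (hV.mem_nhds hu')).comp u ((contMDiffOn_centeredChart_symm x).contMDiffAt
    ((centeredChart (n := n) x).open_target.mem_nhds hu))

/-- The flat connection of the preferred chart at `x`. -/
def flatConnection (x : M) (σ : Π y : M, TangentSpace (𝓡 n) y) (y : M) :
    TangentSpace (𝓡 n) y →L[ℝ] TangentSpace (𝓡 n) y :=
  (ofComponents x y).comp (mvfderiv (𝓡 n) (componentField x σ) y)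

theorem components_flatConnection (hy : y ∈ (centeredChart (n := n) x).source)
    {σ : Π y : M, TangentSpace (𝓡 n) y}
    (hσ : MDifferentiableAt (𝓡 n) (𝓡 n).tangent
      (fun z => (⟨z, σ z⟩ : TangentBundle (𝓡 n) M)) y) (v : TangentSpace (𝓡 n) y) :
    components x y (flatConnection x σ y v) =
      fderiv ℝ (componentField x σ ∘ (centeredChart (n := n) x).symm) (centeredChart (n := n) x y)
        (components x y v) := by
  rw [← mvfderiv_eq_fderiv_comp_centeredChart_symm hy
    ((mdifferentiableAt_iff_componentField hy σ).1 hσ)]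
  exact components_ofComponents hy _

/-- A reference point: subtracting it from a connection leaves a tensor, whose components are the
Christoffel symbols. -/
theorem isCovariantDerivativeOn_flatConnection (x : M) :
    IsCovariantDerivativeOn (EuclideanSpace ℝ (Fin n)) (flatConnection (n := n) x)
      (centeredChart (n := n) x).source where
  add {σ σ' y} hσ hσ' hy := by
    have h := (mdifferentiableAt_iff_componentField hy σ).1 hσ
    have h' := (mdifferentiableAt_iff_componentField hy σ').1 hσ'
    have e : componentField x (σ + σ') = componentField x σ + componentField x σ' := by
      funext z
      simp [componentField]
    rw [flatConnection, e, mvfderiv_add h h', ContinuousLinearMap.comp_add]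
    rfl
  leibniz {σ g y} hσ hg hy := by
    have h := (mdifferentiableAt_iff_componentField hy σ).1 hσ
    have e : componentField x (g • σ) = g • componentField x σ := by
      funext z
      simp [componentField]
    have e' : ofComponents x y (componentField x σ y) = σ y := ofComponents_components hy _
    rw [flatConnection, e, mvfderiv_smul hg h, ContinuousLinearMap.comp_add,
      ContinuousLinearMap.comp_smul]
    congr 1
    ext v
    simp [e']

/-- Vector fields with constant components in the preferred chart at `x`. -/
def constField (x : M) (a : EuclideanSpace ℝ (Fin n)) (y : M) : TangentSpace (𝓡 n) y :=
  ofComponents x y a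

theorem componentField_constField (hy : y ∈ (centeredChart (n := n) x).source)
    (a : EuclideanSpace ℝ (Fin n)) : componentField x (constField x a) y = a :=
  components_ofComponents hy a

theorem contMDiffOn_constField (x : M) (a : EuclideanSpace ℝ (Fin n)) :
    ContMDiffOn (𝓡 n) (𝓡 n).tangent ∞ (fun z => (⟨z, constField x a z⟩ : TangentBundle (𝓡 n) M))
      (centeredChart (n := n) x).source := by
  rw [contMDiffOn_iff_componentField (centeredChart (n := n) x).open_source subset_rfl]
  exact contMDiffOn_const.congr fun z hz => componentField_constField hz a

theorem mdifferentiableAt_constField (hy : y ∈ (centeredChart (n := n) x).source)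
    (a : EuclideanSpace ℝ (Fin n)) :
    MDifferentiableAt (𝓡 n) (𝓡 n).tangent
      (fun z => (⟨z, constField x a z⟩ : TangentBundle (𝓡 n) M)) y :=
  ((contMDiffOn_constField x a).contMDiffAt
    ((centeredChart (n := n) x).open_source.mem_nhds hy)).mdifferentiableAt (by simp)

theorem flatConnection_constField (hy : y ∈ (centeredChart (n := n) x).source)
    (a : EuclideanSpace ℝ (Fin n)) : flatConnection x (constField x a) y = 0 := by
  have h : componentField x (constField x a) =ᶠ[𝓝 y] fun _ => a := by
    filter_upwards [(centeredChart (n := n) x).open_source.mem_nhds hy] with z hz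
    exact componentField_constField hz a
  have h' : mvfderiv (𝓡 n) (componentField x (constField x a)) y = 0 := by
    rw [mvfderiv, h.mfderiv_eq, mfderiv_const]
    ext v
    rfl
  rw [flatConnection, h', ContinuousLinearMap.comp_zero]

/-- `mpullback` applies the inverse of the derivative of the chart, and on the chart domain this
inverse is `ofComponents`. -/
theorem coordField_eq_constField (hy : y ∈ (centeredChart (n := n) x).source) (i : Fin n) :
    coordField n x i y = constField x (EuclideanSpace.single i (1 : ℝ)) y := by
  have h : (mfderiv (𝓡 n) 𝓘(ℝ, EuclideanSpace ℝ (Fin n)) (extChartAt (𝓡 n) x) y).inverse =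
      ofComponents x y := by
    rw [← components_eq_mfderiv_extChartAt hy]
    refine ContinuousLinearMap.inverse_eq ?_ ?_
    · ext1 v; exact components_ofComponents hy v
    · ext1 v; exact ofComponents_components hy v
  exact congrArg (fun L => L (EuclideanSpace.single i (1 : ℝ))) h

/-- The vector with components `a` is the combination of the coordinate fields. -/
theorem ofComponents_eq_sum (x y : M) (a : EuclideanSpace ℝ (Fin n)) :
    ofComponents x y a = ∑ i, a i • ofComponents x y (EuclideanSpace.single i (1 : ℝ)) := by
  conv_lhs => rw [← (EuclideanSpace.basisFun (Fin n) ℝ).sum_repr a]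
  simp

end FlatConnection

/-! ### Christoffel symbols as a germ of bilinear maps. -/

section ChristoffelForm

open Bundle

section

universe u

variable {E F G : Type u} [NormedAddCommGroup E] [NormedSpace ℝ E] [NormedAddCommGroup F]
  [NormedSpace ℝ F] [NormedAddCommGroup G] [NormedSpace ℝ G]

/-- The bilinear map `(a, b) ↦ f(a) g(b) c`. -/
def bilinearUnit (f g : E →L[ℝ] ℝ) (c : F) : E →L[ℝ] E →L[ℝ] F :=
  f.smulRight (g.smulRight c)

theorem contDiffAt_bilinearUnit (f g : E →L[ℝ] ℝ) {c : G → F} {u : G}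
    (hc : ContDiffAt ℝ ∞ c u) : ContDiffAt ℝ ∞ (fun v => bilinearUnit f g (c v)) u :=
  contDiffAt_const.smulRight (contDiffAt_const.smulRight hc)

/-- The bilinear map with entries `c i j` with respect to families of functionals. -/
def bilinearOfEntries {ι : Type*} [Fintype ι] (f : ι → E →L[ℝ] ℝ) (c : ι → ι → F) :
    E →L[ℝ] E →L[ℝ] F :=
  ∑ i, ∑ j, bilinearUnit (f i) (f j) (c i j)

theorem bilinearOfEntries_apply {ι : Type*} [Fintype ι] (f : ι → E →L[ℝ] ℝ) (c : ι → ι → F)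
    (a b : E) : bilinearOfEntries f c a b = ∑ i, ∑ j, f i a • f j b • c i j := by
  simp [bilinearOfEntries, _root_.sum_apply, bilinearUnit]

theorem contDiffAt_bilinearOfEntries {ι : Type*} [Fintype ι] (f : ι → E →L[ℝ] ℝ)
    {c : ι → ι → G → F} {u : G} (hc : ∀ i j, ContDiffAt ℝ ∞ (c i j) u) :
    ContDiffAt ℝ ∞ (fun v => bilinearOfEntries f fun i j => c i j v) u :=
  ContDiffAt.sum (F := E →L[ℝ] E →L[ℝ] F) fun i _ =>
    ContDiffAt.sum (F := E →L[ℝ] E →L[ℝ] F) fun j _ => contDiffAt_bilinearUnit (f i) (f j) (hc i j)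

end

variable {n : ℕ} {M : Type*} [TopologicalSpace M] [ChartedSpace (EuclideanSpace ℝ (Fin n)) M]
  [IsManifold (𝓡 n) ∞ M] {x y : M}

/-- The Christoffel symbols of a connection, as a function of the centered coordinates with values
in the bilinear maps. -/
def christoffelForm (D : LocalConnection n x) (u : EuclideanSpace ℝ (Fin n)) :
    EuclideanSpace ℝ (Fin n) →L[ℝ] EuclideanSpace ℝ (Fin n) →L[ℝ] EuclideanSpace ℝ (Fin n) :=
  bilinearOfEntries (fun i : Fin n => EuclideanSpace.proj i) fun i j =>
    christoffel D i j (extChartAt (𝓡 n) x x + u)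

/-- The tensor by which a connection differs from the flat connection of the chart. -/
def connectionTensor (D : LocalConnection n x) (y : M) :
    TangentSpace (𝓡 n) y →L[ℝ] TangentSpace (𝓡 n) y →L[ℝ] TangentSpace (𝓡 n) y :=
  IsCovariantDerivativeOn.difference
    (D.isCovariantDerivativeOn.mono (inter_subset_left (t := (centeredChart (n := n) x).source)))
    ((isCovariantDerivativeOn_flatConnection x).mono inter_subset_right) y

theorem connectionTensor_apply (D : LocalConnection n x) (hy : y ∈ D.domain)
    (hy' : y ∈ (centeredChart (n := n) x).source) {σ : Π y : M, TangentSpace (𝓡 n) y}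
    (hσ : MDifferentiableAt (𝓡 n) (𝓡 n).tangent
      (fun z => (⟨z, σ z⟩ : TangentBundle (𝓡 n) M)) y) :
    connectionTensor D y (σ y) = D.cov σ y - flatConnection x σ y :=
  IsCovariantDerivativeOn.difference_apply
    (D.isCovariantDerivativeOn.mono (inter_subset_left (t := (centeredChart (n := n) x).source)))
    ((isCovariantDerivativeOn_flatConnection x).mono inter_subset_right)
    (show y ∈ (D.domain : Set M) ∩ (centeredChart (n := n) x).source from ⟨hy, hy'⟩) hσ

/-- Constant fields are parallel for the flat connection, so on them the difference tensor is the
covariant derivative itself. -/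
theorem connectionTensor_ofComponents (D : LocalConnection n x) (hy : y ∈ D.domain)
    (hy' : y ∈ (centeredChart (n := n) x).source) (b : EuclideanSpace ℝ (Fin n)) :
    connectionTensor D y (ofComponents x y b) = D.cov (constField x b) y := by
  have h := connectionTensor_apply D hy hy' (mdifferentiableAt_constField hy' b)
  rw [flatConnection_constField hy', sub_zero] at h
  exact h

theorem christoffel_centeredChart (D : LocalConnection n x) (hy : y ∈ D.domain)
    (hy' : y ∈ (centeredChart (n := n) x).source) (i j : Fin n) :
    christoffel D i j (extChartAt (𝓡 n) x x + centeredChart (n := n) x y) =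
      components x y (connectionTensor D y
        (ofComponents x y (EuclideanSpace.single j (1 : ℝ)))
        (ofComponents x y (EuclideanSpace.single i (1 : ℝ)))) := by
  have h : (extChartAt (𝓡 n) x).symm (extChartAt (𝓡 n) x x + centeredChart (n := n) x y) = y := by
    rw [← centeredChart_symm_apply, (centeredChart (n := n) x).left_inv hy']
  have hc : ∀ᶠ z in 𝓝 y, coordField n x j z =
      constField x (EuclideanSpace.single j (1 : ℝ)) z := by
    filter_upwards [(centeredChart (n := n) x).open_source.mem_nhds hy'] with z hz
    exact coordField_eq_constField hz j
  have hd := mdifferentiableAt_constField hy' (EuclideanSpace.single j (1 : ℝ))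
  have hd' : MDifferentiableAt (𝓡 n) (𝓡 n).tangent
      (fun z => (⟨z, coordField n x j z⟩ : TangentBundle (𝓡 n) M)) y := by
    refine hd.congr_of_eventuallyEq ?_
    filter_upwards [hc] with z hz
    rw [hz]
  rw [connectionTensor_ofComponents D hy hy', components_eq_mfderiv_extChartAt hy',
    ← D.isCovariantDerivativeOn.congr_of_eventuallyEq hd' hd (D.domain.isOpen.mem_nhds hy) hc]
  -- The tangent spaces depend on the point, so the equality of points is eliminated in a
  -- generalized statement instead of being rewritten.
  have key : ∀ z : M, z = y → (mfderiv (𝓡 n) 𝓘(ℝ, EuclideanSpace ℝ (Fin n)) (extChartAt (𝓡 n) x) z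
      (D.cov (coordField n x j) z (coordField n x i z)) : EuclideanSpace ℝ (Fin n)) =
      mfderiv (𝓡 n) 𝓘(ℝ, EuclideanSpace ℝ (Fin n)) (extChartAt (𝓡 n) x) y
        (D.cov (coordField n x j) y
          (ofComponents x y (EuclideanSpace.single i (1 : ℝ)))) := by
    rintro _ rfl
    exact congrArg (fun v => mfderiv (𝓡 n) 𝓘(ℝ, EuclideanSpace ℝ (Fin n)) (extChartAt (𝓡 n) x) _
      (D.cov (coordField n x j) _ v)) (coordField_eq_constField hy' i)
  exact key _ h

/-- The arguments are exchanged: the difference tensor takes the differentiated field first, whereas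
in Γᵏᵢⱼ the direction i comes first. -/
theorem christoffelForm_centeredChart (D : LocalConnection n x) (hy : y ∈ D.domain)
    (hy' : y ∈ (centeredChart (n := n) x).source) (a b : EuclideanSpace ℝ (Fin n)) :
    christoffelForm D (centeredChart (n := n) x y) a b =
      components x y (connectionTensor D y (ofComponents x y b) (ofComponents x y a)) := by
  rw [ofComponents_eq_sum x y a, ofComponents_eq_sum x y b]
  simp only [christoffelForm, bilinearOfEntries_apply, PiLp.proj_apply,
    christoffel_centeredChart D hy hy', map_sum, map_smul, _root_.sum_apply,
    _root_.smul_apply, Finset.smul_sum]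

/-- The coordinate expression of a connection. -/
theorem components_cov (D : LocalConnection n x) (hy : y ∈ D.domain)
    (hy' : y ∈ (centeredChart (n := n) x).source) {σ : Π y : M, TangentSpace (𝓡 n) y}
    (hσ : MDifferentiableAt (𝓡 n) (𝓡 n).tangent
      (fun z => (⟨z, σ z⟩ : TangentBundle (𝓡 n) M)) y) (v : TangentSpace (𝓡 n) y) :
    components x y (D.cov σ y v) =
      fderiv ℝ (componentField x σ ∘ (centeredChart (n := n) x).symm) (centeredChart (n := n) x y)
        (components x y v) +
      christoffelForm D (centeredChart (n := n) x y) (components x y v)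
        (componentField x σ y) := by
  rw [christoffelForm_centeredChart D hy hy', componentField, ofComponents_components hy',
    ofComponents_components hy', connectionTensor_apply D hy hy' hσ, _root_.sub_apply, map_sub,
    components_flatConnection hy' hσ]
  simp

/-- A bilinear identity that determines the Christoffel form. -/
theorem christoffelForm_eq_of_constField (D : LocalConnection n x) (hy : y ∈ D.domain)
    (hy' : y ∈ (centeredChart (n := n) x).source) (a b : EuclideanSpace ℝ (Fin n)) :
    christoffelForm D (centeredChart (n := n) x y) a b =
      components x y (D.cov (constField x b) y (ofComponents x y a)) := by
  rw [christoffelForm_centeredChart D hy hy', connectionTensor_ofComponents D hy hy']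

theorem eventually_symm_mem_domain (D : LocalConnection n x) :
    ∀ᶠ u in 𝓝 (0 : EuclideanSpace ℝ (Fin n)), u ∈ (centeredChart (n := n) x).target ∧
      (centeredChart (n := n) x).symm u ∈ D.domain := by
  have h0 := zero_mem_centeredChart_target (n := n) x
  refine Filter.Eventually.and ((centeredChart (n := n) x).open_target.mem_nhds h0) ?_
  refine ((centeredChart (n := n) x).continuousAt_symm h0).eventually ?_
  rw [centeredChart_symm_zero]
  exact D.domain.isOpen.mem_nhds D.mem_domain

theorem contDiffAt_christoffel_of_mem (D : LocalConnection n x) {u : EuclideanSpace ℝ (Fin n)}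
    (hu : u ∈ (centeredChart (n := n) x).target)
    (hu' : (centeredChart (n := n) x).symm u ∈ D.domain) (i j : Fin n) :
    ContDiffAt ℝ ∞ (fun v => christoffel D i j (extChartAt (𝓡 n) x x + v)) u := by
  -- Constant fields are known to be smooth only on the chart domain, so the smoothness of the
  -- connection is used on the intersection of that domain with its own.
  let V : Opens M := D.domain ⊓ ⟨(centeredChart (n := n) x).source,
    (centeredChart (n := n) x).open_source⟩
  have hV : (V : Set M) ⊆ (centeredChart (n := n) x).source := inter_subset_right
  have h1 : ContMDiffOn (𝓡 n) (𝓡 n).tangent (∞ + 1)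
      (fun z => (⟨z, constField x (EuclideanSpace.single j (1 : ℝ)) z⟩ : TangentBundle (𝓡 n) M))
      (V : Set M) := (contMDiffOn_constField x _).mono hV
  have h2 := (contMDiffOn_iff_homComponentField V.isOpen hV _).1
    ((D.smooth V inf_le_left).contMDiff h1)
  have h3 := contDiffAt_comp_centeredChart_symm V.isOpen h2 hu
    ⟨hu', (centeredChart (n := n) x).map_target hu⟩
  have h4 := h3.clm_apply (contDiffAt_const (c := EuclideanSpace.single i (1 : ℝ)))
  refine h4.congr_of_eventuallyEq ?_
  have h5 : ∀ᶠ v in 𝓝 u, (centeredChart (n := n) x).symm v ∈ D.domain :=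
    ((centeredChart (n := n) x).continuousAt_symm hu).eventually (D.domain.isOpen.mem_nhds hu')
  filter_upwards [(centeredChart (n := n) x).open_target.mem_nhds hu, h5] with v hv hv'
  have := christoffel_centeredChart D hv' ((centeredChart (n := n) x).map_target hv) i j
  rw [(centeredChart (n := n) x).right_inv hv,
    connectionTensor_ofComponents D hv' ((centeredChart (n := n) x).map_target hv)] at this
  exact this

theorem eventually_contDiffAt_christoffelForm (D : LocalConnection n x) :
    ∀ᶠ u in 𝓝 0, ContDiffAt ℝ ∞ (christoffelForm D) u := by
  filter_upwards [eventually_symm_mem_domain D] with u hu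
  exact contDiffAt_bilinearOfEntries _ fun i j => contDiffAt_christoffel_of_mem D hu.1 hu.2 i j

theorem contDiffAt_christoffelForm (D : LocalConnection n x) :
    ContDiffAt ℝ ∞ (christoffelForm D) 0 := (eventually_contDiffAt_christoffelForm D).self_of_nhds

end ChristoffelForm

/-! ### Lie brackets in coordinates and symmetric Christoffel symbols. -/

section LieBracketVectorSpace

variable {E : Type*} [NormedAddCommGroup E] [NormedSpace ℝ E]

theorem three_le_infty : (3 : WithTop ℕ∞) ≤ ∞ :=
  WithTop.coe_le_coe.2 (le_top : (3 : ℕ∞) ≤ ⊤)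

theorem mlieBracket_eq_lieBracket (V W : E → E) :
    VectorField.mlieBracket 𝓘(ℝ, E) V W = VectorField.lieBracket ℝ V W := by
  have h := VectorField.mlieBracketWithin_eq_lieBracketWithin (𝕜 := ℝ) (V := V) (W := W)
    (s := univ)
  exact h.trans VectorField.lieBracketWithin_univ

theorem lieBracket_congr {V V' W W' : E → E} {u : E} (hV : V =ᶠ[𝓝 u] V') (hW : W =ᶠ[𝓝 u] W') :
    VectorField.lieBracket ℝ V W u = VectorField.lieBracket ℝ V' W' u := by
  rw [VectorField.lieBracket, VectorField.lieBracket, hV.fderiv_eq, hW.fderiv_eq, hV.eq_of_nhds,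
    hW.eq_of_nhds]

end LieBracketVectorSpace

section ContDiffFlip

universe u

variable {E H : Type u} [NormedAddCommGroup E] [NormedSpace ℝ E] [NormedAddCommGroup H]
  [NormedSpace ℝ H]

theorem contDiffAt_flip_apply {f : H → E →L[ℝ] E →L[ℝ] E} {g : H → E} {u : H}
    (hf : ContDiffAt ℝ ∞ f u) (hg : ContDiffAt ℝ ∞ g u) :
    ContDiffAt ℝ ∞ (fun v => (f v).flip (g v)) u := by
  have hflip : ContDiff ℝ ∞ fun γ : E →L[ℝ] E →L[ℝ] E => γ.flip :=
    (ContinuousLinearMap.flipₗᵢ ℝ E E E).contDiff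
  exact (hflip.contDiffAt.comp u hf).clm_apply hg

end ContDiffFlip

section SymmetricChristoffelForm

open Bundle

variable {n : ℕ} {M : Type*} [TopologicalSpace M] [ChartedSpace (EuclideanSpace ℝ (Fin n)) M]

theorem inverse_mfderiv_symm {N : Type*} [TopologicalSpace N]
    [ChartedSpace (EuclideanSpace ℝ (Fin n)) N]
    {e : OpenPartialHomeomorph N M} (he : e.MDifferentiable (𝓡 n) (𝓡 n)) {z : N}
    (hz : z ∈ e.source) :
    (mfderiv (𝓡 n) (𝓡 n) e.symm (e z)).inverse = mfderiv (𝓡 n) (𝓡 n) e z := by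
  refine ContinuousLinearMap.inverse_eq ?_ ?_
  · exact he.symm_comp_deriv hz
  · have h := he.comp_symm_deriv (e.map_source hz)
    rw [e.left_inv hz] at h
    exact h

variable [IsManifold (𝓡 n) ∞ M] {x y : M}

theorem mdifferentiable_centeredChart (x : M) :
    (centeredChart (n := n) x).MDifferentiable (𝓡 n) 𝓘(ℝ, EuclideanSpace ℝ (Fin n)) :=
  ⟨(contMDiffOn_centeredChart x).mdifferentiableOn (by simp),
    (contMDiffOn_centeredChart_symm x).mdifferentiableOn (by simp)⟩

theorem mpullback_centeredChart_symm (σ : Π y : M, TangentSpace (𝓡 n) y)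
    {u : EuclideanSpace ℝ (Fin n)} (hu : u ∈ (centeredChart (n := n) x).target) :
    VectorField.mpullback 𝓘(ℝ, EuclideanSpace ℝ (Fin n)) (𝓡 n) (centeredChart (n := n) x).symm σ u =
      componentField x σ ((centeredChart (n := n) x).symm u) := by
  have h := inverse_mfderiv_symm (mdifferentiable_centeredChart x)
    ((centeredChart (n := n) x).map_target hu)
  rw [(centeredChart (n := n) x).right_inv hu] at h
  rw [componentField, components_eq_mfderiv ((centeredChart (n := n) x).map_target hu), ← h]
  rfl

/-- The bracket is natural under pullback by the inverse chart, which turns a field into its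
component function; on the model space the bracket is a difference of directional derivatives. -/
theorem components_mlieBracket (hy : y ∈ (centeredChart (n := n) x).source)
    {σ τ : Π y : M, TangentSpace (𝓡 n) y}
    (hσ : MDifferentiableAt (𝓡 n) (𝓡 n).tangent
      (fun z => (⟨z, σ z⟩ : TangentBundle (𝓡 n) M)) y)
    (hτ : MDifferentiableAt (𝓡 n) (𝓡 n).tangent
      (fun z => (⟨z, τ z⟩ : TangentBundle (𝓡 n) M)) y) :
    components x y (VectorField.mlieBracket (𝓡 n) σ τ y) =
      fderiv ℝ (componentField x τ ∘ (centeredChart (n := n) x).symm) (centeredChart (n := n) x y)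
        (componentField x σ y) -
      fderiv ℝ (componentField x σ ∘ (centeredChart (n := n) x).symm) (centeredChart (n := n) x y)
        (componentField x τ y) := by
  have : IsManifold (𝓡 n) (minSmoothness ℝ 3) M := IsManifold.of_le (n := ∞) (by
    rw [minSmoothness_of_isRCLikeNormedField]; exact three_le_infty)
  have hu := (centeredChart (n := n) x).map_source hy
  have hyu := (centeredChart (n := n) x).left_inv hy
  have hs : ContMDiffAt 𝓘(ℝ, EuclideanSpace ℝ (Fin n)) (𝓡 n) ∞ (centeredChart (n := n) x).symm
      (centeredChart (n := n) x y) := (contMDiffOn_centeredChart_symm x).contMDiffAt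
        ((centeredChart (n := n) x).open_target.mem_nhds hu)
  have hev : ∀ ρ : Π y : M, TangentSpace (𝓡 n) y,
      VectorField.mpullback 𝓘(ℝ, EuclideanSpace ℝ (Fin n)) (𝓡 n) (centeredChart (n := n) x).symm ρ
        =ᶠ[𝓝 (centeredChart (n := n) x y)]
        componentField x ρ ∘ (centeredChart (n := n) x).symm := fun ρ => by
    filter_upwards [(centeredChart (n := n) x).open_target.mem_nhds hu] with v hv
    exact mpullback_centeredChart_symm ρ hv
  have key := VectorField.mpullback_mlieBracket (I := 𝓘(ℝ, EuclideanSpace ℝ (Fin n)))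
    (I' := 𝓡 n) (V := σ) (W := τ) (f := (centeredChart (n := n) x).symm)
    (x₀ := centeredChart (n := n) x y) (n := ∞) (by rwa [hyu]) (by rwa [hyu]) hs
    (by rw [minSmoothness_of_isRCLikeNormedField]; exact two_le_infty)
  have hl := congrFun (mlieBracket_eq_lieBracket
    (VectorField.mpullback 𝓘(ℝ, EuclideanSpace ℝ (Fin n)) (𝓡 n) (centeredChart (n := n) x).symm σ)
    (VectorField.mpullback 𝓘(ℝ, EuclideanSpace ℝ (Fin n)) (𝓡 n) (centeredChart (n := n) x).symm τ))
    (centeredChart (n := n) x y)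
  have hl' := lieBracket_congr (hev σ) (hev τ)
  have key' := ((mpullback_centeredChart_symm (x := x) _ hu).symm.trans key).trans (hl.trans hl')
  simp only [hyu, VectorField.lieBracket, Function.comp_apply] at key'
  exact key'

theorem fderiv_componentField_constField (hy : y ∈ (centeredChart (n := n) x).source)
    (a : EuclideanSpace ℝ (Fin n)) :
    fderiv ℝ (componentField x (constField x a) ∘ (centeredChart (n := n) x).symm)
      (centeredChart (n := n) x y) = 0 := by
  have h : componentField x (constField x a) ∘ (centeredChart (n := n) x).symm
      =ᶠ[𝓝 (centeredChart (n := n) x y)] fun _ => a := by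
    filter_upwards [(centeredChart (n := n) x).open_target.mem_nhds
      ((centeredChart (n := n) x).map_source hy)] with v hv
    exact componentField_constField ((centeredChart (n := n) x).map_target hv) a
  rw [h.fderiv_eq, fderiv_const_apply]

/-- Constant fields commute, so on them torsion-freeness is the symmetry of the symbols. -/
theorem christoffelForm_symmetric {D : LocalConnection n x} (hD : D ∈ symmetricConnections n x)
    (hy : y ∈ D.domain) (hy' : y ∈ (centeredChart (n := n) x).source)
    (a b : EuclideanSpace ℝ (Fin n)) :
    christoffelForm D (centeredChart (n := n) x y) a b =
      christoffelForm D (centeredChart (n := n) x y) b a := by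
  have h := hD y hy (constField x a) (constField x b) (mdifferentiableAt_constField hy' a)
    (mdifferentiableAt_constField hy' b)
  have h' := congrArg (components x y) h
  rw [map_sub, components_mlieBracket hy' (mdifferentiableAt_constField hy' a)
    (mdifferentiableAt_constField hy' b), fderiv_componentField_constField hy',
    fderiv_componentField_constField hy', _root_.zero_apply, _root_.zero_apply, sub_self,
    sub_eq_zero] at h'
  rw [christoffelForm_eq_of_constField D hy hy', christoffelForm_eq_of_constField D hy hy']
  exact h'

theorem eventually_christoffelForm_symmetric {D : LocalConnection n x}
    (hD : D ∈ symmetricConnections n x) :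
    ∀ᶠ u in 𝓝 0, ∀ a b, christoffelForm D u a b = christoffelForm D u b a := by
  filter_upwards [eventually_symm_mem_domain D] with u hu a b
  have := christoffelForm_symmetric hD hu.2 ((centeredChart (n := n) x).map_target hu.1) a b
  rwa [(centeredChart (n := n) x).right_inv hu.1] at this

end SymmetricChristoffelForm

/-! ### Connections with prescribed Christoffel symbols. -/

section Realization

open Bundle

variable {n : ℕ} {M : Type*} [TopologicalSpace M] [ChartedSpace (EuclideanSpace ℝ (Fin n)) M]
  [IsManifold (𝓡 n) ∞ M] {x y : M}

/-- The connection given by Christoffel symbols in the preferred chart at `x`. -/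
def connectionOfForm (x : M) (Γ : EuclideanSpace ℝ (Fin n) → EuclideanSpace ℝ (Fin n) →L[ℝ]
      EuclideanSpace ℝ (Fin n) →L[ℝ] EuclideanSpace ℝ (Fin n))
    (σ : Π y : M, TangentSpace (𝓡 n) y) (y : M) : TangentSpace (𝓡 n) y →L[ℝ] TangentSpace (𝓡 n) y :=
  (ofComponents x y).comp (mvfderiv (𝓡 n) (componentField x σ) y +
    ((Γ (centeredChart (n := n) x y)).flip (componentField x σ y)).comp (components x y))

theorem connectionOfForm_eq (x : M) (Γ : EuclideanSpace ℝ (Fin n) → EuclideanSpace ℝ (Fin n) →L[ℝ]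
      EuclideanSpace ℝ (Fin n) →L[ℝ] EuclideanSpace ℝ (Fin n))
    (σ : Π y : M, TangentSpace (𝓡 n) y) (y : M) :
    connectionOfForm x Γ σ y = flatConnection x σ y + (ofComponents x y).comp
      (((Γ (centeredChart (n := n) x y)).flip (componentField x σ y)).comp (components x y)) := by
  rw [connectionOfForm, ContinuousLinearMap.comp_add]
  rfl

theorem isCovariantDerivativeOn_connectionOfForm (x : M)
    (Γ : EuclideanSpace ℝ (Fin n) → EuclideanSpace ℝ (Fin n) →L[ℝ]
      EuclideanSpace ℝ (Fin n) →L[ℝ] EuclideanSpace ℝ (Fin n)) :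
    IsCovariantDerivativeOn (EuclideanSpace ℝ (Fin n)) (connectionOfForm x Γ)
      (centeredChart (n := n) x).source where
  add {σ σ' y} hσ hσ' hy := by
    have h := (isCovariantDerivativeOn_flatConnection x).add hσ hσ' hy
    have e : componentField x (σ + σ') y = componentField x σ y + componentField x σ' y := by
      simp [componentField]
    simp only [connectionOfForm_eq, h, e, map_add, ContinuousLinearMap.comp_add,
      ContinuousLinearMap.add_comp]
    abel
  leibniz {σ g y} hσ hg hy := by
    have h := (isCovariantDerivativeOn_flatConnection x).leibniz hσ hg hy
    have e : componentField x (g • σ) y = g y • componentField x σ y := by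
      simp [componentField]
    simp only [connectionOfForm_eq, h, e, map_smul, ContinuousLinearMap.comp_smul,
      ContinuousLinearMap.smul_comp, smul_add]
    abel

theorem components_connectionOfForm
    (Γ : EuclideanSpace ℝ (Fin n) → EuclideanSpace ℝ (Fin n) →L[ℝ]
      EuclideanSpace ℝ (Fin n) →L[ℝ] EuclideanSpace ℝ (Fin n))
    (hy : y ∈ (centeredChart (n := n) x).source) {σ : Π y : M, TangentSpace (𝓡 n) y}
    (hσ : MDifferentiableAt (𝓡 n) (𝓡 n).tangent
      (fun z => (⟨z, σ z⟩ : TangentBundle (𝓡 n) M)) y) (v : TangentSpace (𝓡 n) y) :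
    components x y (connectionOfForm x Γ σ y v) =
      fderiv ℝ (componentField x σ ∘ (centeredChart (n := n) x).symm) (centeredChart (n := n) x y)
        (components x y v) +
      Γ (centeredChart (n := n) x y) (components x y v) (componentField x σ y) := by
  rw [connectionOfForm_eq, _root_.add_apply, map_add, components_flatConnection hy hσ]
  congr 1
  exact components_ofComponents hy _

theorem contMDiffOn_connectionOfForm
    {Γ : EuclideanSpace ℝ (Fin n) → EuclideanSpace ℝ (Fin n) →L[ℝ]
      EuclideanSpace ℝ (Fin n) →L[ℝ] EuclideanSpace ℝ (Fin n)}
    {V : Set M} (hV : IsOpen V) (hV' : V ⊆ (centeredChart (n := n) x).source)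
    (hΓ : ∀ y ∈ V, ContDiffAt ℝ ∞ Γ (centeredChart (n := n) x y))
    {σ : Π y : M, TangentSpace (𝓡 n) y}
    (hσ : ContMDiffOn (𝓡 n) (𝓡 n).tangent ∞
      (fun z => (⟨z, σ z⟩ : TangentBundle (𝓡 n) M)) V) :
    ContMDiffOn (𝓡 n)
      ((𝓡 n).prod 𝓘(ℝ, EuclideanSpace ℝ (Fin n) →L[ℝ] EuclideanSpace ℝ (Fin n))) ∞
      (fun z => (⟨z, connectionOfForm x Γ σ z⟩ :
        TotalSpace (EuclideanSpace ℝ (Fin n) →L[ℝ] EuclideanSpace ℝ (Fin n))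
        fun z : M => TangentSpace (𝓡 n) z →L[ℝ] TangentSpace (𝓡 n) z)) V := by
  rw [contMDiffOn_iff_homComponentField hV hV']
  have hσ' := (contMDiffOn_iff_componentField hV hV' σ).1 hσ
  intro y hy
  have hys := hV' hy
  have hu := (centeredChart (n := n) x).map_source hys
  have h1 : ContDiffAt ℝ ∞ (componentField x σ ∘ (centeredChart (n := n) x).symm)
      (centeredChart (n := n) x y) := contDiffAt_comp_centeredChart_symm hV hσ' hu (by
    rwa [(centeredChart (n := n) x).left_inv hys])
  have h2 : ContDiffAt ℝ ∞ (fun u =>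
      fderiv ℝ (componentField x σ ∘ (centeredChart (n := n) x).symm) u +
        (Γ u).flip ((componentField x σ ∘ (centeredChart (n := n) x).symm) u))
      (centeredChart (n := n) x y) := by
    refine (h1.fderiv_right (m := ∞) (by simp)).add ?_
    exact contDiffAt_flip_apply (hΓ y hy) h1
  have h4 := h2.contMDiffAt.comp y ((contMDiffOn_centeredChart x).contMDiffAt
    ((centeredChart (n := n) x).open_source.mem_nhds hys))
  refine (h4.congr_of_eventuallyEq ?_).contMDiffWithinAt
  filter_upwards [hV.mem_nhds hy] with z hz
  have hz' := hV' hz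
  have hσz := (hσ.contMDiffAt (hV.mem_nhds hz)).mdifferentiableAt (by simp)
  refine ContinuousLinearMap.ext fun a => ?_
  have := components_connectionOfForm Γ hz' hσz (ofComponents x z a)
  rw [components_ofComponents hz'] at this
  refine this.trans ?_
  simp [(centeredChart (n := n) x).left_inv hz']

/-- Every smooth germ of Christoffel symbols is the Christoffel form of a connection. -/
theorem exists_localConnection (x : M)
    {Γ : EuclideanSpace ℝ (Fin n) → EuclideanSpace ℝ (Fin n) →L[ℝ]
      EuclideanSpace ℝ (Fin n) →L[ℝ] EuclideanSpace ℝ (Fin n)}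
    {U : Set (EuclideanSpace ℝ (Fin n))} (hU : IsOpen U) (h0 : 0 ∈ U)
    (hΓ : ∀ u ∈ U, ContDiffAt ℝ ∞ Γ u) :
    ∃ D : LocalConnection n x, (∀ᶠ u in 𝓝 0, christoffelForm D u = Γ u) ∧
      ((∀ u ∈ U, ∀ a b, Γ u a b = Γ u b a) → D ∈ symmetricConnections n x) := by
  have hx : x ∈ (centeredChart (n := n) x).source ∩ centeredChart (n := n) x ⁻¹' U :=
    ⟨mem_centeredChart_source x, by rwa [mem_preimage, centeredChart_self]⟩
  let D : LocalConnection n x :=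
    { domain := ⟨(centeredChart (n := n) x).source ∩ centeredChart (n := n) x ⁻¹' U,
        (centeredChart (n := n) x).isOpen_inter_preimage hU⟩
      mem_domain := hx
      cov := connectionOfForm x Γ
      isCovariantDerivativeOn :=
        (isCovariantDerivativeOn_connectionOfForm x Γ).mono inter_subset_left
      smooth := fun V hV => ⟨fun hσ => contMDiffOn_connectionOfForm V.isOpen
        (fun y hy => (hV hy).1) (fun y hy => hΓ _ (hV hy).2) hσ⟩ }
  refine ⟨D, ?_, ?_⟩
  · filter_upwards [eventually_symm_mem_domain D] with u hu
    have hs := (centeredChart (n := n) x).map_target hu.1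
    ext1 a
    ext1 b
    have h := christoffelForm_eq_of_constField D hu.2 hs a b
    have h' := components_connectionOfForm Γ hs (mdifferentiableAt_constField hs b)
      (ofComponents x _ a)
    rw [fderiv_componentField_constField hs, components_ofComponents hs,
      componentField_constField hs, _root_.zero_apply, zero_add] at h'
    have := h.trans h'
    rwa [(centeredChart (n := n) x).right_inv hu.1] at this
  -- The derivative terms of the two covariant derivatives make up the bracket; the Γ terms cancel
  -- by symmetry.
  · intro hsymm y hy σ τ hσ hτ
    have hs : y ∈ (centeredChart (n := n) x).source := hy.1
    have h1 := components_connectionOfForm Γ hs hτ (σ y)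
    have h2 := components_connectionOfForm Γ hs hσ (τ y)
    have h3 := components_mlieBracket hs hσ hτ
    have h4 := hsymm _ hy.2 (components x y (σ y)) (components x y (τ y))
    have h5 : components x y (D.cov τ y (σ y) - D.cov σ y (τ y)) =
        components x y (VectorField.mlieBracket (𝓡 n) σ τ y) := by
      rw [map_sub, h3]
      refine (congrArg₂ _ h1 h2).trans ?_
      simp only [componentField] at h4 ⊢
      rw [h4]
      abel
    rw [← ofComponents_components hs (D.cov τ y (σ y) - D.cov σ y (τ y)), h5,
      ofComponents_components hs]

end Realization

/-! ### From approximate to exact transforms. -/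

section ExactTransform

open Asymptotics

universe u

variable {E : Type u} [NormedAddCommGroup E] [NormedSpace ℝ E]

/-- The Christoffel symbols of the transform by `τ` of the connection with symbols `Γ`. -/
def transformedSymbols (τ : E → E) (Γ : E → E →L[ℝ] E →L[ℝ] E) (u : E) : E →L[ℝ] E →L[ℝ] E :=
  (ContinuousLinearMap.compL ℝ E E E (fderiv ℝ τ u).inverse).comp
    ((Γ (τ u)).bilinearComp (fderiv ℝ τ u) (fderiv ℝ τ u) + fderiv ℝ (fderiv ℝ τ) u)

theorem transformedSymbols_apply (τ : E → E) (Γ : E → E →L[ℝ] E →L[ℝ] E) (u a b : E) :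
    transformedSymbols τ Γ u a b = (fderiv ℝ τ u).inverse
      (Γ (τ u) (fderiv ℝ τ u a) (fderiv ℝ τ u b) + fderiv ℝ (fderiv ℝ τ) u a b) := rfl

theorem transformDefect_transformedSymbols {τ : E → E} {Γ : E → E →L[ℝ] E →L[ℝ] E} {u : E}
    (h : (fderiv ℝ τ u).IsInvertible) : transformDefect τ Γ (transformedSymbols τ Γ) u = 0 := by
  obtain ⟨e, he⟩ := h
  ext a b
  rw [transformDefect_apply, transformedSymbols_apply, ← he]
  simp

theorem inverse_apply_transformDefect {τ : E → E} {Γ Γ' : E → E →L[ℝ] E →L[ℝ] E} {u : E}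
    (h : (fderiv ℝ τ u).IsInvertible) :
    (ContinuousLinearMap.compL ℝ E E E (fderiv ℝ τ u).inverse).comp (transformDefect τ Γ Γ' u) =
      Γ' u - transformedSymbols τ Γ u := by
  obtain ⟨e, he⟩ := h
  ext a b
  rw [ContinuousLinearMap.comp_apply, ContinuousLinearMap.compL_apply,
    ContinuousLinearMap.comp_apply, transformDefect_apply, _root_.sub_apply, _root_.sub_apply,
    transformedSymbols_apply, ← he]
  simp
  abel

theorem transformDefect_congr {τ τ' : E → E} {Γ Γ' : E → E →L[ℝ] E →L[ℝ] E} {u : E}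
    (h : τ =ᶠ[𝓝 u] τ') : transformDefect τ Γ Γ' u = transformDefect τ' Γ Γ' u := by
  unfold transformDefect
  rw [h.fderiv_eq, h.fderiv.fderiv_eq, h.eq_of_nhds]

theorem contDiffAt_transformedSymbols [CompleteSpace E] {τ : E → E}
    {Γ : E → E →L[ℝ] E →L[ℝ] E} {u : E} (hτ : ContDiffAt ℝ ∞ τ u)
    (hτ' : (fderiv ℝ τ u).IsInvertible) (hΓ : ContDiffAt ℝ ∞ Γ (τ u)) :
    ContDiffAt ℝ ∞ (transformedSymbols τ Γ) u := by
  have h1 : ContDiffAt ℝ ∞ (fderiv ℝ τ) u := hτ.fderiv_right (by simp)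
  have h2 : ContDiffAt ℝ ∞ (fderiv ℝ (fderiv ℝ τ)) u := h1.fderiv_right (by simp)
  have h4 : ContDiffAt ℝ ∞ (fun v => (fderiv ℝ τ v).inverse) u := by
    refine ContDiffAt.comp (g := ContinuousLinearMap.inverse) u ?_ h1
    obtain ⟨e, he⟩ := hτ'
    rw [← he]
    exact contDiffAt_map_inverse e
  have h5 : ContDiffAt ℝ ∞ (fun v => (Γ (τ v)).bilinearComp (fderiv ℝ τ v) (fderiv ℝ τ v) +
      fderiv ℝ (fderiv ℝ τ) v) u :=
    (contDiffAt_bilinearComp (ContDiffAt.comp u hΓ hτ) h1 h1).add h2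
  exact contDiffAt_compL_comp h4 h5

theorem IsDiffeoFixingZero.isInvertible_fderiv {τ : OpenPartialHomeomorph E E}
    (h : IsDiffeoFixingZero τ) {u : E} (hu : u ∈ τ.source) : (fderiv ℝ τ u).IsInvertible := by
  have key : ∀ {σ : OpenPartialHomeomorph E E}, IsDiffeoFixingZero σ → ∀ {v : E}, v ∈ σ.source →
      (fderiv ℝ σ.symm (σ v)).comp (fderiv ℝ σ v) = ContinuousLinearMap.id ℝ E := by
    intro σ hσ v hv
    have h1 : σ.symm ∘ σ =ᶠ[𝓝 v] id := by
      filter_upwards [σ.open_source.mem_nhds hv] with w hw using σ.left_inv hw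
    have h2 := h1.fderiv_eq (𝕜 := ℝ)
    rw [fderiv_comp _ ((hσ.symm.contDiffAt (σ.map_source hv)).differentiableAt (by simp))
      ((hσ.contDiffAt hv).differentiableAt (by simp)), fderiv_id] at h2
    exact h2
  have h' := key h.symm (τ.map_source hu)
  rw [τ.left_inv hu, τ.symm_symm] at h'
  exact ContinuousLinearMap.IsInvertible.of_inverse h' (key h hu)

/-- If two families of symbols are related up to terms of order `N`, then the second agrees up to
terms of order `N` with an actual transform of the first. -/
theorem exists_exact_transform [CompleteSpace E] {τ : OpenPartialHomeomorph E E}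
    (hτ : IsDiffeoFixingZero τ) {N : ℕ} {Γ Γ' : E → E →L[ℝ] E →L[ℝ] E}
    (hΓ : ∀ᶠ u in 𝓝 0, ContDiffAt ℝ ∞ Γ u)
    (h : transformDefect τ Γ Γ' =O[𝓝 0] fun u => ‖u‖ ^ N) :
    (∀ᶠ u in 𝓝 0, ContDiffAt ℝ ∞ (transformedSymbols τ Γ) u ∧
      transformDefect τ Γ (transformedSymbols τ Γ) u = 0) ∧
    (fun u => Γ' u - transformedSymbols τ Γ u) =O[𝓝 0] (fun u => ‖u‖ ^ N) ∧
    ((∀ᶠ u in 𝓝 0, ∀ a b, Γ u a b = Γ u b a) →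
      ∀ᶠ u in 𝓝 0, ∀ a b, transformedSymbols τ Γ u a b = transformedSymbols τ Γ u b a) := by
  refine ⟨?_, ?_, fun hs => ?_⟩
  · filter_upwards [hτ.eventually_mem_source, hτ.tendsto.eventually hΓ] with u hu hu'
    exact ⟨contDiffAt_transformedSymbols (hτ.contDiffAt hu) (hτ.isInvertible_fderiv hu) hu',
      transformDefect_transformedSymbols (hτ.isInvertible_fderiv hu)⟩
  -- Dτ⁻¹ is bounded near the origin, and applying it to the defect gives the difference from the
  -- exact transform.
  · have hc : ContinuousAt (fun v => (fderiv ℝ τ v).inverse) 0 := by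
      have h1 : ContDiffAt ℝ ∞ (fderiv ℝ τ) 0 :=
        (hτ.contDiffAt hτ.mem_source).fderiv_right (by simp)
      obtain ⟨e, he⟩ := hτ.isInvertible_fderiv hτ.mem_source
      have h2 : ContDiffAt ℝ ∞ ContinuousLinearMap.inverse (fderiv ℝ τ 0) := by
        rw [← he]
        exact contDiffAt_map_inverse e
      exact (ContDiffAt.comp (0 : E) h2 h1).continuousAt
    refine (isBigO_compL_comp h (hc.isBigO_one ℝ)).congr' ?_ EventuallyEq.rfl
    filter_upwards [hτ.eventually_mem_source] with u hu
    exact inverse_apply_transformDefect (hτ.isInvertible_fderiv hu)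
  · filter_upwards [hτ.eventually_mem_source, hτ.tendsto.eventually hs] with u hu hu' a b
    have h2 : IsSymmSndFDerivAt ℝ τ u :=
      (hτ.contDiffAt hu).isSymmSndFDerivAt (by simpa using two_le_infty)
    rw [transformedSymbols_apply, transformedSymbols_apply, hu', h2.eq a b]

end ExactTransform

/-! ### Transforms of connections in coordinates. -/

section TransformCoordinates

open Asymptotics Bundle

variable {n : ℕ} {M : Type*} [TopologicalSpace M] [ChartedSpace (EuclideanSpace ℝ (Fin n)) M]

/-- The coordinate expression of a local homeomorphism. -/
def coordMap (x : M) (τ : OpenPartialHomeomorph M M) :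
    OpenPartialHomeomorph (EuclideanSpace ℝ (Fin n)) (EuclideanSpace ℝ (Fin n)) :=
  ((centeredChart (n := n) x).symm.trans τ).trans (centeredChart (n := n) x)

theorem coordMap_apply (x : M) (τ : OpenPartialHomeomorph M M) (u : EuclideanSpace ℝ (Fin n)) :
    coordMap x τ u = centeredChart (n := n) x (τ ((centeredChart (n := n) x).symm u)) := rfl

theorem mem_coordMap_source {x : M} {τ : OpenPartialHomeomorph M M}
    {u : EuclideanSpace ℝ (Fin n)} : u ∈ (coordMap x τ).source ↔
      u ∈ (centeredChart (n := n) x).target ∧ (centeredChart (n := n) x).symm u ∈ τ.source ∧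
        τ ((centeredChart (n := n) x).symm u) ∈ (centeredChart (n := n) x).source := by
  simp only [coordMap, OpenPartialHomeomorph.trans_source, mem_inter_iff, mem_preimage,
    OpenPartialHomeomorph.symm_source, OpenPartialHomeomorph.coe_trans, Function.comp_apply,
    and_assoc]

theorem mdifferentiable_toFun {x : M} (τ : LocalDiffeoFixing n x) :
    τ.toFun.MDifferentiable (𝓡 n) (𝓡 n) :=
  ⟨τ.smooth.mdifferentiableOn (by simp), τ.smooth_symm.mdifferentiableOn (by simp)⟩

theorem map_centeredChart_nhds (x : M) :
    map (centeredChart (n := n) x) (𝓝 x) = 𝓝 0 := by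
  rw [(centeredChart (n := n) x).map_nhds_eq (mem_centeredChart_source x), centeredChart_self]

variable [IsManifold (𝓡 n) ∞ M] {x y : M}

theorem contDiffOn_coordMap {τ : OpenPartialHomeomorph M M}
    (hτ : ContMDiffOn (𝓡 n) (𝓡 n) ∞ τ τ.source) :
    ContDiffOn ℝ ∞ (coordMap (n := n) x τ) (coordMap (n := n) x τ).source := by
  rw [← contMDiffOn_iff_contDiffOn]
  refine (contMDiffOn_centeredChart x).comp (hτ.comp ((contMDiffOn_centeredChart_symm x).mono
    (t := (coordMap (n := n) x τ).source) ?_) ?_) ?_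
  · exact fun u hu => (mem_coordMap_source.1 hu).1
  · exact fun u hu => (mem_coordMap_source.1 hu).2.1
  · exact fun u hu => (mem_coordMap_source.1 hu).2.2

theorem isDiffeoFixingZero_coordMap (τ : LocalDiffeoFixing n x) :
    IsDiffeoFixingZero (coordMap (n := n) x τ.toFun) where
  mem_source := by
    rw [mem_coordMap_source, centeredChart_symm_zero, τ.map_point]
    exact ⟨zero_mem_centeredChart_target x, τ.mem_source, mem_centeredChart_source x⟩
  map_zero := by
    rw [coordMap_apply, centeredChart_symm_zero, τ.map_point, centeredChart_self]
  smooth := contDiffOn_coordMap τ.smooth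
  smooth_symm := by
    rw [← contMDiffOn_iff_contDiffOn]
    refine (contMDiffOn_centeredChart x).comp (τ.smooth_symm.comp
      ((contMDiffOn_centeredChart_symm x).mono fun u hu => hu.1) fun u hu => hu.2.1)
      fun u hu => hu.2.2

theorem components_mfderiv (τ : LocalDiffeoFixing n x)
    (hy : y ∈ (centeredChart (n := n) x).source) (hτ : y ∈ τ.toFun.source)
    (hτy : τ.toFun y ∈ (centeredChart (n := n) x).source) (v : TangentSpace (𝓡 n) y) :
    components x (τ.toFun y) (mfderiv (𝓡 n) (𝓡 n) τ.toFun y v) =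
      fderiv ℝ (coordMap (n := n) x τ.toFun) (centeredChart (n := n) x y) (components x y v) := by
  have h1 : MDifferentiableAt (𝓡 n) (𝓡 n) τ.toFun y :=
    (τ.smooth.contMDiffAt (τ.toFun.open_source.mem_nhds hτ)).mdifferentiableAt (by simp)
  have h2 := (mdifferentiableAt_centeredChart hτy).hasMFDerivAt.comp y h1.hasMFDerivAt
  have h3 := mvfderiv_eq_fderiv_comp_centeredChart_symm hy h2.mdifferentiableAt v
  rw [mvfderiv, h2.mfderiv] at h3
  rw [components_eq_mfderiv hτy]
  exact h3

/-- The coordinate expression of the push-forward of a vector field. -/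
theorem componentField_pushforward (τ : LocalDiffeoFixing n x)
    (σ : Π y : M, TangentSpace (𝓡 n) y) {u : EuclideanSpace ℝ (Fin n)}
    (hu : u ∈ (coordMap (n := n) x τ.toFun).source) :
    componentField x (VectorField.mpullback (𝓡 n) (𝓡 n) τ.toFun.symm σ)
      ((centeredChart (n := n) x).symm (coordMap (n := n) x τ.toFun u)) =
      fderiv ℝ (coordMap (n := n) x τ.toFun) u
        (componentField x σ ((centeredChart (n := n) x).symm u)) := by
  obtain ⟨hu1, hu2, hu3⟩ := mem_coordMap_source.1 hu
  rw [coordMap_apply, (centeredChart (n := n) x).left_inv hu3]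
  have h := components_mfderiv τ ((centeredChart (n := n) x).map_target hu1) hu2 hu3
    (σ ((centeredChart (n := n) x).symm u))
  rw [(centeredChart (n := n) x).right_inv hu1] at h
  refine Eq.trans ?_ h
  have h2 := inverse_mfderiv_symm (mdifferentiable_toFun τ) hu2
  have h3 : VectorField.mpullback (𝓡 n) (𝓡 n) τ.toFun.symm σ
      (τ.toFun ((centeredChart (n := n) x).symm u)) =
      mfderiv (𝓡 n) (𝓡 n) τ.toFun ((centeredChart (n := n) x).symm u)
        (σ ((centeredChart (n := n) x).symm u)) := by
    rw [VectorField.mpullback_apply, h2, τ.toFun.left_inv hu2]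
  rw [componentField, h3]

/-- Differentiate Z ∘ θ = Dθ·Y, where Y and Z are the components of the field and of its
push-forward; composing with θ⁻¹ shows that Z is differentiable. The D²θ term is the source of the
inhomogeneous part of the transformation law. -/
theorem mdifferentiableAt_pushforward (τ : LocalDiffeoFixing n x)
    {σ : Π y : M, TangentSpace (𝓡 n) y} {u : EuclideanSpace ℝ (Fin n)}
    (hu : u ∈ (coordMap (n := n) x τ.toFun).source)
    (hσ : DifferentiableAt ℝ (componentField x σ ∘ (centeredChart (n := n) x).symm) u) :
    DifferentiableAt ℝ (componentField x (VectorField.mpullback (𝓡 n) (𝓡 n) τ.toFun.symm σ) ∘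
      (centeredChart (n := n) x).symm) (coordMap (n := n) x τ.toFun u) ∧
    ∀ a, fderiv ℝ (componentField x (VectorField.mpullback (𝓡 n) (𝓡 n) τ.toFun.symm σ) ∘
      (centeredChart (n := n) x).symm) (coordMap (n := n) x τ.toFun u)
        (fderiv ℝ (coordMap (n := n) x τ.toFun) u a) =
      fderiv ℝ (fderiv ℝ (coordMap (n := n) x τ.toFun)) u a
          (componentField x σ ((centeredChart (n := n) x).symm u)) +
        fderiv ℝ (coordMap (n := n) x τ.toFun) u
          (fderiv ℝ (componentField x σ ∘ (centeredChart (n := n) x).symm) u a) := by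
  set θ := coordMap (n := n) x τ.toFun with hθ
  have hθd := isDiffeoFixingZero_coordMap τ
  rw [← hθ] at hθd
  set Z := componentField x (VectorField.mpullback (𝓡 n) (𝓡 n) τ.toFun.symm σ) ∘
      (centeredChart (n := n) x).symm with hZ
  have h1 : HasFDerivAt (fderiv ℝ θ) (fderiv ℝ (fderiv ℝ θ) u) u :=
    (((hθd.contDiffAt hu).fderiv_right (m := ∞) (by simp)).differentiableAt
      (by simp)).hasFDerivAt
  have h2 := h1.clm_apply hσ.hasFDerivAt
  have hev : Z ∘ θ =ᶠ[𝓝 u] fun v => fderiv ℝ θ v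
      ((componentField x σ ∘ (centeredChart (n := n) x).symm) v) := by
    filter_upwards [θ.open_source.mem_nhds hu] with v hv
    exact componentField_pushforward τ σ hv
  have h3 := h2.congr_of_eventuallyEq hev
  have hs : DifferentiableAt ℝ θ.symm (θ u) :=
    (hθd.symm.contDiffAt (θ.map_source hu)).differentiableAt (by simp)
  have h4 : DifferentiableAt ℝ Z (θ u) := by
    have h5 : DifferentiableAt ℝ (Z ∘ θ) (θ.symm (θ u)) := by
      rw [θ.left_inv hu]; exact h3.differentiableAt
    refine (h5.comp (θ u) hs).congr_of_eventuallyEq ?_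
    filter_upwards [θ.open_target.mem_nhds (θ.map_source hu)] with v hv
    simp only [Function.comp_apply, θ.right_inv hv]
  refine ⟨h4, fun a => ?_⟩
  have h6 := h4.hasFDerivAt.comp u ((hθd.contDiffAt hu).differentiableAt (by simp)).hasFDerivAt
  have h7 := congrArg (fun L => L a) (h6.unique h3)
  simp only [ContinuousLinearMap.comp_apply, _root_.add_apply,
    ContinuousLinearMap.flip_apply, Function.comp_apply] at h7
  rw [h7, add_comm]

/-- The coordinate expression of the condition that a connection is a transform of another. -/
theorem transformDefect_coordMap (τ : LocalDiffeoFixing n x) (D D' : LocalConnection n x)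
    (hy : y ∈ (centeredChart (n := n) x).source) (hτ : y ∈ τ.toFun.source)
    (hτy : τ.toFun y ∈ (centeredChart (n := n) x).source) (hD' : y ∈ D'.domain)
    (hD : τ.toFun y ∈ D.domain) {σ : Π y : M, TangentSpace (𝓡 n) y}
    (hσ : MDifferentiableAt (𝓡 n) (𝓡 n).tangent
      (fun z => (⟨z, σ z⟩ : TangentBundle (𝓡 n) M)) y) (v : TangentSpace (𝓡 n) y) :
    transformDefect (coordMap (n := n) x τ.toFun) (christoffelForm D) (christoffelForm D')
        (centeredChart (n := n) x y) (components x y v) (componentField x σ y) =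
      components x (τ.toFun y) (mfderiv (𝓡 n) (𝓡 n) τ.toFun y (D'.cov σ y v)) -
      components x (τ.toFun y) (D.cov (VectorField.mpullback (𝓡 n) (𝓡 n) τ.toFun.symm σ)
        (τ.toFun y) (mfderiv (𝓡 n) (𝓡 n) τ.toFun y v)) := by
  have hyl := (centeredChart (n := n) x).left_inv hy
  have hu : centeredChart (n := n) x y ∈ (coordMap (n := n) x τ.toFun).source := by
    rw [mem_coordMap_source, hyl]
    exact ⟨(centeredChart (n := n) x).map_source hy, hτ, hτy⟩
  have hσ' := (mdifferentiableAt_iff_comp_centeredChart_symm hy _).1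
    ((mdifferentiableAt_iff_componentField hy σ).1 hσ)
  obtain ⟨h1, h2⟩ := mdifferentiableAt_pushforward τ hu hσ'
  have hc : coordMap (n := n) x τ.toFun (centeredChart (n := n) x y) =
      centeredChart (n := n) x (τ.toFun y) := by rw [coordMap_apply, hyl]
  have hZ : MDifferentiableAt (𝓡 n) (𝓡 n).tangent (fun z =>
      (⟨z, VectorField.mpullback (𝓡 n) (𝓡 n) τ.toFun.symm σ z⟩ : TangentBundle (𝓡 n) M))
      (τ.toFun y) := by
    rw [mdifferentiableAt_iff_componentField hτy,
      mdifferentiableAt_iff_comp_centeredChart_symm hτy, ← hc]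
    exact h1
  have h3 := componentField_pushforward τ σ hu
  rw [hc, (centeredChart (n := n) x).left_inv hτy, hyl] at h3
  rw [components_mfderiv τ hy hτ hτy, components_cov D' hD' hy hσ, components_cov D hD hτy hZ, h3,
    components_mfderiv τ hy hτ hτy, ← hc, h2, hyl, transformDefect_apply, map_add]
  abel

/-- In `transformDefect_coordMap` the derivatives of the field cancel, so the condition is
tensorial: it depends only on the values of X and Y at the point. -/
theorem isTransform_iff (τ : LocalDiffeoFixing n x) (D D' : LocalConnection n x) :
    IsTransform τ D D' ↔ ∀ᶠ u in 𝓝 0, transformDefect (coordMap (n := n) x τ.toFun)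
      (christoffelForm D) (christoffelForm D') u = 0 := by
  rw [← map_centeredChart_nhds x, eventually_map, IsTransform]
  have hx := mem_centeredChart_source (n := n) x
  have hc : Tendsto τ.toFun (𝓝 x) (𝓝 x) := by
    have := (τ.toFun.continuousAt τ.mem_source).tendsto
    rwa [τ.map_point] at this
  have hs := (centeredChart (n := n) x).open_source.mem_nhds hx
  refine eventually_congr ?_
  filter_upwards [hs, τ.toFun.open_source.mem_nhds τ.mem_source, hc.eventually hs,
    D'.domain.isOpen.mem_nhds D'.mem_domain,
    hc.eventually (D.domain.isOpen.mem_nhds D.mem_domain)] with y hy hτ hτy hD' hD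
  constructor
  -- Constant fields already realize every pair of vectors at y.
  · intro h
    ext1 a
    ext1 b
    have h1 := transformDefect_coordMap τ D D' hy hτ hτy hD' hD
      (mdifferentiableAt_constField hy b) (ofComponents x y a)
    rw [components_ofComponents hy, componentField_constField hy] at h1
    have h2 := h (constField x a) (constField x b) (mdifferentiableAt_constField hy b)
    rw [constField] at h2
    rw [h1, h2, sub_self]
    rfl
  · intro h X Y hY
    have h1 := transformDefect_coordMap τ D D' hy hτ hτy hD' hD hY (X y)
    rw [h, _root_.zero_apply, _root_.zero_apply, eq_comm, sub_eq_zero] at h1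
    have h2 := congrArg (ofComponents x (τ.toFun y)) h1
    rwa [ofComponents_components hτy, ofComponents_components hτy] at h2

/-- The local diffeomorphism of the manifold with given coordinate expression. -/
def ofCoordMap (x : M) {θ : OpenPartialHomeomorph (EuclideanSpace ℝ (Fin n))
    (EuclideanSpace ℝ (Fin n))} (hθ : IsDiffeoFixingZero θ) : LocalDiffeoFixing n x where
  toFun := ((centeredChart (n := n) x).trans θ).trans (centeredChart (n := n) x).symm
  mem_source := by
    simp only [OpenPartialHomeomorph.trans_source, mem_inter_iff, mem_preimage,
      OpenPartialHomeomorph.symm_source, OpenPartialHomeomorph.coe_trans, Function.comp_apply,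
      centeredChart_self, hθ.map_zero]
    exact ⟨⟨mem_centeredChart_source x, hθ.mem_source⟩, zero_mem_centeredChart_target x⟩
  map_point := by
    simp only [OpenPartialHomeomorph.coe_trans, Function.comp_apply, centeredChart_self,
      hθ.map_zero, centeredChart_symm_zero]
  smooth := by
    refine (contMDiffOn_centeredChart_symm x).comp
      (hθ.smooth.contMDiffOn.comp ((contMDiffOn_centeredChart x).mono fun y hy => hy.1.1)
        fun y hy => hy.1.2) fun y hy => hy.2
  smooth_symm := by
    refine (contMDiffOn_centeredChart_symm x).comp
      (hθ.smooth_symm.contMDiffOn.comp ((contMDiffOn_centeredChart x).mono fun y hy => hy.1)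
        fun y hy => hy.2.1) fun y hy => hy.2.2

/-- An equality of germs only: chart and inverse chart cancel when both u and θ u lie in the target
of the chart. -/
theorem coordMap_ofCoordMap (x : M) {θ : OpenPartialHomeomorph (EuclideanSpace ℝ (Fin n))
    (EuclideanSpace ℝ (Fin n))} (hθ : IsDiffeoFixingZero θ) :
    ∀ᶠ u in 𝓝 0, coordMap (n := n) x (ofCoordMap x hθ).toFun u = θ u := by
  have h0 := (centeredChart (n := n) x).open_target.mem_nhds (zero_mem_centeredChart_target x)
  filter_upwards [h0, hθ.tendsto.eventually h0] with u hu hu'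
  simp only [coordMap_apply, ofCoordMap, OpenPartialHomeomorph.coe_trans, Function.comp_apply,
    (centeredChart (n := n) x).right_inv hu]
  exact (centeredChart (n := n) x).right_inv hu'

end TransformCoordinates

/-! ### Linear coordinates on jets of Christoffel symbols. -/

section CompMultilinear

universe u

variable {E F G : Type u} [NormedAddCommGroup E] [NormedSpace ℝ E] [NormedAddCommGroup F]
  [NormedSpace ℝ F] [NormedAddCommGroup G] [NormedSpace ℝ G]

/-- Postcomposition of multilinear maps with a continuous linear map. -/
def postcompMultilinear (k : ℕ) (L : F →L[ℝ] G) (T : E [×k]→L[ℝ] F) : E [×k]→L[ℝ] G :=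
  L.compContinuousMultilinearMap T

theorem contDiff_postcompMultilinear (k : ℕ) (L : F →L[ℝ] G) :
    ContDiff ℝ ∞ (postcompMultilinear (E := E) k L) :=
  (ContinuousLinearMap.compContinuousMultilinearMapL ℝ (fun _ : Fin k => E) F G L).contDiff

/-- The linear map `c ↦ ((a, b) ↦ f(a) g(b) c)`. -/
def bilinearUnitL (f g : E →L[ℝ] ℝ) : F →L[ℝ] E →L[ℝ] E →L[ℝ] F :=
  (ContinuousLinearMap.smulRightL ℝ E (E →L[ℝ] F) f).comp (ContinuousLinearMap.smulRightL ℝ E F g)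

end CompMultilinear

section JetCoordinates

variable {n r : ℕ}

/-- The jet of Christoffel symbols with given coordinates, as a family of multilinear maps with
values in the bilinear maps. -/
def symbolsOfCoord (c : JetCoordSpace n r) : SymbolJet (EuclideanSpace ℝ (Fin n)) r := fun m =>
  ∑ i : Fin n, ∑ j : Fin n, postcompMultilinear
    (G := EuclideanSpace ℝ (Fin n) →L[ℝ] EuclideanSpace ℝ (Fin n) →L[ℝ] EuclideanSpace ℝ (Fin n))
    m (bilinearUnitL (EuclideanSpace.proj i) (EuclideanSpace.proj j)) (c m i j)

theorem symbolsOfCoord_apply (c : JetCoordSpace n r) (m : Fin (r + 1))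
    (w : Fin m → EuclideanSpace ℝ (Fin n)) (a b : EuclideanSpace ℝ (Fin n)) :
    symbolsOfCoord c m w a b = ∑ i, ∑ j, a i • b j • c m i j w := by
  simp only [symbolsOfCoord, _root_.sum_apply]
  rfl

/-- The coordinates of a jet of Christoffel symbols. -/
def coordOfSymbols (q : SymbolJet (EuclideanSpace ℝ (Fin n)) r) : JetCoordSpace n r :=
  fun m i j => postcompMultilinear
    (F := EuclideanSpace ℝ (Fin n) →L[ℝ] EuclideanSpace ℝ (Fin n) →L[ℝ] EuclideanSpace ℝ (Fin n))
    m (evalBilin (EuclideanSpace.single i (1 : ℝ)) (EuclideanSpace.single j (1 : ℝ))) (q m)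

theorem coordOfSymbols_apply (q : SymbolJet (EuclideanSpace ℝ (Fin n)) r) (m : Fin (r + 1))
    (i j : Fin n) (w : Fin m → EuclideanSpace ℝ (Fin n)) :
    coordOfSymbols q m i j w =
      q m w (EuclideanSpace.single i (1 : ℝ)) (EuclideanSpace.single j (1 : ℝ)) := rfl

theorem contDiff_symbolsOfCoord :
    ContDiff ℝ ∞ (symbolsOfCoord : JetCoordSpace n r → _) := by
  refine contDiff_pi.2 fun m => ContDiff.sum fun i _ => ContDiff.sum fun j _ => ?_
  have h : ContDiff ℝ ∞ fun c : JetCoordSpace n r => c m i j :=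
    contDiff_pi.1 (contDiff_pi.1 (contDiff_pi.1 contDiff_id m) i) j
  exact (contDiff_postcompMultilinear _ _).comp h

theorem contDiff_coordOfSymbols :
    ContDiff ℝ ∞ (coordOfSymbols : SymbolJet (EuclideanSpace ℝ (Fin n)) r → _) := by
  refine contDiff_pi.2 fun m => contDiff_pi.2 fun i => contDiff_pi.2 fun j => ?_
  exact (contDiff_postcompMultilinear _ _).comp (contDiff_jetFamily_apply m)

theorem coordOfSymbols_symbolsOfCoord (c : JetCoordSpace n r) :
    coordOfSymbols (symbolsOfCoord c) = c := by
  funext m i j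
  ext1 w
  rw [coordOfSymbols_apply, symbolsOfCoord_apply]
  rw [Finset.sum_eq_single i, Finset.sum_eq_single j]
  · simp
  · intro l _ hl; simp [hl]
  · simp
  · intro l _ hl; simp [hl]
  · simp

theorem symbolsOfCoord_coordOfSymbols (q : SymbolJet (EuclideanSpace ℝ (Fin n)) r) :
    symbolsOfCoord (coordOfSymbols q) = q := by
  funext m
  refine ContinuousMultilinearMap.ext fun w => ContinuousLinearMap.ext fun a =>
    ContinuousLinearMap.ext fun b => ?_
  have h : ∀ v : EuclideanSpace ℝ (Fin n),
      ∑ i, v i • EuclideanSpace.single i (1 : ℝ) = v := fun v => by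
    conv_rhs => rw [← (EuclideanSpace.basisFun (Fin n) ℝ).sum_repr v]
    simp
  rw [symbolsOfCoord_apply]
  conv_rhs => rw [← h a, ← h b]
  simp only [coordOfSymbols_apply, map_sum, map_smul, _root_.sum_apply, _root_.smul_apply,
    Finset.smul_sum]
  rw [Finset.sum_comm]
  exact Finset.sum_congr rfl fun _ _ => Finset.sum_congr rfl fun _ _ => smul_comm _ _ _

end JetCoordinates

/-! ### Equivalence of jets of connections in terms of symbols. -/

section JetEquivalence

open Asymptotics

variable {n : ℕ} {M : Type*} [TopologicalSpace M] [ChartedSpace (EuclideanSpace ℝ (Fin n)) M]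
  [IsManifold (𝓡 n) ∞ M] {x : M}

/-- Derivatives commute with evaluation on basis vectors, and centring the chart only translates the
base point. -/
theorem symbolsOfCoord_jetCoord (r : ℕ) (D : LocalConnection n x) :
    symbolsOfCoord (jetCoord r D) = jetAt r (christoffelForm D) := by
  rw [← symbolsOfCoord_coordOfSymbols (jetAt r (christoffelForm D))]
  congr 1
  funext m i j
  ext1 w
  have hm : ((m : ℕ) : WithTop ℕ∞) ≤ ∞ := by exact_mod_cast le_top
  have h1 : jetAt r (christoffelForm D) m w (EuclideanSpace.single i (1 : ℝ))
      (EuclideanSpace.single j (1 : ℝ)) = iteratedFDeriv ℝ m (fun v => christoffelForm D v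
        (EuclideanSpace.single i (1 : ℝ)) (EuclideanSpace.single j (1 : ℝ))) 0 w :=
    (iteratedFDeriv_apply₂ ((contDiffAt_christoffelForm D).of_le hm) w _ _).symm
  have h2 : (fun v => christoffelForm D v (EuclideanSpace.single i (1 : ℝ))
      (EuclideanSpace.single j (1 : ℝ))) =
      fun v => christoffel D i j (extChartAt (𝓡 n) x x + v) := by
    funext v
    rw [christoffelForm, bilinearOfEntries_apply, Finset.sum_eq_single i, Finset.sum_eq_single j]
    · simp
    · intro l _ hl; simp [hl]
    · simp
    · intro l _ hl; simp [hl]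
    · simp
  rw [coordOfSymbols_apply, h1, h2, iteratedFDeriv_comp_add_left, add_zero]
  rfl

theorem jetCoord_eq_iff (r : ℕ) (D D' : LocalConnection n x) :
    jetCoord r D = jetCoord r D' ↔ jetAt r (christoffelForm D) = jetAt r (christoffelForm D') := by
  rw [← symbolsOfCoord_jetCoord, ← symbolsOfCoord_jetCoord]
  exact ⟨fun h => by rw [h], fun h => by
    rw [← coordOfSymbols_symbolsOfCoord (jetCoord r D), h, coordOfSymbols_symbolsOfCoord]⟩

theorem IsTransform.jetRel {τ : LocalDiffeoFixing n x} {D D' : LocalConnection n x}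
    (h : IsTransform τ D D') (N : ℕ) : JetRel N (christoffelForm D) (christoffelForm D') := by
  refine ⟨_, isDiffeoFixingZero_coordMap τ, ?_⟩
  refine IsBigO.of_bound 1 ?_
  filter_upwards [(isTransform_iff τ D D').1 h] with u hu
  have h3 : ‖transformDefect (coordMap (n := n) x τ.toFun) (christoffelForm D) (christoffelForm D')
      u‖ = 0 := by rw [hu]; exact ContinuousLinearMap.opNorm_zero
  rw [h3]
  positivity

/-- If the Christoffel symbols of two connections are related up to terms of order `r + 1`, then
the `r`-jet of the second is that of a transform of the first. -/
theorem JetRel.exists_isTransform {r : ℕ} {D D' : LocalConnection n x}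
    (h : JetRel (r + 1) (christoffelForm D) (christoffelForm D')) :
    ∃ (τ : LocalDiffeoFixing n x) (D'' : LocalConnection n x), IsTransform τ D D'' ∧
      jetCoord r D'' = jetCoord r D' ∧
      (D ∈ symmetricConnections n x → D'' ∈ symmetricConnections n x) := by
  obtain ⟨θ, hθ, hd⟩ := h
  obtain ⟨h1, h2, h3⟩ := exists_exact_transform hθ (eventually_contDiffAt_christoffelForm D) hd
  -- Everything needed is collected on one neighbourhood; stating symmetry conditionally treats both
  -- classes of connections at once.
  have h4 : ∀ᶠ u in 𝓝 0, (ContDiffAt ℝ ∞ (transformedSymbols θ (christoffelForm D)) u ∧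
      transformDefect θ (christoffelForm D) (transformedSymbols θ (christoffelForm D)) u = 0) ∧
      (D ∈ symmetricConnections n x → ∀ a b, transformedSymbols θ (christoffelForm D) u a b =
        transformedSymbols θ (christoffelForm D) u b a) := by
    refine h1.and ?_
    by_cases hD : D ∈ symmetricConnections n x
    · exact (h3 (eventually_christoffelForm_symmetric hD)).mono fun u hu _ => hu
    · exact Eventually.of_forall fun u hD' => absurd hD' hD
  obtain ⟨U, hU, hUo, h0⟩ := eventually_nhds_iff.1 h4
  obtain ⟨D'', hD'', hs⟩ := exists_localConnection x hUo h0 fun u hu => (hU u hu).1.1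
  refine ⟨ofCoordMap x hθ, D'', ?_, ?_, fun hD => hs fun u hu => (hU u hu).2 hD⟩
  · rw [isTransform_iff]
    -- The coordinate maps must agree near each u, since the defect contains two derivatives of
    -- them; for the symbols of `D''` agreement at u is enough.
    filter_upwards [(coordMap_ofCoordMap x hθ).eventually_nhds, hUo.mem_nhds h0, hD'']
      with u hu hu' hu''
    rw [transformDefect_congr hu]
    have := (hU u hu').1.2
    unfold transformDefect at this ⊢
    rwa [hu'']
  · rw [jetCoord_eq_iff, eq_comm,
      jetAt_eq_iff_isBigO r (contDiffAt_christoffelForm D') (contDiffAt_christoffelForm D'')]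
    refine h2.congr' ?_ EventuallyEq.rfl
    filter_upwards [hD''] with u hu
    rw [hu]

end JetEquivalence

/-! ### Normal jets and linear intertwiners. -/

section NormalSymbols

open Asymptotics

universe u

variable {E F : Type u} [NormedAddCommGroup E] [NormedSpace ℝ E] [NormedAddCommGroup F]
  [NormedSpace ℝ F] {r : ℕ}

theorem transformDefect_continuousLinearEquiv (e : E ≃L[ℝ] E) (Γ Γ' : E → E →L[ℝ] E →L[ℝ] E)
    (u a b : E) : transformDefect e Γ Γ' u a b = e (Γ' u a b) - Γ (e u) (e a) (e b) := by
  have h : fderiv ℝ (e : E → E) = fun _ => (e : E →L[ℝ] E) := funext fun _ => e.fderiv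
  rw [transformDefect_apply, h]
  simp

theorem isDiffeoFixingZero_continuousLinearEquiv (e : E ≃L[ℝ] E) :
    IsDiffeoFixingZero e.toHomeomorph.toOpenPartialHomeomorph where
  mem_source := mem_univ _
  map_zero := e.map_zero
  smooth := e.contDiff.contDiffOn
  smooth_symm := e.symm.contDiff.contDiffOn

/-- Linear equivalences intertwining two families of symbols induce equivalent jets. -/
theorem jetRel_of_intertwining {q q' : SymbolJet E r} (e : E ≃L[ℝ] E)
    (h : ∀ (m : Fin (r + 1)) (w : Fin m → E) (a b : E),
      e (q' m w a b) = q m (fun i => e (w i)) (e a) (e b)) :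
    JetRel (r + 1) (jetPoly q) (jetPoly q') := by
  refine ⟨_, isDiffeoFixingZero_continuousLinearEquiv e, IsBigO.of_bound 1 ?_⟩
  refine Eventually.of_forall fun u => ?_
  have h2 : transformDefect e (jetPoly q) (jetPoly q') u = 0 := by
    ext a b
    rw [transformDefect_continuousLinearEquiv, jetPoly_apply₂, jetPoly_apply₂, map_sum]
    simp only [map_smul, h, sub_self, _root_.zero_apply]
  have h3 : ‖transformDefect e (jetPoly q) (jetPoly q') u‖ = 0 := by
    rw [h2]; exact ContinuousLinearMap.opNorm_zero
  change ‖transformDefect e (jetPoly q) (jetPoly q') u‖ ≤ _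
  rw [h3]
  positivity

/-- Symbols in normal coordinates. -/
def IsNormalJet (q : SymbolJet E r) : Prop :=
  ∀ (m : Fin (r + 1)) (u : E), q m (fun _ => u) u u = 0

theorem IsNormalJet.jetPoly_eq_zero {q : SymbolJet E r} (hq : IsNormalJet q) (u : E) :
    jetPoly q u u u = 0 := by
  rw [jetPoly_apply₂]
  exact Finset.sum_eq_zero fun m _ => by rw [hq, smul_zero]

/-- Equivalent jets of symbols in normal coordinates are intertwined by a linear equivalence. -/
theorem exists_intertwining {q q' : SymbolJet E r} (hq : IsSymmetricJet q)
    (hq' : IsSymmetricJet q') (hn : IsNormalJet q) (hn' : IsNormalJet q')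
    (h : JetRel (r + 1) (jetPoly q) (jetPoly q')) :
    ∃ e : E ≃L[ℝ] E, ∀ (m : Fin (r + 1)) (w : Fin m → E) (a b : E),
      e (q' m w a b) = q m (fun i => e (w i)) (e a) (e b) := by
  obtain ⟨τ, hτ, hd⟩ := h
  have h1 := transformDefect_fderiv_of_normal hτ (contDiff_jetPoly q).contDiffAt
    (contDiff_jetPoly q').contDiffAt hn.jetPoly_eq_zero hn'.jetPoly_eq_zero hd
  obtain ⟨e, he⟩ := hτ.isInvertible_fderiv hτ.mem_source
  rw [← he] at h1
  refine ⟨e, fun m w a b => ?_⟩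
  -- For fixed a and b both sides of the claim are coefficients of vector-valued Taylor polynomials,
  -- which coincide once the polynomials differ by O(|u|^(r+1)).
  let p : JetFamily E E r := fun k =>
    postcompMultilinear k ((e : E →L[ℝ] E).comp (evalBilin a b)) (q' k)
  let p' : JetFamily E E r := fun k => (postcompMultilinear k (evalBilin (e a) (e b))
    (q k)).compContinuousLinearMap fun _ => (e : E →L[ℝ] E)
  have hp : IsSymmetricJet p := fun k σ v => by
    change e (q' k (v ∘ σ) a b) = e (q' k v a b)
    rw [hq']
  have hp' : IsSymmetricJet p' := fun k σ v => by
    change q k ((fun i => e (v i)) ∘ σ) (e a) (e b) = q k (fun i => e (v i)) (e a) (e b)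
    rw [hq]
  have h2 : (fun u => jetPoly p u - jetPoly p' u) =O[𝓝 0] fun u => ‖u‖ ^ (r + 1) := by
    have hc : ∀ v : E, (fun _ : E => v) =O[𝓝 0] fun _ => (1 : ℝ) := fun v =>
      isBigO_const_const v one_ne_zero _
    have h3 := isBigO_apply₂ h1 (hc a) (hc b)
    simp only [mul_one] at h3
    refine h3.congr_left fun u => ?_
    refine (transformDefect_continuousLinearEquiv e (jetPoly q) (jetPoly q') u a b).trans ?_
    rw [jetPoly_apply₂, jetPoly_apply₂, map_sum]
    simp only [map_smul]
    rfl
  have h4 := (jetAt_eq_iff_isBigO r (contDiff_jetPoly p).contDiffAt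
    (contDiff_jetPoly p').contDiffAt).2 h2
  rw [jetAt_jetPoly hp, jetAt_jetPoly hp'] at h4
  exact DFunLike.congr_fun (congrFun h4 m) w

end NormalSymbols

/-! ### Normal jets as tensors. -/

section TensorsOfSymbols

universe u

/-- The space of `k`-linear maps from `E` to `F`. -/
abbrev MultilinearSpace (k : ℕ) (E F : Type u) [NormedAddCommGroup E] [NormedSpace ℝ E]
    [NormedAddCommGroup F] [NormedSpace ℝ F] : Type u :=
  E [×k]→L[ℝ] F

/-- Multilinear maps with values in linear maps, as multilinear maps with one more argument. -/
def uncurryValues (k : ℕ) (E F : Type u) [NormedAddCommGroup E] [NormedSpace ℝ E]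
    [NormedAddCommGroup F] [NormedSpace ℝ F] :
    MultilinearSpace k E (E →L[ℝ] F) ≃L[ℝ] (E [×(k + 1)]→L[ℝ] F) :=
  (ContinuousLinearMap.flipMultilinearEquiv ℝ (fun _ : Fin k => E) E F).symm.trans
    (continuousMultilinearCurryLeftEquiv ℝ (fun _ : Fin (k + 1) => E) F).symm.toContinuousLinearEquiv

variable {E F : Type u} [NormedAddCommGroup E] [NormedSpace ℝ E] [NormedAddCommGroup F]
  [NormedSpace ℝ F] {k : ℕ}

/-- The tensor corresponding to a derivative of Christoffel symbols. -/
def tensorOfSymbol (q : MultilinearSpace k E (E →L[ℝ] E →L[ℝ] E)) : E [×(k + 2)]→L[ℝ] E :=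
  uncurryValues (k + 1) E E (uncurryValues k E (E →L[ℝ] E) q)

/-- The family of bilinear-map-valued multilinear maps corresponding to a tensor. -/
def symbolOfTensor (T : E [×(k + 2)]→L[ℝ] E) : MultilinearSpace k E (E →L[ℝ] E →L[ℝ] E) :=
  (uncurryValues k E (E →L[ℝ] E)).symm ((uncurryValues (k + 1) E E).symm T)

/-- The currying exchanges the first two slots relative to Γᵏᵢⱼ. This is harmless: neither the
conditions on the tensors nor the linear action distinguish these slots. -/
theorem symbolOfTensor_apply (T : E [×(k + 2)]→L[ℝ] E) (w : Fin k → E) (a b : E) :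
    symbolOfTensor T w a b = T (Fin.cons b (Fin.cons a w)) := rfl

theorem contDiff_tensorOfSymbol :
    ContDiff ℝ ∞ (tensorOfSymbol : MultilinearSpace k E (E →L[ℝ] E →L[ℝ] E) → E [×(k + 2)]→L[ℝ] E) :=
  (uncurryValues (k + 1) E E).contDiff.comp (uncurryValues k E (E →L[ℝ] E)).contDiff

theorem contDiff_symbolOfTensor :
    ContDiff ℝ ∞ (symbolOfTensor : (E [×(k + 2)]→L[ℝ] E) → MultilinearSpace k E (E →L[ℝ] E →L[ℝ] E)) :=
  (uncurryValues k E (E →L[ℝ] E)).symm.contDiff.comp (uncurryValues (k + 1) E E).symm.contDiff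

theorem tensorOfSymbol_symbolOfTensor (T : E [×(k + 2)]→L[ℝ] E) :
    tensorOfSymbol (symbolOfTensor T) = T := by
  simp [tensorOfSymbol, symbolOfTensor]

theorem symbolOfTensor_tensorOfSymbol (q : MultilinearSpace k E (E →L[ℝ] E →L[ℝ] E)) :
    symbolOfTensor (tensorOfSymbol q) = q := by
  simp [tensorOfSymbol, symbolOfTensor]

/-- The symmetrization vanishes iff the tensor vanishes on the diagonal. At equal arguments the sum
is a nonzero multiple of T(u,…,u); conversely the sum is the (k+2)-th derivative of u ↦ T(u,…,u). -/
theorem mem_normalTensors_iff (T : E [×(k + 2)]→L[ℝ] E) :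
    T ∈ normalTensors E k ↔
      (∀ (σ : Equiv.Perm (Fin k)) (w : Fin k → E),
        symbolOfTensor T (w ∘ σ) = symbolOfTensor T w) ∧
      ∀ u : E, symbolOfTensor T (fun _ => u) u u = 0 := by
  have hc : ∀ u : E, (Fin.cons u (Fin.cons u fun _ : Fin k => u) : Fin (k + 2) → E) =
      fun _ => u := fun u => by
    funext i
    refine Fin.cases rfl (fun i => ?_) i
    refine Fin.cases rfl (fun i => rfl) i
  constructor
  · rintro ⟨h1, h2⟩
    refine ⟨fun σ w => ?_, fun u => ?_⟩
    · ext a b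
      rw [symbolOfTensor_apply, symbolOfTensor_apply, h1]
    · have h3 := h2 fun _ => u
      simp only [Function.comp_def, Finset.sum_const, Finset.card_univ] at h3
      rw [symbolOfTensor_apply, hc]
      rw [← Nat.cast_smul_eq_nsmul ℝ, smul_eq_zero] at h3
      exact h3.resolve_left (Nat.cast_ne_zero.2 Fintype.card_ne_zero)
  · rintro ⟨h1, h2⟩
    refine ⟨fun σ u v w => ?_, fun v => ?_⟩
    · rw [← symbolOfTensor_apply, ← symbolOfTensor_apply, h1]
    · have h3 := T.iteratedFDeriv_comp_diagonal 0 v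
      have h4 : (fun u : E => T fun _ => u) = fun _ => 0 := funext fun u => by
        rw [← hc u, ← symbolOfTensor_apply, h2]
      rw [h4] at h3
      exact h3.symm.trans (by simp)

end TensorsOfSymbols

/-! ### Morphisms between quotient ringed spaces. -/

section RingedMorphisms

variable {X Y A B P Q : Type*} [TopologicalSpace X] [TopologicalSpace Y] [TopologicalSpace A]
  [TopologicalSpace B] [NormedAddCommGroup P] [NormedSpace ℝ P] [NormedAddCommGroup Q]
  [NormedSpace ℝ Q]

/-- A continuous map between quotients that lifts to a smooth map is a morphism of ringed
spaces. -/
theorem isRingedMorphism_of_lift {c : X → P} {c' : Y → Q} {πX : C(X, A)} {πY : C(Y, B)}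
    {φ : C(A, B)} {h : X → Y} (hh : Continuous h) {G : P → Q} (hG : ContDiff ℝ ∞ G)
    (hc : ∀ p, c' (h p) = G (c p)) (hφ : ∀ p, φ (πX p) = πY (h p)) :
    IsRingedMorphism ((smoothFunSheaf c).direct πX) ((smoothFunSheaf c').direct πY) φ := by
  intro V f hf p
  have hm : ∀ q : Opens.comap πX (Opens.comap φ V), h q ∈ Opens.comap πY V := fun q => by
    have := q.2
    change φ (πX q) ∈ V at this
    rw [hφ] at this
    exact this
  let H : Opens.comap πX (Opens.comap φ V) → Opens.comap πY V := fun q => ⟨h q, hm q⟩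
  have hH : Continuous H := (hh.comp continuous_subtype_val).subtype_mk _
  obtain ⟨g, hg, hgf⟩ := hf (H p)
  -- A smooth function representing a section near the image point represents the pulled back
  -- section after composition with G.
  refine ⟨g ∘ G, hg.comp hG, ?_⟩
  filter_upwards [hH.continuousAt.eventually hgf] with q hq
  rw [Function.comp_apply, ← hc]
  refine Eq.trans ?_ hq
  exact congrArg f (Subtype.ext (hφ q))

end RingedMorphisms

/-! ### Smoothness on products and subspaces; linear projections. -/

section SymbolJets

universe u

theorem jetRel_jetPoly_jetAt {E : Type u} [NormedAddCommGroup E] [NormedSpace ℝ E] (r : ℕ)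
    {Γ : E → E →L[ℝ] E →L[ℝ] E} (hΓ : ContDiffAt ℝ ∞ Γ 0) :
    JetRel (r + 1) Γ (jetPoly (jetAt r Γ)) :=
  JetRel.of_isBigO ((isBigO_sub_jetPoly r hΓ).neg_left.congr_left fun u => by rw [neg_sub])

theorem contDiff_pi_map {ι : Type*} [Fintype ι] {A B : ι → Type*} [∀ i, NormedAddCommGroup (A i)]
    [∀ i, NormedSpace ℝ (A i)] [∀ i, NormedAddCommGroup (B i)] [∀ i, NormedSpace ℝ (B i)]
    {f : ∀ i, A i → B i} (hf : ∀ i, ContDiff ℝ ∞ (f i)) :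
    ContDiff ℝ ∞ fun (v : ∀ i, A i) i => f i (v i) :=
  contDiff_pi.2 fun i => (hf i).comp (contDiff_pi.1 contDiff_id i)

theorem contDiff_submodule_coe {V W : Type*} [NormedAddCommGroup V] [NormedSpace ℝ V]
    [NormedAddCommGroup W] [NormedSpace ℝ W] (S : Submodule ℝ V) {f : V → W}
    (hf : ContDiff ℝ ∞ f) : ContDiff ℝ ∞ fun v : S => f v :=
  hf.comp S.subtypeL.contDiff

end SymbolJets

section FiniteDimension

instance finiteDimensional_continuousMultilinearMap {E F : Type*} [NormedAddCommGroup E]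
    [NormedSpace ℝ E] [FiniteDimensional ℝ E] [NormedAddCommGroup F] [NormedSpace ℝ F]
    [FiniteDimensional ℝ F] (k : ℕ) : FiniteDimensional ℝ (E [×k]→L[ℝ] F) :=
  Module.Finite.of_injective
    (ContinuousMultilinearMap.toMultilinearMapLinear (R' := ℝ) (A := ℝ) (M₁ := fun _ : Fin k => E)
      (M₂ := F)) ContinuousMultilinearMap.toMultilinearMap_injective

/-- Serves to extend the passage from normal jets to tensors smoothly to all jets, as required of a
global lift. -/
theorem exists_continuous_projection {V : Type*} [NormedAddCommGroup V] [NormedSpace ℝ V]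
    [FiniteDimensional ℝ V] (S : Submodule ℝ V) : ∃ P : V →L[ℝ] S, ∀ v : S, P v = v := by
  obtain ⟨P, hP⟩ := S.subtype.exists_leftInverse_of_injective (by simp)
  exact ⟨LinearMap.toContinuousLinearMap P, fun v => DFunLike.congr_fun hP v⟩

end FiniteDimension

/-! ### The moduli spaces as orbit spaces. -/

section ModuliSpaces

variable {n r : ℕ} {M : Type*} [TopologicalSpace M] [ChartedSpace (EuclideanSpace ℝ (Fin n)) M]
  [IsManifold (𝓡 n) ∞ M] {x : M} {C : Set (LocalConnection n x)}

theorem JetSpace.exists_rep (j : JetSpace r C) : ∃ D : C, jet r D = j :=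
  Quotient.exists_rep j

theorem symbolsOfCoord_coord_jet (D : C) :
    symbolsOfCoord (JetSpace.coord r C (jet r D)) = jetAt r (christoffelForm D.1) :=
  symbolsOfCoord_jetCoord r D.1

theorem isSymmetricJet_coord (j : JetSpace r C) :
    IsSymmetricJet (symbolsOfCoord (JetSpace.coord r C j)) := by
  obtain ⟨D, rfl⟩ := j.exists_rep
  rw [symbolsOfCoord_coord_jet]
  exact isSymmetricJet_jetAt r (contDiffAt_christoffelForm D.1)

theorem isTorsionFreeJet_coord (hC : C ⊆ symmetricConnections n x) (j : JetSpace r C) :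
    IsTorsionFreeJet (symbolsOfCoord (JetSpace.coord r C j)) := by
  obtain ⟨D, rfl⟩ := j.exists_rep
  rw [symbolsOfCoord_coord_jet]
  exact isTorsionFreeJet_jetAt (contDiffAt_christoffelForm D.1)
    (eventually_christoffelForm_symmetric (hC D.2))

theorem jetRel_christoffelForm_coord (D : C) :
    JetRel (r + 1) (christoffelForm D.1)
      (jetPoly (symbolsOfCoord (JetSpace.coord r C (jet r D)))) := by
  rw [symbolsOfCoord_coord_jet]
  exact jetRel_jetPoly_jetAt r (contDiffAt_christoffelForm D.1)

/-- The choice of representatives is immaterial: a connection differs from its Taylor polynomial by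
O(|u|^(r+1)). -/
theorem jetRel_of_jetEquiv {j j' : JetSpace r C} (h : JetEquiv r C j j') :
    JetRel (r + 1) (jetPoly (symbolsOfCoord (JetSpace.coord r C j)))
      (jetPoly (symbolsOfCoord (JetSpace.coord r C j'))) := by
  obtain ⟨τ, D, D', hD, rfl, rfl⟩ := h
  exact (jetRel_christoffelForm_coord D).symm.trans
    ((hD.jetRel (r + 1)).trans (jetRel_christoffelForm_coord D'))

/-- The proposition b selects the class: false gives all connections, true the symmetric ones. The
exact transform stays in the class, so it represents the target jet there. -/
theorem jetEquiv_of_jetRel {b : Prop}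
    (hC : ∀ D, D ∈ C ↔ (b → D ∈ symmetricConnections n x)) {j j' : JetSpace r C}
    (h : JetRel (r + 1) (jetPoly (symbolsOfCoord (JetSpace.coord r C j)))
      (jetPoly (symbolsOfCoord (JetSpace.coord r C j')))) : JetEquiv r C j j' := by
  obtain ⟨D, rfl⟩ := j.exists_rep
  obtain ⟨D', rfl⟩ := j'.exists_rep
  obtain ⟨τ, D'', h1, h2, h3⟩ := JetRel.exists_isTransform ((jetRel_christoffelForm_coord D).trans
    (h.trans (jetRel_christoffelForm_coord D').symm))
  exact ⟨τ, D, ⟨D'', (hC D'').2 fun hb => h3 ((hC D.1).1 D.2 hb)⟩, h1, rfl, Quotient.sound h2⟩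

/-- The Taylor polynomial itself serves as Christoffel symbols on the whole chart. -/
theorem exists_jet_of_symbols {b : Prop}
    (hC : ∀ D, D ∈ C ↔ (b → D ∈ symmetricConnections n x))
    {q : SymbolJet (EuclideanSpace ℝ (Fin n)) r} (hq : IsSymmetricJet q)
    (hq' : b → IsTorsionFreeJet q) :
    ∃ j : JetSpace r C, JetSpace.coord r C j = coordOfSymbols q := by
  obtain ⟨D, hD, hD'⟩ := exists_localConnection x (Γ := jetPoly q) isOpen_univ (mem_univ _)
    fun u _ => (contDiff_jetPoly q).contDiffAt
  refine ⟨jet r ⟨D, (hC D).2 fun hb => hD' fun u _ => jetPoly_torsionFree (hq' hb) u⟩, ?_⟩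
  rw [← coordOfSymbols_symbolsOfCoord (JetSpace.coord r C _), symbolsOfCoord_coord_jet]
  congr 1
  refine Eq.trans (funext fun k => ?_) (jetAt_jetPoly hq)
  exact (EventuallyEq.iteratedFDeriv ℝ hD k).eq_of_nhds

section Tensors

variable {b : Prop} {S : ∀ m : ℕ, Submodule ℝ (EuclideanSpace ℝ (Fin n) [×(m + 2)]→L[ℝ]
  EuclideanSpace ℝ (Fin n))}

/-- The jet of Christoffel symbols corresponding to a family of tensors. -/
def symbolsOfTensors (T : ∀ m : Fin (r + 1), S m) : SymbolJet (EuclideanSpace ℝ (Fin n)) r :=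
  fun m => symbolOfTensor (T m).1

theorem contDiff_symbolsOfTensors :
    ContDiff ℝ ∞ (symbolsOfTensors : (∀ m : Fin (r + 1), S m) → _) :=
  contDiff_pi_map (ι := Fin (r + 1)) (A := fun m => S m)
    (f := fun m (T : S m) => symbolOfTensor T.1)
    fun m => contDiff_submodule_coe (S m) contDiff_symbolOfTensor

theorem symbolsOfTensors_properties
    (hS : ∀ m T, T ∈ S m ↔ T ∈ normalTensors (EuclideanSpace ℝ (Fin n)) m ∧
      (b → ∀ (u v : EuclideanSpace ℝ (Fin n)) (w : Fin m → EuclideanSpace ℝ (Fin n)),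
        T (Fin.cons u (Fin.cons v w)) = T (Fin.cons v (Fin.cons u w))))
    (T : ∀ m : Fin (r + 1), S m) :
    IsSymmetricJet (symbolsOfTensors T) ∧ IsNormalJet (symbolsOfTensors T) ∧
      (b → IsTorsionFreeJet (symbolsOfTensors T)) := by
  refine ⟨fun m => ?_, fun m => ?_, fun hb m w u v => ?_⟩
  · exact ((mem_normalTensors_iff _).1 ((hS m _).1 (T m).2).1).1
  · exact ((mem_normalTensors_iff _).1 ((hS m _).1 (T m).2).1).2
  · exact ((hS m _).1 (T m).2).2 hb v u w

theorem tensorOfSymbol_mem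
    (hS : ∀ m T, T ∈ S m ↔ T ∈ normalTensors (EuclideanSpace ℝ (Fin n)) m ∧
      (b → ∀ (u v : EuclideanSpace ℝ (Fin n)) (w : Fin m → EuclideanSpace ℝ (Fin n)),
        T (Fin.cons u (Fin.cons v w)) = T (Fin.cons v (Fin.cons u w))))
    {q : SymbolJet (EuclideanSpace ℝ (Fin n)) r} (hq : IsSymmetricJet q) (hn : IsNormalJet q)
    (ht : b → IsTorsionFreeJet q) (m : Fin (r + 1)) : tensorOfSymbol (q m) ∈ S m := by
  refine (hS m _).2 ⟨(mem_normalTensors_iff _).2 ?_, fun hb u v w => ht hb m w v u⟩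
  rw [symbolOfTensor_tensorOfSymbol]
  exact ⟨hq m, hn m⟩

/-- Moving g to the other side turns the action on tensors into the intertwining condition for jets,
with g⁻¹ as the linear change of coordinates. -/
theorem productRep_eq_iff
    (hinv : ∀ (m : ℕ) (g : EuclideanSpace ℝ (Fin n) ≃L[ℝ] EuclideanSpace ℝ (Fin n)),
      S m ≤ (S m).comap (tensorRep (EuclideanSpace ℝ (Fin n)) (m + 2) g))
    (g : EuclideanSpace ℝ (Fin n) ≃L[ℝ] EuclideanSpace ℝ (Fin n))
    (T T' : ∀ m : Fin (r + 1), S m) :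
    productRep r S hinv g T = T' ↔ ∀ (m : Fin (r + 1)) (w : Fin m → EuclideanSpace ℝ (Fin n))
      (a c : EuclideanSpace ℝ (Fin n)), g.symm (symbolsOfTensors T' m w a c) =
        symbolsOfTensors T m (fun i => g.symm (w i)) (g.symm a) (g.symm c) := by
  have key : ∀ (m : Fin (r + 1)) (w : Fin m → EuclideanSpace ℝ (Fin n))
      (a c : EuclideanSpace ℝ (Fin n)), symbolsOfTensors (productRep r S hinv g T) m w a c =
      g (symbolsOfTensors T m (fun i => g.symm (w i)) (g.symm a) (g.symm c)) := by
    intro m w a c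
    change g ((T m).1 fun i => g.symm ((Fin.cons c (Fin.cons a w) : Fin (m + 2) → _) i)) = _
    rw [comp_cons_cons]
    rfl
  constructor
  · rintro rfl m w a c
    rw [key, g.symm_apply_apply]
  · intro h
    funext m
    apply Subtype.ext
    rw [← tensorOfSymbol_symbolOfTensor (T' m).1,
      ← tensorOfSymbol_symbolOfTensor (productRep r S hinv g T m).1]
    congr 1
    refine ContinuousMultilinearMap.ext fun w => ContinuousLinearMap.ext fun a =>
      ContinuousLinearMap.ext fun c => ?_
    refine (key m w a c).trans ?_
    rw [← h, g.apply_symm_apply]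
    rfl

/-- Tensors are read off by uncurrying and then projected onto the subspaces; the projection does
nothing to normal jets, the only ones for which a left-over condition must hold. -/
theorem exists_tensorsOfSymbols
    (hS : ∀ m T, T ∈ S m ↔ T ∈ normalTensors (EuclideanSpace ℝ (Fin n)) m ∧
      (b → ∀ (u v : EuclideanSpace ℝ (Fin n)) (w : Fin m → EuclideanSpace ℝ (Fin n)),
        T (Fin.cons u (Fin.cons v w)) = T (Fin.cons v (Fin.cons u w)))) :
    ∃ t : SymbolJet (EuclideanSpace ℝ (Fin n)) r → ∀ m : Fin (r + 1), S m, ContDiff ℝ ∞ t ∧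
      ∀ q, IsSymmetricJet q → IsNormalJet q → (b → IsTorsionFreeJet q) →
        symbolsOfTensors (t q) = q := by
  choose pr hpr using fun m : Fin (r + 1) => exists_continuous_projection (S m)
  refine ⟨fun q m => pr m (tensorOfSymbol (q m)),
    contDiff_pi_map fun m => (pr m).contDiff.comp contDiff_tensorOfSymbol,
    fun q hq hn ht => funext fun m => ?_⟩
  have h1 := hpr m ⟨_, tensorOfSymbol_mem hS hq hn ht m⟩
  change symbolOfTensor (pr m _).1 = _
  rw [h1, symbolOfTensor_tensorOfSymbol]

end Tensors

/-- The moduli space of jets of connections is the orbit space of any representation that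
parametrizes equivariantly the jets in normal coordinates. -/
theorem ringedIsomorphic_moduliSheaf {b : Prop}
    (hC : ∀ D, D ∈ C ↔ (b → D ∈ symmetricConnections n x))
    {W : Type*} [NormedAddCommGroup W] [NormedSpace ℝ W]
    (ρ : Representation ℝ (EuclideanSpace ℝ (Fin n) ≃L[ℝ] EuclideanSpace ℝ (Fin n)) W)
    {s : W → SymbolJet (EuclideanSpace ℝ (Fin n)) r} (hs : ContDiff ℝ ∞ s)
    (hs' : ∀ T, IsSymmetricJet (s T) ∧ IsNormalJet (s T) ∧ (b → IsTorsionFreeJet (s T)))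
    {t : SymbolJet (EuclideanSpace ℝ (Fin n)) r → W} (ht : ContDiff ℝ ∞ t)
    (hst : ∀ q, IsSymmetricJet q → IsNormalJet q → (b → IsTorsionFreeJet q) → s (t q) = q)
    (hρ : ∀ g T T', ρ g T = T' ↔ ∀ (m : Fin (r + 1)) (w : Fin m → EuclideanSpace ℝ (Fin n))
      (a c : EuclideanSpace ℝ (Fin n)), g.symm (s T' m w a c) =
        s T m (fun i => g.symm (w i)) (g.symm a) (g.symm c)) :
    RingedIsomorphic (moduliSheaf r C) (orbitSheaf ρ) := by
  obtain ⟨Φ, hΦ, hΦ'⟩ := exists_normalization (E := EuclideanSpace ℝ (Fin n)) r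
  -- Both lifts are defined on the full coordinate spaces, as the sheaf of smooth functions
  -- requires, although actual jets satisfy symmetry conditions.
  let G : JetCoordSpace n r → W := fun c => t (Φ (symbolsOfCoord c))
  let G' : W → JetCoordSpace n r := fun T => coordOfSymbols (s T)
  have hG : ContDiff ℝ ∞ G := ht.comp (hΦ.comp contDiff_symbolsOfCoord)
  have hG' : ContDiff ℝ ∞ G' := contDiff_coordOfSymbols.comp hs
  have hex : ∀ T, ∃ j : JetSpace r C, JetSpace.coord r C j = G' T :=
    fun T => exists_jet_of_symbols hC (hs' T).1 (hs' T).2.2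
  choose h' hh' using hex
  let h : JetSpace r C → W := fun j => G (JetSpace.coord r C j)
  have hcont : Continuous h := hG.continuous.comp continuous_induced_dom
  have hcont' : Continuous h' := by
    refine continuous_induced_rng.2 ?_
    have : JetSpace.coord r C ∘ h' = G' := funext hh'
    rw [this]
    exact hG'.continuous
  have hsymb : ∀ j, s (h j) = Φ (symbolsOfCoord (JetSpace.coord r C j)) := fun j =>
    hst _ ((hΦ' _).2.1 (isSymmetricJet_coord j)) (hΦ' _).2.2.2
      fun hb => (hΦ' _).2.2.1 (isTorsionFreeJet_coord (fun D hD => (hC D).1 hD hb) j)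
  have hsymb' : ∀ T, symbolsOfCoord (JetSpace.coord r C (h' T)) = s T := fun T => by
    rw [hh', symbolsOfCoord_coordOfSymbols]
  -- Uniqueness of normal forms: equivalent normal jets lie in one orbit. It makes φ well defined.
  have horbit : ∀ T T', JetRel (r + 1) (jetPoly (s T)) (jetPoly (s T')) →
      Quotient.mk (orbitSetoid ρ) T = Quotient.mk _ T' := by
    intro T T' hT
    obtain ⟨e, he⟩ := exists_intertwining (hs' T).1 (hs' T').1 (hs' T).2.1 (hs' T').2.1 hT
    exact Quotient.sound ⟨e.symm, (hρ e.symm T T').2 he⟩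
  -- Existence of normal forms: each jet is equivalent to the one it is sent to. This makes both
  -- composites the identity on classes.
  have hrel : ∀ j, JetRel (r + 1) (jetPoly (symbolsOfCoord (JetSpace.coord r C j)))
      (jetPoly (s (h j))) := fun j => by
    rw [hsymb]
    exact (hΦ' _).1
  let φ : C(ModuliSpace r C, OrbitSpace ρ) :=
    ⟨Quot.lift (fun j => Quotient.mk _ (h j)) fun j j' hj => horbit _ _
      ((hrel j).symm.trans ((jetRel_of_jetEquiv hj).trans (hrel j'))),
      continuous_quot_lift _ (continuous_quot_mk.comp hcont)⟩
  let ψ : C(OrbitSpace ρ, ModuliSpace r C) :=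
    ⟨Quotient.lift (fun T => Quot.mk _ (h' T)) (by
      rintro T T' ⟨g, hg⟩
      refine Quot.sound (jetEquiv_of_jetRel hC ?_)
      rw [hsymb', hsymb']
      exact jetRel_of_intertwining g.symm ((hρ g T T').1 hg)),
      (continuous_quot_mk.comp hcont').quotient_lift _⟩
  refine ⟨φ, ψ, isRingedMorphism_of_lift hcont hG (fun _ => rfl) fun _ => rfl,
    isRingedMorphism_of_lift hcont' hG' hh' fun _ => rfl, ?_, ?_⟩
  · ext T
    refine Quotient.inductionOn T fun T => ?_
    refine horbit _ _ ?_
    have := (hrel (h' T)).symm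
    rwa [hsymb'] at this
  · ext j
    refine Quot.inductionOn j fun j => ?_
    refine Quot.sound (jetEquiv_of_jetRel hC ?_)
    rw [hsymb']
    exact (hrel j).symm

end ModuliSpaces

end

theorem theorem3p3 (n r : ℕ) {M : Type*} [TopologicalSpace M]
    [ChartedSpace (EuclideanSpace ℝ (Fin n)) M] [IsManifold (𝓡 n) ∞ M] (x : M) :
    RingedIsomorphic (moduliSheaf r (allConnections n x))
      (orbitSheaf (normalRep (EuclideanSpace ℝ (Fin n)) r)) ∧
    RingedIsomorphic (moduliSheaf r (symmetricConnections n x))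
      (orbitSheaf (symmetricNormalRep (EuclideanSpace ℝ (Fin n)) r)) := by
  constructor
  -- With b false the symmetry conditions are vacuous; below, b true imposes them on connections and
  -- tensors alike.
  · have hS : ∀ m T, T ∈ normalTensors (EuclideanSpace ℝ (Fin n)) m ↔
        T ∈ normalTensors (EuclideanSpace ℝ (Fin n)) m ∧ (False →
          ∀ (u v : EuclideanSpace ℝ (Fin n)) (w : Fin m → EuclideanSpace ℝ (Fin n)),
            T (Fin.cons u (Fin.cons v w)) = T (Fin.cons v (Fin.cons u w))) :=
      fun m T => (and_iff_left False.elim).symm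
    obtain ⟨t, ht, hst⟩ := exists_tensorsOfSymbols (r := r) hS
    exact ringedIsomorphic_moduliSheaf (fun D => iff_of_true trivial False.elim)
      (normalRep (EuclideanSpace ℝ (Fin n)) r) contDiff_symbolsOfTensors
      (symbolsOfTensors_properties hS) ht hst (productRep_eq_iff normalTensors_invariant)
  · have hS : ∀ m T, T ∈ symmetricNormalTensors (EuclideanSpace ℝ (Fin n)) m ↔
        T ∈ normalTensors (EuclideanSpace ℝ (Fin n)) m ∧ (True →
          ∀ (u v : EuclideanSpace ℝ (Fin n)) (w : Fin m → EuclideanSpace ℝ (Fin n)),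
            T (Fin.cons u (Fin.cons v w)) = T (Fin.cons v (Fin.cons u w))) :=
      fun m T => and_congr_right' ⟨fun h _ => h, fun h => h trivial⟩
    obtain ⟨t, ht, hst⟩ := exists_tensorsOfSymbols (r := r) hS
    exact ringedIsomorphic_moduliSheaf (fun D => ⟨fun h _ => h, fun h => h trivial⟩)
      (symmetricNormalRep (EuclideanSpace ℝ (Fin n)) r) contDiff_symbolsOfTensors
      (symbolsOfTensors_properties hS) ht hst (productRep_eq_iff symmetricNormalTensors_invariant)
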